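/- Let $F_{14}=\mathbb{F}_2[t]/(t^{14}+t^{13}+t^{11}+t^{10}+t^8+t^6+t^4+t+1)$ and $F_5=\mathbb{F}_2[t]/(t^5+t^3+t^2+t+1)$, and consider the points $$P=(0:0:1)\in\mathbb{P}^2(\mathbb{F}_2),\quad Q=(t^{11898}:t^{137}:1)\in\mathbb{P}^2(F_{14}),\quad R=(t^6:t^{15}:1)\in\mathbb{P}^2(F_5),$$ with Frobenius conjugates $Q_1,\dots,Q_{14}$ of $Q$ and $R_1,\dots,R_5$ of $R$. Let $W$ be the $\mathbb{F}_2$-vector space of forms of degree $9$ in $\mathbb{F}_2[x,y,z]$ that have multiplicity at least $3$ at $P$, at least $2$ at every $Q_i$ and at least $1$ at every $R_i$. Then $\dim W=5$. Choose any basis of $W$, let $S\subset\mathbb{P}^4$ be the closure of the image of the rational map $\mathbb{P}^2\dashrightarrow\mathbb{P}^4$ over $\mathbb{F}_2$ that it defines (so the ideal $I_S$ is the kernel of $\mathbb{F}_2[x_0,\dots,x_4]\to\mathbb{F}_2[x,y,z]$, $x_i\mapsto$ the $i$-th basis element), and for a field $K\supseteq\mathbb{F}_2$ let $S_K\subset\mathbb{P}^4_K$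 be its base change, with ideal $I_{S_K}$. For a closed subscheme $X\subset\mathbb{P}^4_K$, an $n$-secant of $X$ is a line $L\subset\mathbb{P}^4_K$ such that the scheme $L\cap X$ is finite of length exactly $n$. Then, for every field $K\supseteq\mathbb{F}_2$: 1. $S_K$ has exactly two $6$-secants, and it has no $n$-secant for any $n>6$. 2. The common zero locus in $\mathbb{P}^4(K)$ of the forms of degree at most $5$ in $I_{S_K}$ is the union of $S_K(K)$ and the two $6$-secants. 3. In particular, if $\mathcal{F}$ is any family (that is, any class) of closed subschemes of $\mathbb{P}^4_K$, each of which has $0$, $1$ or infinitely many $6$-secants, then no subscheme projectively equivalent to $S_K$ belongs to $\mathcal{F}$. -/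

import Mathlib

namespace SecantSurface

open MvPolynomial

noncomputable section

/-- The field with `2 ^ 14` elements, realized as
`𝔽₂[t] / (t¹⁴ + t¹³ + t¹¹ + t¹⁰ + t⁸ + t⁶ + t⁴ + t + 1)`. -/
abbrev F14 : Type :=
  AdjoinRoot (Polynomial.X ^ 14 + Polynomial.X ^ 13 + Polynomial.X ^ 11 + Polynomial.X ^ 10 +
    Polynomial.X ^ 8 + Polynomial.X ^ 6 + Polynomial.X ^ 4 + Polynomial.X + 1 :
      Polynomial (ZMod 2))

/-- The field with `2 ^ 5` elements, realized as `𝔽₂[t] / (t⁵ + t³ + t² + t + 1)`. -/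
abbrev F5 : Type :=
  AdjoinRoot (Polynomial.X ^ 5 + Polynomial.X ^ 3 + Polynomial.X ^ 2 + Polynomial.X + 1 :
      Polynomial (ZMod 2))

/-- The class of the variable `t` in `F14`. -/
def t14 : F14 := AdjoinRoot.root _

/-- The class of the variable `t` in `F5`. -/
def t5 : F5 := AdjoinRoot.root _

/-- The point `P = (0 : 0 : 1)`. -/
def pointP : Fin 3 → ZMod 2 := ![0, 0, 1]

/-- The point `Q = (t ^ 11898 : t ^ 137 : 1)`. -/
def pointQ : Fin 3 → F14 := ![t14 ^ 11898, t14 ^ 137, 1]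

/-- The point `R = (t ^ 6 : t ^ 15 : 1)`. -/
def pointR : Fin 3 → F5 := ![t5 ^ 6, t5 ^ 15, 1]

/-- The `i`-th conjugate of a point under the Frobenius endomorphism `a ↦ a ^ 2`. -/
def frobConj {A : Type*} [CommRing A] (p : Fin 3 → A) (i : ℕ) : Fin 3 → A :=
  fun j => p j ^ (2 ^ i)

/-- The homogeneous ideal of the point `p = (p₀ : p₁ : p₂)` of the projective plane, generated by
the `2 × 2` minors `pᵢ xⱼ - pⱼ xᵢ`. -/
def pointIdeal {A : Type*} [CommRing A] (p : Fin 3 → A) : Ideal (MvPolynomial (Fin 3) A) :=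
  Ideal.span (Set.range fun ij : Fin 3 × Fin 3 => C (p ij.1) * X ij.2 - C (p ij.2) * X ij.1)

/-- The polynomials over `𝔽₂` in three variables with multiplicity at least `m` at the point `p`,
i.e. those lying in the `m`-th power of the ideal of `p` after extension of scalars. -/
def multAtLeast {A : Type*} [CommRing A] [Algebra (ZMod 2) A] (p : Fin 3 → A) (m : ℕ) :
    Submodule (ZMod 2) (MvPolynomial (Fin 3) (ZMod 2)) :=
  (Ideal.comap (MvPolynomial.map (algebraMap (ZMod 2) A)) (pointIdeal p ^ m)).restrictScalars
    (ZMod 2)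

/-- The linear system `|9L - 3P - 2Q₁ - ⋯ - 2Q₁₄ - R₁ - ⋯ - R₅|` over `𝔽₂`, as a vector space of
ternary forms of degree `9`. -/
def nonics : Submodule (ZMod 2) (MvPolynomial (Fin 3) (ZMod 2)) :=
  homogeneousSubmodule (Fin 3) (ZMod 2) 9 ⊓ multAtLeast pointP 3 ⊓
    (⨅ i : Fin 14, multAtLeast (frobConj pointQ i) 2) ⊓
    (⨅ i : Fin 5, multAtLeast (frobConj pointR i) 1)

/-- The homogeneous ideal of the surface `S ⊂ ℙ⁴` over `𝔽₂`: the closure of the image of the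
rational map `ℙ² ⇢ ℙ⁴` given by a basis of the linear system `nonics`. -/
def surfaceIdeal (b : Module.Basis (Fin 5) (ZMod 2) nonics) :
    Ideal (MvPolynomial (Fin 5) (ZMod 2)) :=
  RingHom.ker (aeval (R := ZMod 2) fun i => (b i : MvPolynomial (Fin 3) (ZMod 2)))

/-- The homogeneous ideal of the base change `S_K ⊂ ℙ⁴_K` of `S`. -/
def surfaceIdealOver (b : Module.Basis (Fin 5) (ZMod 2) nonics)
    (K : Type*) [Field K] [Algebra (ZMod 2) K] : Ideal (MvPolynomial (Fin 5) K) :=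
  (surfaceIdeal b).map (MvPolynomial.map (algebraMap (ZMod 2) K))

variable {K : Type*} [Field K]

/-- The Hilbert function of the closed subscheme of `ℙ⁴` with homogeneous ideal `I`: the dimension
of the degree `d` part of the homogeneous coordinate ring. -/
def hilbertFn (I : Ideal (MvPolynomial (Fin 5) K)) (d : ℕ) : ℕ :=
  Module.finrank K (homogeneousSubmodule (Fin 5) K d ⧸
    (I.restrictScalars K).comap (homogeneousSubmodule (Fin 5) K d).subtype)

/-- The closed subscheme of `ℙ⁴` with homogeneous ideal `I` is finite of length `n`, i.e. its
Hilbert polynomial is the constant `n`. -/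
def HasLength (I : Ideal (MvPolynomial (Fin 5) K)) (n : ℕ) : Prop :=
  ∀ᶠ d in Filter.atTop, hilbertFn I d = n

/-- The homogeneous ideal of the linear subspace of `ℙ⁴` given by the vector subspace `L` of `K⁵`,
generated by the linear forms that vanish on `L`. -/
def linearIdeal (L : Submodule K (Fin 5 → K)) : Ideal (MvPolynomial (Fin 5) K) :=
  Ideal.span {f | f.IsHomogeneous 1 ∧ ∀ v ∈ L, eval v f = 0}

/-- The `n`-secant lines of the closed subscheme `X ⊂ ℙ⁴` with homogeneous ideal `I`: the lines `L`
of `ℙ⁴` (two-dimensional subspaces of `K⁵`) whose scheme-theoretic intersection with `X` is finite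
of length `n`. -/
def secants (n : ℕ) (I : Ideal (MvPolynomial (Fin 5) K)) : Set (Submodule K (Fin 5 → K)) :=
  {L | Module.finrank K L = 2 ∧ HasLength (I ⊔ linearIdeal L) n}

/-- The affine cone in `K⁵` over the set of `K`-rational points of the closed subscheme of `ℙ⁴`
with homogeneous ideal `I`. -/
def cone (I : Ideal (MvPolynomial (Fin 5) K)) : Set (Fin 5 → K) :=
  {v | ∀ f ∈ I, eval v f = 0}

/-- The ideal generated by the forms of degree at most `5` in `I`. -/
def quinticPart (I : Ideal (MvPolynomial (Fin 5) K)) : Ideal (MvPolynomial (Fin 5) K) :=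
  Ideal.span {f | f ∈ I ∧ ∃ d ≤ 5, f.IsHomogeneous d}

/-- The closed subschemes of `ℙ⁴` with homogeneous ideals `I` and `J` are projectively equivalent:
an invertible linear change of coordinates carries `I` to `J`. -/
def ProjEquiv (I J : Ideal (MvPolynomial (Fin 5) K)) : Prop :=
  ∃ g : Matrix.GeneralLinearGroup (Fin 5) K,
    J = I.map (aeval (R := K) fun i => ∑ j, C ((g : Matrix (Fin 5) (Fin 5) K) i j) *
      (X j : MvPolynomial (Fin 5) K))

end

end SecantSurface

/-! The ideal of `S` is generated by a quartic and five quintics (`lowGens`) and two sextics `s₀`,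
`s₁` (`sexticGens`); this is `ker_paramHom`, and the same forms generate over every `K`. Two
explicit lines `ℓ₀`, `ℓ₁` lie in the zero locus of the quartic and the quintics. The sextic `s_c`
vanishes on the other line, restricts to a nonzero binary sextic on `ℓ_c`, and its product with each
linear equation of `ℓ_c` lies in the ideal of `lowGens` (`sextic_mul_linSum_mem`).

The secants follow formally. A form of degree `e` in the ideal that is not identically zero on a
line bounds the length of the intersection by `e` (`hilbertFn_le`). So if `L` meets `S` in a finite
scheme of length at least 6, all of `lowGens` vanish on `L`. Some `s_c` does not, as otherwise `L`
would lie in `S`. Since `K[t]` is a domain, the linear equations of `ℓ_c` then vanish on `L`, hence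
`L = ℓ_c` (`eq_secantLine`). Conversely, the ideal restricts on `ℓ_c` to the multiples of one binary
sextic, so the length is exactly 6. The same dichotomy at a single point gives the zero locus of the
forms of degree at most 5.

The generators are found by two hyperplane sections. Up to degree 5 they come from linear algebra.
The section by `x₄ = 0` is parametrized by the plane curve of the last nonic, which is irreducible;
the section by `x₃ = x₄ = 0` is described by a ring of dimension `81 - 9 - 4 * 14 - 5 = 11`, in
which the third nonic is a unit. Membership in high degree descends to degree 6 for the points
(`mem_points`), then for the curve (`mem_curve`), then for the surface
(`mem_surface_of_homogeneous`), by dividing successively by `x₂`, `x₃`, `x₄`.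

The space `W` is determined by linear algebra on the coefficients of a nonic (`nonics_eq_span`); the
conditions at the conjugates follow from those at `Q` and `R` by Frobenius. Another basis of `W`
changes the ideal by an element of `GL₅`, under which every notion in the theorem is invariant. All
finite computations are Gaussian eliminations over `𝔽₂` on forms that the Kronecker substitution
encodes as natural numbers. -/

namespace SecantSurface

/-! ### Polynomials over `𝔽₂` as natural numbers, and Gaussian elimination. -/

section BinaryPolynomials

open Polynomial

/-- The polynomial over `𝔽₂` whose coefficients are the binary digits of `n`. -/
noncomputable def toPoly (n : ℕ) : (ZMod 2)[X] :=
  ∑ i ∈ Finset.range n, if n.testBit i then X ^ i else 0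

lemma coeff_toPoly (n i : ℕ) : (toPoly n).coeff i = if n.testBit i then 1 else 0 := by
  rw [toPoly, finsetSum_coeff]
  have h : ∀ j ∈ Finset.range n, (if n.testBit j then (X : (ZMod 2)[X]) ^ j else 0).coeff i =
      if j = i then (if n.testBit i then 1 else 0) else 0 := by
    intro j _
    by_cases hji : j = i
    · subst hji; rw [if_pos rfl]; split_ifs <;> simp
    · rw [if_neg hji]; split_ifs <;> simp [coeff_X_pow, Ne.symm hji]
  rw [Finset.sum_congr rfl h, Finset.sum_ite_eq']
  split_ifs with h1 h2 h2 <;> try rfl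
  exfalso
  -- Digits outside the range of summation vanish, because `n ≤ i < 2 ^ i`.
  have : n < 2 ^ i := lt_of_le_of_lt (by simpa using h1) Nat.lt_two_pow_self
  rw [Nat.testBit_lt_two_pow this] at h2
  exact Bool.noConfusion h2

lemma toPoly_injective : Function.Injective toPoly := by
  intro a b h
  refine Nat.eq_of_testBit_eq fun i => ?_
  have := congrArg (fun p => p.coeff i) h
  simp only [coeff_toPoly] at this
  by_cases ha : a.testBit i <;> by_cases hb : b.testBit i <;> simp_all

lemma toPoly_zero : toPoly 0 = 0 := by ext i; simp [coeff_toPoly]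

lemma toPoly_one : toPoly 1 = 1 := by simp [toPoly]

lemma toPoly_xor (a b : ℕ) : toPoly (a ^^^ b) = toPoly a + toPoly b := by
  ext i
  simp only [coeff_toPoly, coeff_add, Nat.testBit_xor]
  by_cases ha : a.testBit i <;> by_cases hb : b.testBit i <;> simp [ha, hb]
  decide

lemma toPoly_shiftLeft (a k : ℕ) : toPoly (a <<< k) = X ^ k * toPoly a := by
  ext i
  rw [coeff_X_pow_mul', coeff_toPoly, Nat.testBit_shiftLeft, coeff_toPoly]
  by_cases h : k ≤ i <;> simp [h]

lemma toPoly_two_pow (k : ℕ) : toPoly (1 <<< k) = X ^ k := by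
  rw [toPoly_shiftLeft, toPoly_one, mul_one]

lemma degree_toPoly_lt {n k : ℕ} (h : n < 2 ^ k) : (toPoly n).degree < k := by
  rw [degree_lt_iff_coeff_zero]
  intro m hm
  rw [coeff_toPoly, Nat.testBit_lt_two_pow (h.trans_le (Nat.pow_le_pow_right two_pos hm))]
  simp

lemma xor_self_eq_zero_poly (p : (ZMod 2)[X]) : p + p = 0 := by
  rw [← two_mul]
  have : (2 : (ZMod 2)[X]) = 0 := by exact_mod_cast CharP.cast_eq_zero (ZMod 2)[X] 2
  rw [this, zero_mul]

/-- `k n`, arranged so that the kernel evaluates `n` first. -/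
def force {β : Type*} (n : ℕ) (k : ℕ → β) : β :=
  match n with
  | 0 => k 0
  | m + 1 => k (m + 1)

@[simp] lemma force_eq {β : Type*} (n : ℕ) (k : ℕ → β) : force n k = k n := by
  cases n <;> rfl

/-- The carry-less sum of `acc` and the product of `a` with the powers of two in the list. -/
def mulExps (a : ℕ) : List ℕ → ℕ → ℕ
  | [], acc => acc
  | e :: es, acc => force (acc ^^^ (a <<< e)) fun acc' => mulExps a es acc'

/-- The polynomial over `𝔽₂` with the given exponents. -/
noncomputable def expsPoly (es : List ℕ) : (ZMod 2)[X] := (es.map fun e => X ^ e).sum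

lemma toPoly_mulExps (a : ℕ) (es : List ℕ) : ∀ acc,
    toPoly (mulExps a es acc) = toPoly acc + expsPoly es * toPoly a := by
  induction es with
  | nil => intro acc; simp [mulExps, expsPoly]
  | cons e es ih =>
    intro acc
    rw [mulExps, force_eq, ih, toPoly_xor, toPoly_shiftLeft, expsPoly, expsPoly, List.map_cons,
      List.sum_cons]
    ring

/-- Reduction of a polynomial over `𝔽₂` modulo `m`, which has degree `D`. -/
def clmod (m D : ℕ) : ℕ → ℕ → ℕ
  | 0, a => a
  | k + 1, a =>
    match (a >>> (D + k)) % 2 with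
    | 0 => clmod m D k a
    | _ + 1 => force (a ^^^ (m <<< k)) fun a' => clmod m D k a'

/-- Each step adds a multiple of `m`, and sums are differences in characteristic 2. Nothing is
claimed about the size of the remainder; where it matters, it is checked on the numbers themselves.
-/
lemma dvd_toPoly_clmod_add (m D k : ℕ) : ∀ a,
    toPoly m ∣ toPoly (clmod m D k a) + toPoly a := by
  induction k with
  | zero => intro a; simp [clmod, xor_self_eq_zero_poly]
  | succ k ih =>
    intro a
    rw [clmod]
    split
    · exact ih a
    · rw [force_eq]
      have h := ih (a ^^^ (m <<< k))
      rw [toPoly_xor, toPoly_shiftLeft, ← add_assoc] at h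
      exact (dvd_add_left (Dvd.intro_left _ rfl)).1 h

/-- Auxiliary bisection for `lg`. -/
def lgAux : ℕ → ℕ → ℕ → ℕ
  | 0, _, acc => acc
  | k + 1, n, acc =>
    match n >>> (1 <<< k) with
    | 0 => lgAux k n acc
    | m + 1 => force (m + 1) fun n' => force (acc + (1 <<< k)) fun acc' => lgAux k n' acc'

/-- The binary logarithm of `n < 2 ^ 2 ^ 16`. -/
def lg (n : ℕ) : ℕ := lgAux 16 n 0

/-- The elements of `l`, with `r` added to those whose `p`-th digit is `1`, passed on to `k`. -/
def elim {β : Type*} (p r : ℕ) : List ℕ → List ℕ → (List ℕ → β) → β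
  | [], acc, k => k acc
  | s :: t, acc, k =>
    match (s >>> p) % 2 with
    | 0 => elim p r t (s :: acc) k
    | _ + 1 => force (s ^^^ r) fun s' => elim p r t (s' :: acc) k

lemma elim_eq {β : Type*} (p r : ℕ) (l : List ℕ) : ∀ (acc : List ℕ) (k : List ℕ → β),
    elim p r l acc k = k (elim p r l acc id) := by
  induction l with
  | nil => intro acc k; rfl
  | cons s t ih =>
    intro acc k
    rw [elim, elim]
    split
    · exact ih _ _
    · rw [force_eq, force_eq]; exact ih _ _

/-- The span over `𝔽₂` of the polynomials in the list. -/
noncomputable def polySpan (l : List ℕ) : Submodule (ZMod 2) (ZMod 2)[X] :=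
  Submodule.span (ZMod 2) (toPoly '' {n | n ∈ l})

lemma toPoly_mem_polySpan {l : List ℕ} {n : ℕ} (h : n ∈ l) : toPoly n ∈ polySpan l :=
  Submodule.subset_span ⟨n, h, rfl⟩

lemma polySpan_le {l : List ℕ} {S : Submodule (ZMod 2) (ZMod 2)[X]} :
    polySpan l ≤ S ↔ ∀ n ∈ l, toPoly n ∈ S := by
  rw [polySpan, Submodule.span_le]
  exact ⟨fun h n hn => h ⟨n, hn, rfl⟩, by rintro h _ ⟨n, hn, rfl⟩; exact h n hn⟩

lemma polySpan_cons (n : ℕ) (l : List ℕ) :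
    polySpan (n :: l) = Submodule.span (ZMod 2) {toPoly n} ⊔ polySpan l := by
  rw [polySpan, polySpan, ← Submodule.span_union]
  congr 1
  ext p
  simp [eq_comm]

/-- `elim` adds multiples of `r` and clears the `p`-th digit. -/
lemma elim_spec (p r : ℕ) (hr : r.testBit p = true) (l : List ℕ) : ∀ acc : List ℕ,
    ∀ s' ∈ elim p r l acc id, s' ∈ acc ∨ s'.testBit p = false := by
  induction l with
  | nil => intro acc s' h; exact Or.inl h
  | cons s t ih =>
    intro acc s' h
    have hs : s.testBit p = decide ((s >>> p) % 2 = 1) := by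
      rw [Nat.testBit_eq_decide_div_mod_eq, Nat.shiftRight_eq_div_pow]
    rw [elim] at h
    split at h
    · next h0 =>
      rcases ih _ _ h with h1 | h1
      · rcases List.mem_cons.1 h1 with rfl | h1
        · right; rw [hs, h0]; rfl
        · exact Or.inl h1
      · exact Or.inr h1
    · next m h0 =>
      rw [force_eq] at h
      rcases ih _ _ h with h1 | h1
      · rcases List.mem_cons.1 h1 with rfl | h1
        · right
          have : (s >>> p) % 2 = 1 := by omega
          rw [Nat.testBit_xor, hs, hr, this]; rfl
        · exact Or.inl h1
      · exact Or.inr h1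

/-- Together with `span_elim` this says that the row operations preserve the span in the presence of
`r`. It holds for every `p`, whether or not `p` is a digit of `r`. -/
lemma elim_span (p r : ℕ) (l : List ℕ) : ∀ acc : List ℕ,
    (∀ s ∈ l, toPoly s ∈ Submodule.span (ZMod 2) {toPoly r} ⊔ polySpan (elim p r l acc id)) ∧
    (∀ s ∈ acc, s ∈ elim p r l acc id) := by
  induction l with
  | nil => intro acc; exact ⟨by simp, fun s h => h⟩
  | cons s t ih =>
    intro acc
    rw [elim]
    split
    · obtain ⟨h1, h2⟩ := ih (s :: acc)
      refine ⟨?_, fun s' hs' => h2 _ (List.mem_cons_of_mem _ hs')⟩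
      intro s' hs'
      rcases List.mem_cons.1 hs' with rfl | hs'
      · exact Submodule.mem_sup_right (toPoly_mem_polySpan (h2 _ List.mem_cons_self))
      · exact h1 _ hs'
    · rw [force_eq]
      obtain ⟨h1, h2⟩ := ih ((s ^^^ r) :: acc)
      refine ⟨?_, fun s' hs' => h2 _ (List.mem_cons_of_mem _ hs')⟩
      intro s' hs'
      rcases List.mem_cons.1 hs' with rfl | hs'
      · have h3 := toPoly_mem_polySpan (h2 _ List.mem_cons_self)
        have : toPoly s' = toPoly r + toPoly (s' ^^^ r) := by
          rw [toPoly_xor]; linear_combination - xor_self_eq_zero_poly (toPoly r)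
        rw [this]
        exact Submodule.add_mem_sup (Submodule.mem_span_singleton_self _) h3
      · exact h1 _ hs'

lemma span_elim (p r : ℕ) (l : List ℕ) : ∀ acc : List ℕ, ∀ s' ∈ elim p r l acc id,
    s' ∈ acc ∨ toPoly s' ∈ polySpan (r :: l) := by
  induction l with
  | nil => intro acc s' h; exact Or.inl h
  | cons s t ih =>
    intro acc s' h
    have key : polySpan (r :: t) ≤ polySpan (r :: s :: t) :=
      Submodule.span_mono (Set.image_mono fun x hx => by simp at hx ⊢; tauto)
    rw [elim] at h
    split at h
    · rcases ih _ _ h with h1 | h1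
      · rcases List.mem_cons.1 h1 with rfl | h1
        · exact Or.inr (toPoly_mem_polySpan (by simp))
        · exact Or.inl h1
      · exact Or.inr (key h1)
    · rw [force_eq] at h
      rcases ih _ _ h with h1 | h1
      · rcases List.mem_cons.1 h1 with rfl | h1
        · right
          rw [toPoly_xor]
          exact add_mem (toPoly_mem_polySpan (by simp)) (toPoly_mem_polySpan (by simp))
        · exact Or.inl h1
      · exact Or.inr (key h1)

/-- Gaussian elimination of the digits from the `B`-th one onwards. -/
def kern (B : ℕ) : ℕ → List ℕ → List ℕ
  | 0, l => l
  | _ + 1, [] => []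
  | k + 1, r :: t =>
    match r >>> B with
    | 0 => r :: kern B k t
    | m + 1 => force (B + lg (m + 1)) fun p =>
      match (r >>> p) % 2 with
      | 0 => r :: t
      | _ + 1 => elim p r t [] (kern B k)

/-- Once a pivot digit `q ≥ B` is cleared from the other rows, a vector of degree below `B` cannot
involve the pivot row, which may be discarded. Rows without digits from `B` on are kept. Only this
inclusion is needed, so exhausted fuel merely returns too many vectors. -/
theorem mem_polySpan_kern (B k : ℕ) : ∀ (l : List ℕ) {p : (ZMod 2)[X]}, p ∈ polySpan l →
    p.degree < B → p ∈ polySpan (kern B k l) := by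
  induction k with
  | zero => intro l p hp _; exact hp
  | succ k ih =>
    intro l p hp hB
    cases l with
    | nil => exact hp
    | cons r t =>
      rw [kern]
      split
      · next h0 =>
        rw [polySpan_cons] at hp ⊢
        obtain ⟨a, ha, b, hb, rfl⟩ := Submodule.mem_sup.1 hp
        refine Submodule.add_mem_sup ha (ih t hb ?_)
        have ha' : a.degree < B := by
          obtain ⟨c, rfl⟩ := Submodule.mem_span_singleton.1 ha
          refine (degree_smul_le _ _).trans_lt (degree_toPoly_lt ?_)
          rw [Nat.shiftRight_eq_div_pow] at h0
          exact (Nat.div_eq_zero_iff_lt (by positivity)).1 h0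
        have : b = (a + b) - a := by ring
        rw [this]
        exact (degree_sub_le _ _).trans_lt (max_lt hB ha')
      · next m h0 =>
        rw [force_eq]
        generalize hq : B + lg (m + 1) = q
        have hlog : B ≤ q := by omega
        -- That `lg` finds a digit of `r` is tested rather than proved; if the test fails, the rows
        -- are returned unchanged.
        split
        · exact hp
        next h1 =>
        rw [elim_eq]
        have hbit : r.testBit q = true := by
          rw [Nat.testBit_eq_decide_div_mod_eq, ← Nat.shiftRight_eq_div_pow, decide_eq_true_eq]
          have := Nat.mod_lt (r >>> q) two_pos
          omega
        have hsub : polySpan (r :: t) ≤ Submodule.span (ZMod 2) {toPoly r} ⊔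
            polySpan (elim q r t [] id) := by
          rw [polySpan_cons]
          refine sup_le le_sup_left (polySpan_le.2 fun n hn => (elim_span _ _ _ _).1 n hn)
        obtain ⟨a, ha, b, hb, rfl⟩ := Submodule.mem_sup.1 (hsub hp)
        obtain ⟨c, rfl⟩ := Submodule.mem_span_singleton.1 ha
        have hb0 : b.coeff q = 0 := by
          have : polySpan (elim q r t [] id) ≤ LinearMap.ker (lcoeff (ZMod 2) q) := by
            refine polySpan_le.2 fun n hn => ?_
            rcases elim_spec _ _ hbit _ _ n hn with h | h
            · simp at h
            · simp [coeff_toPoly, h]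
          exact this hb
        have hc : c = 0 := by
          have h1 : (c • toPoly r + b).coeff q = 0 :=
            coeff_eq_zero_of_degree_lt (hB.trans_le (by exact_mod_cast hlog))
          simpa [hb0, coeff_toPoly, hbit] using h1
        subst hc
        rw [zero_smul, zero_add] at hB ⊢
        exact ih _ hb hB

/-- Whether all elements of the second list lie in the span of the first one. -/
def spanCheck : ℕ → List ℕ → List ℕ → Bool
  | 0, _, ts => ts.all (Nat.beq 0)
  | _ + 1, [], ts => ts.all (Nat.beq 0)
  | k + 1, g :: gs, ts =>
    match g with
    | 0 => spanCheck k gs ts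
    | m + 1 => force (lg (m + 1)) fun p =>
      elim p (m + 1) gs [] fun gs' => elim p (m + 1) ts [] fun ts' => spanCheck k gs' ts'

lemma toPoly_mem_of_all {ts : List ℕ} (h : ts.all (Nat.beq 0) = true)
    (S : Submodule (ZMod 2) (ZMod 2)[X]) : polySpan ts ≤ S := by
  refine polySpan_le.2 fun n hn => ?_
  have := List.all_eq_true.1 h n hn
  rw [← Nat.eq_of_beq_eq_true this, toPoly_zero]
  exact zero_mem _

/-- Reducing a target by a generator changes it by an element of the span, and in the end all
targets must have become zero. A badly chosen pivot could only make the check fail. -/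
theorem polySpan_le_of_spanCheck (k : ℕ) : ∀ gs ts : List ℕ, spanCheck k gs ts = true →
    polySpan ts ≤ polySpan gs := by
  induction k with
  | zero => intro gs ts h; exact toPoly_mem_of_all (by simpa [spanCheck] using h) _
  | succ k ih =>
    intro gs ts h
    cases gs with
    | nil => exact toPoly_mem_of_all (by simpa [spanCheck] using h) _
    | cons g gs =>
      cases g with
      | zero =>
        rw [spanCheck] at h
        refine (ih _ _ h).trans ?_
        rw [polySpan_cons]; exact le_sup_right
      | succ m =>
        rw [spanCheck, force_eq, elim_eq, elim_eq] at h
        have h1 := ih _ _ h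
        have h2 : polySpan (elim (lg (m + 1)) (m + 1) gs [] id) ≤ polySpan ((m + 1) :: gs) := by
          refine polySpan_le.2 fun n hn => ?_
          rcases span_elim _ _ _ _ n hn with h | h
          · simp at h
          · exact h
        refine polySpan_le.2 fun n hn => ?_
        refine (sup_le ?_ (h1.trans h2)) ((elim_span (lg (m + 1)) (m + 1) ts []).1 n hn)
        rw [polySpan_cons]
        exact le_sup_left

end BinaryPolynomials

/-! ### Enumeration of monomials, and induction on the degree of forms. -/

section Monomials

open MvPolynomial

/-- Auxiliary recursion for `monos`. -/
def prep {α : Type*} (f : α → α) (g : ℕ → List α) (a : α) : ℕ → List α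
  | 0 => [a]
  | d + 1 => (prep f g a d).map f ++ g (d + 1)

/-- The results of applying `d` of the given maps to `a`, later ones of the list first. -/
def monos {α : Type*} : List (α → α) → α → ℕ → List α
  | [], a, 0 => [a]
  | [], _, _ + 1 => []
  | f :: fs, a, d => prep f (monos fs a) a d

lemma monos_cons_succ {α : Type*} (f : α → α) (fs : List (α → α)) (a : α) (d : ℕ) :
    monos (f :: fs) a (d + 1) = (monos (f :: fs) a d).map f ++ monos fs a (d + 1) := rfl

lemma monos_zero {α : Type*} (fs : List (α → α)) (a : α) : monos fs a 0 = [a] := by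
  cases fs <;> rfl

/-- The recursion is parametric in the type, so it can run on polynomials and on their numerical
codes side by side. This links every computation below to actual forms. -/
lemma forall₂_monos {α β : Type*} {ρ : α → β → Prop} {fs : List (α → α)} {gs : List (β → β)}
    (h : List.Forall₂ (fun f g => ∀ a b, ρ a b → ρ (f a) (g b)) fs gs) {a : α} {b : β}
    (hab : ρ a b) (d : ℕ) : List.Forall₂ ρ (monos fs a d) (monos gs b d) := by
  induction h generalizing d with
  | nil => cases d <;> simp [monos, hab]
  | @cons f g fs gs hfg _ ih =>
    induction d with
    | zero => simp [monos_zero, hab]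
    | succ d ihd =>
      rw [monos_cons_succ, monos_cons_succ]
      refine List.rel_append ?_ (ih _)
      rw [List.forall₂_map_left_iff, List.forall₂_map_right_iff]
      exact ihd.imp fun _ _ h => hfg _ _ h

lemma forall_mem_monos {α : Type*} {P : ℕ → α → Prop} {fs : List (α → α)} {a : α} (h0 : P 0 a)
    (h : ∀ f ∈ fs, ∀ d x, P d x → P (d + 1) (f x)) (d : ℕ) : ∀ x ∈ monos fs a d, P d x := by
  induction fs generalizing d with
  | nil => cases d <;> simp [monos, h0]
  | cons f fs ih =>
    induction d with
    | zero => simp [monos_zero, h0]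
    | succ d ihd =>
      intro x hx
      rw [monos_cons_succ, List.mem_append, List.mem_map] at hx
      rcases hx with ⟨y, hy, rfl⟩ | hx
      · exact h _ (by simp) _ _ (ihd y hy)
      · exact ih (fun f hf => h f (by simp [hf])) _ x hx

/-- `l.map f ++ t`, arranged so that the kernel evaluates the elements of the list. -/
def mapAppend (f : ℕ → ℕ) : List ℕ → List ℕ → List ℕ
  | [], t => t
  | x :: l, t => force (f x) fun y => y :: mapAppend f l t

lemma mapAppend_eq (f : ℕ → ℕ) (l t : List ℕ) : mapAppend f l t = l.map f ++ t := by
  induction l with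
  | nil => rfl
  | cons x l ih => rw [mapAppend, force_eq, ih]; rfl

/-- Auxiliary recursion for `codes`. -/
def prepCodes (f : ℕ → ℕ) (g : ℕ → List ℕ) (a : ℕ) : ℕ → List ℕ
  | 0 => [a]
  | d + 1 => mapAppend f (prepCodes f g a d) (g (d + 1))

/-- The same list as `monos`, with evaluated elements. -/
def codes : List (ℕ → ℕ) → ℕ → ℕ → List ℕ
  | [], a, 0 => [a]
  | [], _, _ + 1 => []
  | f :: fs, a, d => prepCodes f (codes fs a) a d

lemma codes_eq (fs : List (ℕ → ℕ)) (a d : ℕ) : codes fs a d = monos fs a d := by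
  induction fs generalizing d with
  | nil => cases d <;> rfl
  | cons f fs ih =>
    rw [codes, monos]
    induction d with
    | zero => rfl
    | succ d ihd => rw [prepCodes, prep, mapAppend_eq, ihd, ih]

/-- The elements of `l₁`, shifted by `B` digits, combined with those of `l₂`. -/
def shiftZip (B : ℕ) : List ℕ → List ℕ → List ℕ
  | [], _ => []
  | _ :: _, [] => []
  | x :: l, y :: l' => force ((x <<< B) ^^^ y) fun z => z :: shiftZip B l l'

variable {σ k : Type*} [Field k]

/-- An induction principle for forms. -/
lemma homogeneousSubmodule_succ_le {d : ℕ} {S : Submodule k (MvPolynomial σ k)}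
    (h : ∀ i, ∀ f ∈ homogeneousSubmodule σ k d, X i * f ∈ S) :
    homogeneousSubmodule σ k (d + 1) ≤ S := by
  intro f hf
  rw [mem_homogeneousSubmodule] at hf
  rw [f.as_sum]
  refine sum_mem fun s hs => ?_
  have hdeg : s.degree = d + 1 := by
    have := hf (mem_support_iff.1 hs)
    rwa [Finsupp.degree_eq_weight_one]
  obtain ⟨i, hi⟩ : ∃ i, s i ≠ 0 := by
    by_contra hcon
    push Not at hcon
    have : s = 0 := Finsupp.ext hcon
    simp [this] at hdeg
  have hle : Finsupp.single i 1 ≤ s := by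
    rw [Finsupp.single_le_iff]; omega
  have hs' : Finsupp.single i 1 + (s - Finsupp.single i 1) = s := add_tsub_cancel_of_le hle
  have hm : monomial s (coeff s f) = X i * monomial (s - Finsupp.single i 1) (coeff s f) := by
    rw [X, monomial_mul, one_mul, hs']
  rw [hm]
  refine h i _ ?_
  rw [mem_homogeneousSubmodule]
  refine isHomogeneous_monomial _ ?_
  have := congrArg Finsupp.degree hs'
  rw [map_add, Finsupp.degree_single, hdeg] at this
  omega

lemma homogeneousSubmodule_le (S : ℕ → Submodule k (MvPolynomial σ k)) (h0 : 1 ∈ S 0)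
    (h : ∀ i d f, f ∈ S d → X i * f ∈ S (d + 1)) (d : ℕ) : homogeneousSubmodule σ k d ≤ S d := by
  induction d with
  | zero =>
    intro f hf
    rw [mem_homogeneousSubmodule, ← totalDegree_zero_iff_isHomogeneous,
      totalDegree_eq_zero_iff_eq_C] at hf
    rw [hf, ← mul_one (C _), ← smul_eq_C_mul]
    exact Submodule.smul_mem _ _ h0
  | succ d ih => exact homogeneousSubmodule_succ_le fun i f hf => h i d f (ih hf)

/-- Multiplication by the variables in `l`. -/
noncomputable def varActs (k : Type*) [Field k] (l : List σ) :
    List (MvPolynomial σ k → MvPolynomial σ k) :=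
  l.map fun i f => X i * f

/-- In `monos` the head variable is applied outermost, so multiplication by it lands in the next
list at once. A later variable is first commuted past the head factors. -/
lemma X_mul_mem_span_monos (l : List σ) (q : MvPolynomial σ k) (d : ℕ) {i : σ} (hi : i ∈ l)
    {f : MvPolynomial σ k} (hf : f ∈ Submodule.span k {g | g ∈ monos (varActs k l) q d}) :
    X i * f ∈ Submodule.span k {g | g ∈ monos (varActs k l) q (d + 1)} := by
  suffices h : Submodule.span k {g | g ∈ monos (varActs k l) q d} ≤
      (Submodule.span k {g | g ∈ monos (varActs k l) q (d + 1)}).comap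
        (LinearMap.mulLeft k (X i)) from h hf
  clear hf f
  rw [Submodule.span_le]
  intro f hf
  change X i * f ∈ Submodule.span k {g | g ∈ monos (varActs k l) q (d + 1)}
  induction l generalizing d f with
  | nil => simp at hi
  | cons j l ih =>
    have hmap : ∀ d g, g ∈ Submodule.span k {g | g ∈ monos (varActs k (j :: l)) q d} →
        X j * g ∈ Submodule.span k {g | g ∈ monos (varActs k (j :: l)) q (d + 1)} := by
      intro d g hg
      have : Submodule.span k {g | g ∈ monos (varActs k (j :: l)) q d} ≤
          (Submodule.span k {g | g ∈ monos (varActs k (j :: l)) q (d + 1)}).comap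
            (LinearMap.mulLeft k (X j)) := by
        rw [Submodule.span_le]
        intro g hg
        refine Submodule.subset_span ?_
        change _ ∈ monos _ _ _
        rw [varActs, List.map_cons, monos_cons_succ]
        exact List.mem_append_left _ (List.mem_map_of_mem hg)
      exact this hg
    have hsub : ∀ d g, g ∈ Submodule.span k {g | g ∈ monos (varActs k l) q (d + 1)} →
        g ∈ Submodule.span k {g | g ∈ monos (varActs k (j :: l)) q (d + 1)} := by
      intro d g hg
      refine Submodule.span_mono ?_ hg
      intro g hg
      change _ ∈ monos _ _ _
      rw [varActs, List.map_cons, monos_cons_succ]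
      exact List.mem_append_right _ hg
    rcases List.mem_cons.1 hi with rfl | hil
    · exact hmap d f (Submodule.subset_span hf)
    · induction d generalizing f with
      | zero =>
        have : f ∈ {g | g ∈ monos (varActs k l) q 0} := by
          change f ∈ monos _ _ _ at hf
          change f ∈ monos _ _ _
          rwa [monos_zero] at hf ⊢
        exact hsub _ _ (ih 0 hil this)
      | succ d ihd =>
        change f ∈ monos _ _ _ at hf
        rw [varActs, List.map_cons, monos_cons_succ, List.mem_append, List.mem_map] at hf
        rcases hf with ⟨g, hg, rfl⟩ | hf
        · rw [mul_left_comm]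
          exact hmap _ _ (ihd hg)
        · exact hsub _ _ (ih _ hil hf)

/-- The forms of degree `d` are spanned by the monomials. -/
lemma mem_span_monos {l : List σ} (hl : ∀ i, i ∈ l) {d : ℕ} {f : MvPolynomial σ k}
    (hf : f ∈ homogeneousSubmodule σ k d) :
    f ∈ Submodule.span k {g | g ∈ monos (varActs k l) 1 d} :=
  homogeneousSubmodule_le (fun d => Submodule.span k {g | g ∈ monos (varActs k l) 1 d})
    (Submodule.subset_span (by simp [monos_zero]))
    (fun i d _ hf => X_mul_mem_span_monos l 1 d (hl i) hf) d hf

lemma mem_homogeneousSubmodule_of_mem_monos {l : List σ} {e : ℕ} {q : MvPolynomial σ k}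
    (hq : q ∈ homogeneousSubmodule σ k e) (d : ℕ) :
    ∀ g ∈ monos (varActs k l) q d, g ∈ homogeneousSubmodule σ k (e + d) := by
  refine forall_mem_monos (P := fun d g => g ∈ homogeneousSubmodule σ k (e + d)) hq ?_ d
  intro f hf d x hx
  obtain ⟨i, _, rfl⟩ := List.mem_map.1 hf
  rw [mem_homogeneousSubmodule] at hx ⊢
  have := (isHomogeneous_X k i).mul hx
  rwa [show 1 + (e + d) = e + (d + 1) by ring] at this

lemma mem_ideal_of_mem_monos {l : List σ} {q : MvPolynomial σ k} {I : Ideal (MvPolynomial σ k)}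
    (hq : q ∈ I) (d : ℕ) : ∀ g ∈ monos (varActs k l) q d, g ∈ I := by
  refine forall_mem_monos (P := fun _ g => g ∈ I) hq ?_ d
  intro f hf d x hx
  obtain ⟨i, _, rfl⟩ := List.mem_map.1 hf
  exact I.mul_mem_left _ hx

end Monomials

/-! ### Forms given by binary masks, Kronecker substitution and kernels. -/

section Forms

open MvPolynomial

variable {σ : Type*}

/-- The sum of those elements of a list that are selected by the binary digits of `n`. -/
def lin {V : Type*} [AddCommMonoid V] : ℕ → List V → V
  | _, [] => 0
  | n, v :: t => (if n % 2 = 0 then 0 else v) + lin (n / 2) t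

/-- The carry-less sum of those elements of a list that are selected by the digits of `n`. -/
def xlin : ℕ → List ℕ → ℕ
  | _, [] => 0
  | n, v :: t => force (n / 2) fun n' =>
    match n % 2 with
    | 0 => xlin n' t
    | _ + 1 => v ^^^ xlin n' t

lemma map_lin {V W : Type*} [AddCommMonoid V] [AddCommMonoid W] (T : V →+ W) (l : List V) :
    ∀ n, T (lin n l) = lin n (l.map T) := by
  induction l with
  | nil => simp [lin]
  | cons v t ih =>
    intro n
    rw [lin, List.map_cons, lin, map_add, ih]
    split_ifs <;> simp

lemma lin_mem {R V : Type*} [Semiring R] [AddCommMonoid V] [Module R V] {S : Submodule R V}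
    {l : List V} (h : ∀ v ∈ l, v ∈ S) : ∀ n, lin n l ∈ S := by
  induction l with
  | nil => simp [lin]
  | cons v t ih =>
    intro n
    rw [lin]
    refine add_mem ?_ (ih (fun v hv => h v (by simp [hv])) _)
    split_ifs
    · exact zero_mem _
    · exact h v (by simp)

lemma lin_map_toPoly (l : List ℕ) : ∀ n, lin n (l.map toPoly) = toPoly (xlin n l) := by
  induction l with
  | nil => simp [lin, xlin, toPoly_zero]
  | cons v t ih =>
    intro n
    rw [List.map_cons, lin, xlin, force_eq, ih]
    rcases Nat.mod_two_eq_zero_or_one n with h | h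
    · simp [h]
    · simp [h, toPoly_xor]

lemma apply_lin {V : Type*} [AddCommMonoid V] {T : V →+ Polynomial (ZMod 2)}
    {ms : List V} {rs : List ℕ} (h : List.Forall₂ (fun m r => T m = toPoly r) ms rs) (n : ℕ) :
    T (lin n ms) = toPoly (xlin n rs) := by
  rw [map_lin, ← lin_map_toPoly]
  congr 1
  induction h with
  | nil => rfl
  | cons h _ ih => rw [List.map_cons, List.map_cons, h, ih]

/-- The form of degree `e` in the variables in `l` whose coefficients are the digits of `n`. -/
noncomputable def form (l : List σ) (e n : ℕ) : MvPolynomial σ (ZMod 2) :=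
  lin n (monos (varActs (ZMod 2) l) 1 e)

lemma form_mem (l : List σ) (e n : ℕ) : form l e n ∈ homogeneousSubmodule σ (ZMod 2) e := by
  refine lin_mem (fun v hv => ?_) n
  have := mem_homogeneousSubmodule_of_mem_monos (e := 0) (isHomogeneous_one σ (ZMod 2)) e v hv
  rwa [zero_add] at this

/-- A homomorphism from `MvPolynomial σ (ZMod 2)` is evaluated on lists of monomials by lists of
binary polynomials. -/
lemma forall₂_monos_of_mul {A : Type*} [CommRing A] [Algebra (ZMod 2) A]
    (Φ : MvPolynomial σ (ZMod 2) →ₐ[ZMod 2] A) (π : Polynomial (ZMod 2) → A) {l : List σ}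
    {acts : List (ℕ → ℕ)}
    (h : List.Forall₂ (fun i act => ∀ r, π (toPoly (act r)) = Φ (X i) * π (toPoly r)) l acts)
    {q : MvPolynomial σ (ZMod 2)} {a : ℕ} (hq : Φ q = π (toPoly a)) (d : ℕ) :
    List.Forall₂ (fun m r => Φ m = π (toPoly r)) (monos (varActs (ZMod 2) l) q d)
      (codes acts a d) := by
  rw [codes_eq]
  refine forall₂_monos (ρ := fun m r => Φ m = π (toPoly r)) ?_ hq d
  rw [varActs, List.forall₂_map_left_iff]
  refine h.imp fun i act hi f r hf => ?_
  rw [hi, map_mul, hf]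

/-- The Kronecker substitution with weights `w`. -/
noncomputable def kron (w : σ → ℕ) : MvPolynomial σ (ZMod 2) →ₐ[ZMod 2] Polynomial (ZMod 2) :=
  aeval fun i => Polynomial.X ^ w i

lemma kron_monomial (w : σ → ℕ) (s : σ →₀ ℕ) (c : ZMod 2) :
    kron w (monomial s c) = Polynomial.monomial (s.sum fun i e => e * w i) c := by
  rw [kron, aeval_monomial, ← Polynomial.C_mul_X_pow_eq_monomial]
  congr 1
  rw [Finsupp.prod, Finsupp.sum, ← Finset.prod_pow_eq_pow_sum]
  exact Finset.prod_congr rfl fun i _ => by rw [← pow_mul, mul_comm]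

/-- The Kronecker substitution is injective on forms of degree `d`. -/
def KronInjective (w : σ → ℕ) (d : ℕ) : Prop :=
  ∀ s t : σ →₀ ℕ, s.degree = d → t.degree = d →
    (s.sum fun i e => e * w i) = (t.sum fun i e => e * w i) → s = t

/-- Distinct monomials of degree `d` go to distinct powers of the variable, so every coefficient of
`f` is a coefficient of its image. -/
lemma kron_eq_zero {w : σ → ℕ} {d : ℕ} (hw : KronInjective w d) {f : MvPolynomial σ (ZMod 2)}
    (hf : f ∈ homogeneousSubmodule σ (ZMod 2) d) (h : kron w f = 0) : f = 0 := by
  have hdeg : ∀ s ∈ f.support, s.degree = d := fun s hs => by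
    have := hf (mem_support_iff.1 hs)
    rwa [Finsupp.degree_eq_weight_one]
  ext s
  rw [coeff_zero]
  by_contra hs
  have hs' := mem_support_iff.2 hs
  have h1 : (kron w f).coeff (s.sum fun i e => e * w i) = coeff s f := by
    conv_lhs => rw [f.as_sum]
    rw [map_sum, Polynomial.finsetSum_coeff, Finset.sum_eq_single s]
    · rw [kron_monomial, Polynomial.coeff_monomial_same]
    · intro t ht hts
      rw [kron_monomial, Polynomial.coeff_monomial_of_ne]
      exact fun heq => hts (hw t s (hdeg t ht) (hdeg s hs') heq.symm)
    · exact fun h => absurd hs' h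
  rw [h, Polynomial.coeff_zero] at h1
  exact hs h1.symm

/-- Multiplication of binary polynomials by the given powers of the variable. -/
def shifts (ws : List ℕ) : List (ℕ → ℕ) := ws.map fun w r => r <<< w

lemma forall₂_kron (w : σ → ℕ) (l : List σ) {q : MvPolynomial σ (ZMod 2)} {a : ℕ}
    (hq : kron w q = toPoly a) (d : ℕ) :
    List.Forall₂ (fun m r => kron w m = toPoly r) (monos (varActs (ZMod 2) l) q d)
      (codes (shifts (l.map w)) a d) := by
  refine forall₂_monos_of_mul (kron w) id ?_ hq d
  rw [shifts, List.forall₂_map_right_iff, List.forall₂_map_right_iff]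
  refine List.forall₂_same.2 fun i _ r => ?_
  simp [kron, toPoly_shiftLeft]

lemma kron_form (w : σ → ℕ) (l : List σ) (e n : ℕ) :
    kron w (form l e n) = toPoly (xlin n (codes (shifts (l.map w)) 1 e)) :=
  apply_lin (T := (kron w).toLinearMap.toAddMonoidHom)
    (forall₂_kron w l (by rw [map_one, toPoly_one]) e) n

/-- The multiples of degree `d` of some forms by monomials. -/
noncomputable def multiples (l : List σ) (gens : List (ℕ × ℕ)) (d : ℕ) :
    List (MvPolynomial σ (ZMod 2)) :=
  gens.flatMap fun g => monos (varActs (ZMod 2) l) (form l g.1 g.2) (d - g.1)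

/-- The Kronecker codes of `multiples`. -/
def multipleCodes (ws : List ℕ) (gens : List (ℕ × ℕ)) (d : ℕ) : List ℕ :=
  gens.flatMap fun g => force (xlin g.2 (codes (shifts ws) 1 g.1)) fun a =>
    codes (shifts ws) a (d - g.1)

lemma forall₂_multiples (w : σ → ℕ) (l : List σ) (gens : List (ℕ × ℕ)) (d : ℕ) :
    List.Forall₂ (fun m r => kron w m = toPoly r) (multiples l gens d)
      (multipleCodes (l.map w) gens d) := by
  induction gens with
  | nil => exact List.Forall₂.nil
  | cons g gens ih =>
    rw [multiples, multipleCodes, List.flatMap_cons, List.flatMap_cons]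
    refine List.rel_append ?_ ih
    rw [force_eq]
    exact forall₂_kron w l (kron_form w l _ _) _

lemma multiples_homogeneous {l : List σ} {gens : List (ℕ × ℕ)} {d : ℕ}
    (h : ∀ g ∈ gens, g.1 ≤ d) :
    ∀ m ∈ multiples l gens d, m ∈ homogeneousSubmodule σ (ZMod 2) d := by
  intro m hm
  obtain ⟨g, hg, hm⟩ := List.mem_flatMap.1 hm
  have := mem_homogeneousSubmodule_of_mem_monos (form_mem l g.1 g.2) _ m hm
  rwa [Nat.add_sub_cancel' (h g hg)] at this

/-- The ideal generated by some forms. -/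
noncomputable def formIdeal (l : List σ) (gens : List (ℕ × ℕ)) :
    Ideal (MvPolynomial σ (ZMod 2)) :=
  Ideal.span {f | ∃ g ∈ gens, f = form l g.1 g.2}

lemma multiples_mem {l : List σ} {gens : List (ℕ × ℕ)} {d : ℕ} :
    ∀ m ∈ multiples l gens d, m ∈ formIdeal l gens := by
  intro m hm
  obtain ⟨g, hg, hm⟩ := List.mem_flatMap.1 hm
  have h : form l g.1 g.2 ∈ {f | ∃ g ∈ gens, f = form l g.1 g.2} := ⟨g, hg, rfl⟩
  exact mem_ideal_of_mem_monos (Ideal.subset_span h) _ m hm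

lemma kron_mem_map_span {w : σ → ℕ} {ms : List (MvPolynomial σ (ZMod 2))} {rs : List ℕ}
    (h : List.Forall₂ (fun m r => kron w m = toPoly r) ms rs) :
    polySpan rs ≤ (Submodule.span (ZMod 2) {m | m ∈ ms}).map (kron w).toLinearMap := by
  refine polySpan_le.2 fun r hr => ?_
  induction h with
  | nil => simp at hr
  | @cons m s ms rs hms _ ih =>
    rcases List.mem_cons.1 hr with rfl | hr
    · exact Submodule.mem_map.2 ⟨m, Submodule.subset_span (by simp), hms⟩
    · exact Submodule.map_mono (Submodule.span_mono fun x hx => by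
        simp only [Set.mem_ofPred_eq] at hx; simp [hx]) (ih hr)

/-- A form whose Kronecker code is spanned by those of multiples of some forms is a combination of
these multiples. -/
theorem mem_span_multiples {w : σ → ℕ} {l : List σ} {d : ℕ} (hw : KronInjective w d)
    {gens : List (ℕ × ℕ)} (hg : ∀ g ∈ gens, g.1 ≤ d) {ts : List ℕ} {fuel : ℕ}
    (hc : spanCheck fuel (multipleCodes (l.map w) gens d) ts = true)
    {f : MvPolynomial σ (ZMod 2)} (hf : f ∈ homogeneousSubmodule σ (ZMod 2) d)
    (h : kron w f ∈ polySpan ts) : f ∈ Submodule.span (ZMod 2) {m | m ∈ multiples l gens d} := by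
  obtain ⟨g, hgm, hgf⟩ := kron_mem_map_span (forall₂_multiples w l gens d)
    (polySpan_le_of_spanCheck _ _ _ hc h)
  have hsub : g ∈ homogeneousSubmodule σ (ZMod 2) d :=
    Submodule.span_le.2 (multiples_homogeneous hg) hgm
  have : f - g = 0 := kron_eq_zero hw (sub_mem hf hsub) (by
    rw [map_sub, sub_eq_zero]; exact hgf.symm)
  rwa [sub_eq_zero.1 this]

lemma span_multiples_le (l : List σ) (gens : List (ℕ × ℕ)) (d : ℕ) :
    Submodule.span (ZMod 2) {m | m ∈ multiples l gens d} ≤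
      (formIdeal l gens).restrictScalars (ZMod 2) :=
  Submodule.span_le.2 multiples_mem

/-- Forms in the kernel of a linear map, found by Gaussian elimination. -/
theorem kron_mem_polySpan_kern {w : σ → ℕ} {l : List σ} (hl : ∀ i, i ∈ l) {d B fuel : ℕ}
    (T : MvPolynomial σ (ZMod 2) →ₗ[ZMod 2] Polynomial (ZMod 2)) {rows : List ℕ}
    (hT : List.Forall₂ (fun m r => T m = toPoly r) (monos (varActs (ZMod 2) l) 1 d) rows)
    (hB : (codes (shifts (l.map w)) 1 d).all (fun r => Nat.blt r (2 ^ B)) = true)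
    {f : MvPolynomial σ (ZMod 2)} (hf : f ∈ homogeneousSubmodule σ (ZMod 2) d) (h : T f = 0) :
    kron w f ∈ polySpan (kern B fuel (shiftZip B rows
      (codes (shifts (l.map w)) 1 d))) := by
  have hk := forall₂_kron w l (q := 1) (a := 1) (by rw [map_one, toPoly_one]) d
  have hfs := mem_span_monos hl hf
  refine mem_polySpan_kern _ _ _ ?_ ?_
  -- The row of a monomial `m` is `X ^ B * T m + kron w m`. If `T f = 0`, the same combination of
  -- rows has only its lower part left, and this encodes `f` itself.
  · let T' : MvPolynomial σ (ZMod 2) →ₗ[ZMod 2] Polynomial (ZMod 2) :=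
      (LinearMap.mulLeft (ZMod 2) (Polynomial.X ^ B)).comp T + (kron w).toLinearMap
    have hT' : T' f = kron w f := by simp [T', h]
    rw [← hT']
    suffices hs : Submodule.span (ZMod 2) {g | g ∈ monos (varActs (ZMod 2) l) 1 d} ≤
        (polySpan (shiftZip B rows
          (codes (shifts (l.map w)) 1 d))).comap T' from hs hfs
    rw [Submodule.span_le]
    generalize monos (varActs (ZMod 2) l) 1 d = ms at *
    generalize codes (shifts (l.map w)) 1 d = cs at *
    clear hB hfs
    intro m hm
    induction hT generalizing cs with
    | nil => simp at hm
    | @cons m' r ms rows h1 _ ih =>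
      cases hk with
      | @cons _ c _ cs h2 hk =>
        rcases List.mem_cons.1 hm with rfl | hm
        · have : T' m = toPoly ((r <<< B) ^^^ c) := by
            rw [toPoly_xor, toPoly_shiftLeft, ← h1, ← h2]; rfl
          rw [SetLike.mem_coe, Submodule.mem_comap, this]
          exact toPoly_mem_polySpan (by simp [shiftZip])
        · rw [SetLike.mem_coe, Submodule.mem_comap, shiftZip, force_eq, polySpan_cons]
          exact Submodule.mem_sup_right (ih cs hk hm)
  · suffices hs : Submodule.span (ZMod 2) {g | g ∈ monos (varActs (ZMod 2) l) 1 d} ≤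
        (Polynomial.degreeLT (ZMod 2) B).comap (kron w).toLinearMap from
      Polynomial.mem_degreeLT.1 (hs hfs)
    rw [Submodule.span_le]
    intro m hm
    rw [SetLike.mem_coe, Submodule.mem_comap, Polynomial.mem_degreeLT]
    obtain ⟨r, hr, hmr⟩ : ∃ r ∈ codes (shifts (l.map w)) 1 d, kron w m = toPoly r := by
      clear hB hfs hT
      generalize monos (varActs (ZMod 2) l) 1 d = ms at *
      generalize codes (shifts (l.map w)) 1 d = cs at *
      induction hk with
      | nil => simp at hm
      | cons h1 _ ih =>
        rcases List.mem_cons.1 hm with rfl | hm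
        · exact ⟨_, by simp, h1⟩
        · obtain ⟨r, hr, hmr⟩ := ih hm
          exact ⟨r, by simp [hr], hmr⟩
    change (kron w m).degree < B
    rw [hmr]
    refine degree_toPoly_lt ?_
    exact Nat.le_of_ble_eq_true (List.all_eq_true.1 hB r hr)

end Forms

/-! ### Evaluation of forms in the rings `𝔽₂[X] / (m)`. -/

section Evaluation

open MvPolynomial

variable {σ : Type*}

/-- Multiplication by binary polynomials with the given exponents, modulo `m` of degree `D`. -/
def mulActs (m D : ℕ) (l : List (List ℕ)) : List (ℕ → ℕ) :=
  l.map fun es r => clmod m D D (mulExps r es 0)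

variable {A : Type*} [CommRing A] [Algebra (ZMod 2) A]

/-- Any homomorphism that kills `m` turns multiplication of codes modulo `m` into genuine
multiplication. The case `m = 0`, `D = 0`, where no reduction takes place, covers identities in
`𝔽₂[X]` itself. -/
lemma apply_clmod_mulExps (π : Polynomial (ZMod 2) →ₐ[ZMod 2] A) {m : ℕ} (hm : π (toPoly m) = 0)
    (D k : ℕ) (es : List ℕ) (r : ℕ) :
    π (toPoly (clmod m D k (mulExps r es 0))) = π (expsPoly es) * π (toPoly r) := by
  obtain ⟨c, hc⟩ := dvd_toPoly_clmod_add m D k (mulExps r es 0)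
  have h1 := congrArg π hc
  rw [toPoly_mulExps, toPoly_zero, zero_add, map_add, map_mul, map_mul, hm, zero_mul] at h1
  have h2 : π (expsPoly es) * π (toPoly r) + π (expsPoly es) * π (toPoly r) = 0 := by
    rw [← map_mul, ← map_add, xor_self_eq_zero_poly, map_zero]
  linear_combination h1 - h2

lemma forall₂_mulActs (Φ : MvPolynomial σ (ZMod 2) →ₐ[ZMod 2] A)
    (π : Polynomial (ZMod 2) →ₐ[ZMod 2] A) {m : ℕ} (hm : π (toPoly m) = 0) (D : ℕ) {l : List σ}
    {ess : List (List ℕ)} (h : List.Forall₂ (fun i es => Φ (X i) = π (expsPoly es)) l ess)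
    (d : ℕ) :
    List.Forall₂ (fun f r => Φ f = π (toPoly r)) (monos (varActs (ZMod 2) l) 1 d)
      (codes (mulActs m D ess) 1 d) := by
  refine forall₂_monos_of_mul Φ π ?_ (by rw [map_one, toPoly_one, map_one]) d
  rw [mulActs, List.forall₂_map_right_iff]
  refine h.imp fun i es hi r => ?_
  rw [hi, apply_clmod_mulExps π hm]

lemma apply_form (Φ : MvPolynomial σ (ZMod 2) →ₐ[ZMod 2] A)
    (π : Polynomial (ZMod 2) →ₐ[ZMod 2] A) {m : ℕ} (hm : π (toPoly m) = 0) (D : ℕ) {l : List σ}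
    {ess : List (List ℕ)} (h : List.Forall₂ (fun i es => Φ (X i) = π (expsPoly es)) l ess)
    (e n : ℕ) : Φ (form l e n) = π (toPoly (xlin n (codes (mulActs m D ess) 1 e))) := by
  have h1 := forall₂_mulActs Φ π hm D h e
  have h2 : ∀ (ms : List (MvPolynomial σ (ZMod 2))) (rs : List ℕ),
      List.Forall₂ (fun f r => Φ f = π (toPoly r)) ms rs →
      ms.map Φ = (rs.map toPoly).map π := by
    intro ms rs h
    induction h with
    | nil => rfl
    | cons h _ ih => simp [h, ih]
  have h3 := map_lin Φ.toLinearMap.toAddMonoidHom (monos (varActs (ZMod 2) l) 1 e) n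
  have h4 := map_lin π.toLinearMap.toAddMonoidHom
    ((codes (mulActs m D ess) 1 e).map toPoly) n
  rw [lin_map_toPoly] at h4
  exact h3.trans ((congrArg (lin n) (h2 _ _ h1)).trans h4.symm)

lemma degree_toPoly_le {m D : ℕ} (h : m < 2 ^ (D + 1)) : (toPoly m).degree ≤ D := by
  rw [Polynomial.degree_le_iff_coeff_zero]
  intro i hi
  rw [coeff_toPoly, Nat.testBit_lt_two_pow (h.trans_le (Nat.pow_le_pow_right two_pos ?_))]
  · simp
  · exact_mod_cast hi

lemma monic_toPoly {m D : ℕ} (h1 : 2 ^ D ≤ m) (h2 : m < 2 ^ (D + 1)) : (toPoly m).Monic := by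
  refine Polynomial.monic_of_degree_le D ?_ ?_
  · exact degree_toPoly_le h2
  · rw [coeff_toPoly, Nat.testBit_eq_decide_div_mod_eq]
    have : m / 2 ^ D = 1 := by
      apply Nat.div_eq_of_lt_le
      · simpa using h1
      · rw [pow_succ] at h2; omega
    simp [this]

lemma degree_toPoly {m D : ℕ} (h1 : 2 ^ D ≤ m) (h2 : m < 2 ^ (D + 1)) :
    (toPoly m).degree = D := by
  refine le_antisymm (degree_toPoly_le h2) ?_
  refine Polynomial.le_degree_of_ne_zero ?_
  rw [coeff_toPoly, Nat.testBit_eq_decide_div_mod_eq]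
  have : m / 2 ^ D = 1 := by
    apply Nat.div_eq_of_lt_le
    · simpa using h1
    · rw [pow_succ] at h2; omega
  simp [this]

/-- The ring `𝔽₂[X] / (m)`. -/
abbrev BinaryRing (m : ℕ) : Type := AdjoinRoot (toPoly m)

/-- The projection from `𝔽₂[X]`. -/
noncomputable def binaryMk (m : ℕ) : Polynomial (ZMod 2) →ₐ[ZMod 2] BinaryRing m :=
  AdjoinRoot.mkₐ (toPoly m)

lemma binaryMk_self (m : ℕ) : binaryMk m (toPoly m) = 0 := AdjoinRoot.mk_self

/-- The representative of smallest degree of an element of `𝔽₂[X] / (m)`. -/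
noncomputable def reduce {m : ℕ} (hm : (toPoly m).Monic) :
    BinaryRing m →ₗ[ZMod 2] Polynomial (ZMod 2) :=
  AdjoinRoot.modByMonicHom hm

lemma reduce_mk {m D r : ℕ} (h1 : 2 ^ D ≤ m) (h2 : m < 2 ^ (D + 1)) (hr : r < 2 ^ D) :
    reduce (monic_toPoly h1 h2) (binaryMk m (toPoly r)) = toPoly r := by
  change AdjoinRoot.modByMonicHom _ (AdjoinRoot.mk _ _) = _
  rw [AdjoinRoot.modByMonicHom_mk, Polynomial.modByMonic_eq_self_iff (monic_toPoly h1 h2),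
    degree_toPoly h1 h2]
  exact degree_toPoly_lt hr

/-- Elimination needs values in `𝔽₂[X]` rather than in a quotient. Taking the smallest
representative is linear, and a code below `2 ^ D` is its own representative. -/
lemma forall₂_reduce {m D : ℕ} (h1 : 2 ^ D ≤ m) (h2 : m < 2 ^ (D + 1))
    {Φ : MvPolynomial σ (ZMod 2) →ₐ[ZMod 2] BinaryRing m} {ms : List (MvPolynomial σ (ZMod 2))}
    {rs : List ℕ} (h : List.Forall₂ (fun f r => Φ f = binaryMk m (toPoly r)) ms rs)
    (hr : rs.all (fun r => Nat.blt r (2 ^ D)) = true) :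
    List.Forall₂ (fun f r => ((reduce (monic_toPoly h1 h2)).comp Φ.toLinearMap) f = toPoly r)
      ms rs := by
  induction h with
  | nil => exact List.Forall₂.nil
  | cons h _ ih =>
    rw [List.all_cons, Bool.and_eq_true] at hr
    refine List.Forall₂.cons ?_ (ih hr.2)
    change reduce (monic_toPoly h1 h2) (Φ _) = _
    rw [h, reduce_mk h1 h2 (Nat.le_of_ble_eq_true hr.1)]

/-- Whether the forms of degree `d` in the kernel of the linear map with the given values on the
monomials are combinations of multiples of the given forms. -/
def kernelCheck (ws : List ℕ) (B d : ℕ) (rows : List ℕ) (gens : List (ℕ × ℕ)) : Bool :=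
  spanCheck 1000 (multipleCodes ws gens d)
    (kern B 1000 (shiftZip B rows (codes (shifts ws) 1 d))) &&
  ((codes (shifts ws) 1 d).all (fun r => Nat.blt r (2 ^ B)) && gens.all fun g => Nat.ble g.1 d)

theorem mem_span_of_kernelCheck {w : σ → ℕ} {l : List σ} (hl : ∀ i, i ∈ l) {d B : ℕ}
    (hw : KronInjective w d) (T : MvPolynomial σ (ZMod 2) →ₗ[ZMod 2] Polynomial (ZMod 2))
    {rows : List ℕ}
    (hT : List.Forall₂ (fun m r => T m = toPoly r) (monos (varActs (ZMod 2) l) 1 d) rows)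
    {gens : List (ℕ × ℕ)} (hc : kernelCheck (l.map w) B d rows gens = true)
    {f : MvPolynomial σ (ZMod 2)} (hf : f ∈ homogeneousSubmodule σ (ZMod 2) d) (h : T f = 0) :
    f ∈ Submodule.span (ZMod 2) {m | m ∈ multiples l gens d} := by
  rw [kernelCheck, Bool.and_eq_true, Bool.and_eq_true] at hc
  refine mem_span_multiples hw ?_ hc.1 hf (kron_mem_polySpan_kern hl T hT hc.2.1 hf h)
  exact fun g hg => Nat.le_of_ble_eq_true (List.all_eq_true.1 hc.2.2 g hg)

end Evaluation

/-! ### Homogeneous components and homogeneous ideals. -/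

section Homogeneous

open MvPolynomial

variable {σ k : Type*} [Field k]

attribute [local instance] MvPolynomial.gradedAlgebra

lemma decompose_eq (f : MvPolynomial σ k) (d : ℕ) :
    (DirectSum.decompose (homogeneousSubmodule σ k) f d : MvPolynomial σ k) =
      homogeneousComponent d f :=
  decomposition.decompose'_apply f d

lemma homogeneousComponent_mul_right {f g : MvPolynomial σ k} {e : ℕ} (hg : g.IsHomogeneous e)
    (d : ℕ) : homogeneousComponent (d + e) (f * g) = homogeneousComponent d f * g := by
  have := DirectSum.coe_decompose_mul_of_right_mem_of_le (homogeneousSubmodule σ k) (a := f)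
    (b := g) hg (Nat.le_add_left e d)
  rwa [Nat.add_sub_cancel, decompose_eq, decompose_eq] at this

lemma homogeneousComponent_mul_right_of_lt {f g : MvPolynomial σ k} {d e : ℕ}
    (hg : g.IsHomogeneous e) (h : d < e) : homogeneousComponent d (f * g) = 0 := by
  rw [← decompose_eq]
  exact DirectSum.coe_decompose_mul_of_right_mem_of_not_le (homogeneousSubmodule σ k) (a := f)
    (b := g) hg (not_le.2 h)

/-- An ideal that contains the homogeneous components of its elements. -/
def HomogeneousIdeal (I : Ideal (MvPolynomial σ k)) : Prop :=
  ∀ f ∈ I, ∀ d, homogeneousComponent d f ∈ I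

lemma homogeneousIdeal_span {S : Set (MvPolynomial σ k)}
    (h : ∀ f ∈ S, ∃ d, f.IsHomogeneous d) : HomogeneousIdeal (Ideal.span S) := by
  intro f hf d
  refine homogeneousComponent_mem_of_mem ?_ hf d
  refine Ideal.homogeneous_span _ _ fun f hf => ?_
  obtain ⟨d, hd⟩ := h f hf
  exact ⟨d, hd⟩

lemma mem_of_components {I : Ideal (MvPolynomial σ k)} {f : MvPolynomial σ k}
    (h : ∀ d, homogeneousComponent d f ∈ I) : f ∈ I := by
  rw [← sum_homogeneousComponent f]
  exact sum_mem fun d _ => h d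

/-- The cofactor of `X i` may be replaced by its component of degree `d`, since the other components
contribute to other degrees and `I` is homogeneous. This is the descent by one degree along a
hyperplane section. -/
lemma exists_sub_X_mul_mem {I : Ideal (MvPolynomial σ k)} (hI : HomogeneousIdeal I) {i : σ}
    {d : ℕ} {f : MvPolynomial σ k} (hf : f ∈ homogeneousSubmodule σ k (d + 1))
    (h : f ∈ I ⊔ Ideal.span {X i}) : ∃ g ∈ homogeneousSubmodule σ k d, f - X i * g ∈ I := by
  obtain ⟨a, ha, b, hb, rfl⟩ := Submodule.mem_sup.1 h
  obtain ⟨c, rfl⟩ := Ideal.mem_span_singleton'.1 hb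
  refine ⟨homogeneousComponent d c, homogeneousComponent_mem d c, ?_⟩
  have h1 := homogeneousComponent_of_mem (m := d + 1) (n := d + 1) hf
  rw [if_pos rfl, map_add, homogeneousComponent_mul_right (isHomogeneous_X k i)] at h1
  have h2 : a + c * X i - X i * homogeneousComponent d c = homogeneousComponent (d + 1) a := by
    rw [← h1]; ring
  rw [h2]
  exact hI a ha _

end Homogeneous

/-! ### Explicit nonics, sections and generators. -/

section Data

open MvPolynomial

/-- The variables of the plane. -/
def vars3 : List (Fin 3) := [0, 1, 2]

/-- The variables of `ℙ⁴`. -/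
def vars5 : List (Fin 5) := [0, 1, 2, 3, 4]

lemma mem_vars3 : ∀ i, i ∈ vars3 := by decide

lemma mem_vars5 : ∀ i, i ∈ vars5 := by decide

/-- The masks of five nonics that form a basis of the linear system. -/
def nonicMasks : List ℕ :=
  [0x716e65695a5, 0x442508eccce4a, 0x2a3f27c378431, 0x142967edc149a, 0xa63a54d38c2fd]

/-- The nonics that form a basis of the linear system. -/
noncomputable def nonicForm (i : Fin 5) : MvPolynomial (Fin 3) (ZMod 2) :=
  form vars3 9 (nonicMasks.getD i 0)

/-- The exponents of the nonics after the substitution `(x, y, z) ↦ (X, X ^ 64, 1)`. -/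
def nonicExps : List (List ℕ) :=
  [[4, 7, 8, 9, 66, 67, 70, 129, 130, 131, 132, 133, 134, 193, 196, 257, 258, 261, 322, 323,
  324, 386, 513], [3, 5, 6, 67, 68, 72, 131, 132, 135, 193, 197, 198, 256, 258, 259, 261, 323,
  324, 385, 512, 513], [3, 4, 7, 9, 67, 71, 130, 132, 193, 196, 257, 260, 261, 320, 321, 322,
  324, 385, 386, 387, 448, 449, 450, 513, 576], [3, 4, 66, 67, 68, 71, 72, 130, 131, 132, 133,
  134, 135, 193, 259, 261, 321, 322, 323, 384, 386, 450, 512, 513], [3, 4, 5, 6, 7, 8, 9, 66,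
  67, 68, 71, 134, 135, 192, 193, 194, 195, 198, 257, 320, 321, 322, 324, 387, 449, 512, 576]]

/-- A polynomial `m` such that the last nonic vanishes at `(X, X ^ 7, 1)` modulo `m`. -/
def curveModulus : ℕ := 0x10208417053a09bf

/-- The values of the nonics at `(X, X ^ 7, 1)` modulo `curveModulus`. -/
def curveExps : List (List ℕ) :=
  [[4, 7, 8, 10, 13, 15, 16, 17, 18, 19, 20, 22, 25, 29, 30, 33, 37, 38, 39, 44, 57], [3, 5, 6,
  10, 11, 15, 17, 18, 21, 22, 26, 27, 28, 30, 31, 33, 38, 39, 43, 56, 57], [5, 6, 8, 9, 11, 16,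
  18, 20, 23, 24, 25, 27, 32, 33, 43, 44, 49, 51, 56, 57], [3, 4, 9, 10, 11, 14, 15, 16, 17, 18,
  19, 20, 21, 22, 31, 33, 36, 37, 38, 42, 44, 51, 56, 57], []]

/-- A polynomial that describes the common moving zeros of the last two nonics. -/
def pointsModulus : ℕ := 2399

/-- The coordinates of the common moving zeros of the last two nonics. -/
def pointsVarExps : List (List ℕ) := [[4, 6, 8, 9], [1], [0]]

/-- The values of the nonics at their common moving zeros. -/
def pointsExps : List (List ℕ) :=
  [[1, 2, 6, 7, 8, 10], [2, 3, 4, 5, 7, 10], [0, 2, 5, 6, 7, 9, 10], [], []]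

/-- Generators of the ideal of the surface in degrees `4` and `5`. -/
def lowGens : List (ℕ × ℕ) :=
  [(4, 0x14002880c81b1170fd),
    (5, 0x10000b0b16fcd60951b1257883f0a),
    (5, 0x2000488108b5414a05e0830f47a3ee),
    (5, 0x9420659b51238c334121c2296edc9f),
    (5, 0x306d40d14d1830afa209599a01ca80c),
    (5, 0x506d45b158df78f4308c16a01b40b82)]

/-- Further generators of the ideal of the surface in degree `6`. -/
def sexticGens : List (ℕ × ℕ) :=
  [(6, 0x200ac774106d43f1568af474b1ba2aa8574a7ae),
    (6, 0x80152010c4c1235da46401ad24795c26f8f7c8c5413655c3986)]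

/-- Generators of the ideal of the surface. -/
def surfaceGens : List (ℕ × ℕ) := lowGens ++ sexticGens

/-- Weights for the Kronecker substitution in the plane. -/
def weights3 : Fin 3 → ℕ := ![1, 64, 0]

/-- Weights for the Kronecker substitution in `ℙ⁴`. -/
def weights5 : Fin 5 → ℕ := ![1, 8, 64, 512, 0]

lemma map_weights5 : vars5.map weights5 = [1, 8, 64, 512, 0] := rfl

/-- The exponents of `x` and `y` are digits in base 64, and the degree then determines the exponent
of `z`. The five-variable case uses base 8 in the same way. -/
lemma kronInjective3 {d : ℕ} (hd : d < 64) : KronInjective weights3 d := by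
  intro s t hs ht h
  rw [Finsupp.degree_eq_sum, Fin.sum_univ_three] at hs ht
  rw [Finsupp.sum_fintype _ _ (by simp), Finsupp.sum_fintype _ _ (by simp), Fin.sum_univ_three,
    Fin.sum_univ_three] at h
  simp only [weights3, Matrix.cons_val] at h
  ext i
  fin_cases i <;> simp only [Fin.zero_eta, Fin.mk_one, Fin.reduceFinMk] <;> omega

lemma kronInjective5 {d : ℕ} (hd : d < 8) : KronInjective weights5 d := by
  intro s t hs ht h
  rw [Finsupp.degree_eq_sum, Fin.sum_univ_five] at hs ht
  rw [Finsupp.sum_fintype _ _ (by simp), Finsupp.sum_fintype _ _ (by simp), Fin.sum_univ_five,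
    Fin.sum_univ_five] at h
  simp only [weights5, Matrix.cons_val] at h
  have h0 : s 0 = t 0 := by omega
  have h1 : s 1 = t 1 := by omega
  have h2 : s 2 = t 2 := by omega
  ext i
  fin_cases i <;> simp only [Fin.zero_eta, Fin.mk_one, Fin.reduceFinMk] <;> omega

/-- The parametrization of the surface. -/
noncomputable def paramHom :
    MvPolynomial (Fin 5) (ZMod 2) →ₐ[ZMod 2] MvPolynomial (Fin 3) (ZMod 2) :=
  aeval nonicForm

lemma paramHom_X (i : Fin 5) : paramHom (X i) = nonicForm i := aeval_X _ _

lemma nonicForm_homogeneous (i : Fin 5) : (nonicForm i).IsHomogeneous 9 := form_mem _ _ _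

lemma paramHom_homogeneous {f : MvPolynomial (Fin 5) (ZMod 2)} {d : ℕ} (hf : f.IsHomogeneous d) :
    (paramHom f).IsHomogeneous (9 * d) := hf.aeval _ nonicForm_homogeneous

variable {A : Type*} [CommRing A] [Algebra (ZMod 2) A]

/-- Values of the nonics under a homomorphism. -/
lemma forall₂_comp_paramHom (Φ : MvPolynomial (Fin 3) (ZMod 2) →ₐ[ZMod 2] A)
    (π : Polynomial (ZMod 2) →ₐ[ZMod 2] A) {m D : ℕ} (hm : π (toPoly m) = 0)
    {ess : List (List ℕ)} (h : List.Forall₂ (fun i es => Φ (X i) = π (expsPoly es)) vars3 ess)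
    {ess' : List (List ℕ)}
    (hc : (nonicMasks.map fun n => xlin n (codes (mulActs m D ess) 1 9)) =
      ess'.map fun es => mulExps 1 es 0) :
    List.Forall₂ (fun i es => (Φ.comp paramHom) (X i) = π (expsPoly es)) vars5 ess' := by
  have h1 : List.Forall₂ (fun i n => (Φ.comp paramHom) (X i) = Φ (form vars3 9 n)) vars5
      nonicMasks := by
    simp [vars5, nonicMasks, paramHom_X, nonicForm]
  have h2 : ∀ (is : List (Fin 5)) (ns : List ℕ) (ess' : List (List ℕ)),
      List.Forall₂ (fun i n => (Φ.comp paramHom) (X i) = Φ (form vars3 9 n)) is ns →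
      (ns.map fun n => xlin n (codes (mulActs m D ess) 1 9)) =
        (ess'.map fun es => mulExps 1 es 0) →
      List.Forall₂ (fun i es => (Φ.comp paramHom) (X i) = π (expsPoly es)) is ess' := by
    intro is ns ess' h3 hc
    induction h3 generalizing ess' with
    | nil => cases ess' <;> simp_all
    | @cons i n is ns hi _ ih =>
      cases ess' with
      | nil => simp at hc
      | cons es ess' =>
        simp only [List.map_cons, List.cons.injEq] at hc
        refine List.Forall₂.cons ?_ (ih _ hc.2)
        have := toPoly_mulExps 1 es 0
        rw [toPoly_zero, toPoly_one, zero_add, mul_one] at this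
        rw [hi, apply_form Φ π hm D h, hc.1, this]
  exact h2 _ _ _ h1 hc

lemma kron_vars (w : Fin 3 → ℕ) : List.Forall₂ (fun i es => kron w (X i) =
    AlgHom.id (ZMod 2) (Polynomial (ZMod 2)) (expsPoly es)) vars3 [[w 0], [w 1], [w 2]] := by
  simp [vars3, kron, expsPoly]

lemma nonicExps_spec : List.Forall₂ (fun i es => ((kron weights3).comp paramHom) (X i) =
    AlgHom.id (ZMod 2) (Polynomial (ZMod 2)) (expsPoly es)) vars5 nonicExps :=
  -- Modulus zero: the products are computed without reduction.
  forall₂_comp_paramHom (m := 0) (D := 0) (kron weights3) (AlgHom.id _ _)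
    (by rw [toPoly_zero, map_zero]) (kron_vars weights3)
    (show _ = _ by
      change (nonicMasks.map fun n => xlin n (codes (mulActs 0 0 [[1], [64], [0]]) 1 9)) = _
      decide +kernel)

/-- Forms of low degree in the ideal of the surface. -/
lemma mem_span_of_paramHom_eq_zero {d B : ℕ} (hd : d < 8) {gens : List (ℕ × ℕ)}
    (hc : kernelCheck [1, 8, 64, 512, 0] B d (codes (mulActs 0 0 nonicExps) 1 d) gens = true)
    {f : MvPolynomial (Fin 5) (ZMod 2)} (hf : f ∈ homogeneousSubmodule (Fin 5) (ZMod 2) d)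
    (h : paramHom f = 0) :
    f ∈ Submodule.span (ZMod 2) {m | m ∈ multiples vars5 gens d} := by
  rw [← map_weights5] at hc
  refine mem_span_of_kernelCheck mem_vars5 (kronInjective5 hd)
    ((kron weights3).comp paramHom).toLinearMap ?_ hc hf (by
      change kron weights3 (paramHom f) = 0; rw [h, map_zero])
  exact forall₂_mulActs ((kron weights3).comp paramHom) (AlgHom.id _ _)
    (by rw [toPoly_zero, map_zero]) 0 nonicExps_spec d

/-- The image is a plane form of degree `9 * e ≤ 54 < 64`, so its vanishing can be tested after the
Kronecker substitution. -/
lemma paramHom_form_eq_zero {e n : ℕ} (he : e < 7)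
    (hc : xlin n (codes (mulActs 0 0 nonicExps) 1 e) = 0) : paramHom (form vars5 e n) = 0 := by
  refine kron_eq_zero (kronInjective3 (d := 9 * e) (by omega))
    (paramHom_homogeneous (form_mem _ _ _)) ?_
  have := apply_form ((kron weights3).comp paramHom) (AlgHom.id _ _) (m := 0)
    (by rw [toPoly_zero, map_zero]) 0 nonicExps_spec e n
  rw [hc, toPoly_zero, map_zero] at this
  exact this

/-- The homomorphism to `𝔽₂[X] / (curveModulus)` given by a family of points of the curve on which
the last nonic vanishes. -/
noncomputable def curveHom :
    MvPolynomial (Fin 3) (ZMod 2) →ₐ[ZMod 2] BinaryRing curveModulus :=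
  (binaryMk curveModulus).comp (kron ![1, 7, 0])

/-- At `(X, X ^ 7, 1)` the last nonic equals `X ^ 3` times `curveModulus`, the factor `X ^ 3`
reflecting the triple point at `P`; the modulus has degree `63 - 3 = 60`. -/
lemma curveExps_spec : List.Forall₂ (fun i es => (curveHom.comp paramHom) (X i) =
    binaryMk curveModulus (expsPoly es)) vars5 curveExps := by
  refine forall₂_comp_paramHom curveHom _ (D := 60) (binaryMk_self _) (ess := [[1], [7], [0]])
    ?_ (by decide +kernel)
  exact (kron_vars ![1, 7, 0]).imp fun i es h => congrArg (binaryMk curveModulus) h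

/-- The homomorphism to `𝔽₂[X] / (pointsModulus)` given by the common moving zeros of the last two
nonics. -/
noncomputable def pointsHom :
    MvPolynomial (Fin 3) (ZMod 2) →ₐ[ZMod 2] BinaryRing pointsModulus :=
  aeval fun i => binaryMk pointsModulus (expsPoly (pointsVarExps.getD i []))

/-- The modulus 2399 has degree `11 = 81 - 9 - 4 * 14 - 5`, the intersection number of two nonics
away from the base points. The two empty entries record the vanishing of the last two nonics. -/
lemma pointsExps_spec : List.Forall₂ (fun i es => (pointsHom.comp paramHom) (X i) =
    binaryMk pointsModulus (expsPoly es)) vars5 pointsExps := by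
  refine forall₂_comp_paramHom pointsHom _ (D := 11) (binaryMk_self _) (ess := pointsVarExps)
    ?_ (by decide +kernel)
  simp [vars3, pointsVarExps, pointsHom]

/-- Forms of degree `6` that vanish on a family of points with values in `𝔽₂[X] / (m)`. -/
lemma mem_span_of_comp_eq_zero {m D d B : ℕ} (h1 : 2 ^ D ≤ m) (h2 : m < 2 ^ (D + 1)) (hd : d < 8)
    (Φ : MvPolynomial (Fin 5) (ZMod 2) →ₐ[ZMod 2] BinaryRing m) {ess : List (List ℕ)}
    (hess : List.Forall₂ (fun i es => Φ (X i) = binaryMk m (expsPoly es)) vars5 ess)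
    {gens : List (ℕ × ℕ)}
    (hc : (kernelCheck [1, 8, 64, 512, 0] B d (codes (mulActs m D ess) 1 d) gens &&
      (codes (mulActs m D ess) 1 d).all fun r => Nat.blt r (2 ^ D)) = true)
    {f : MvPolynomial (Fin 5) (ZMod 2)} (hf : f ∈ homogeneousSubmodule (Fin 5) (ZMod 2) d)
    (h : Φ f = 0) : f ∈ Submodule.span (ZMod 2) {m | m ∈ multiples vars5 gens d} := by
  rw [Bool.and_eq_true, ← map_weights5] at hc
  refine mem_span_of_kernelCheck mem_vars5 (kronInjective5 hd) _
    (forall₂_reduce h1 h2 (forall₂_mulActs Φ (binaryMk m) (binaryMk_self m) D hess d) hc.2) hc.1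
    hf ?_
  change reduce (monic_toPoly h1 h2) (Φ f) = 0
  rw [h, map_zero]

end Data

/-! ### The ideals of the surface, the curve and the points: checks in low degree. -/

section SurfaceIdeal

open MvPolynomial

local notation "R₅" => MvPolynomial (Fin 5) (ZMod 2)

/-- The ideal of the surface, by generators. -/
noncomputable def surface : Ideal R₅ := formIdeal vars5 surfaceGens

lemma formIdeal_homogeneous (gens : List (ℕ × ℕ)) : HomogeneousIdeal (formIdeal vars5 gens) :=
  homogeneousIdeal_span (by rintro _ ⟨g, _, rfl⟩; exact ⟨g.1, form_mem _ _ _⟩)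

/-- In degree 1 the mask `2 ^ i` selects `X i`. Hyperplane sections are thus again given by lists of
masks, to which the checks apply. -/
lemma formIdeal_append_X (gens : List (ℕ × ℕ)) (i : Fin 5) :
    formIdeal vars5 (gens ++ [(1, 2 ^ (i : ℕ))]) = formIdeal vars5 gens ⊔ Ideal.span {X i} := by
  have hX : form vars5 1 (2 ^ (i : ℕ)) = X i := by
    fin_cases i <;>
      simp [form, vars5, varActs, monos, prep, lin]
  rw [formIdeal, formIdeal, ← Ideal.span_union]
  congr 1
  ext f
  simp only [List.mem_append, List.mem_singleton, Set.mem_union, Set.mem_ofPred_eq,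
    Set.mem_singleton_iff]
  constructor
  · rintro ⟨g, hg | rfl, rfl⟩
    · exact Or.inl ⟨g, hg, rfl⟩
    · exact Or.inr hX
  · rintro (⟨g, hg, rfl⟩ | rfl)
    · exact ⟨g, Or.inl hg, rfl⟩
    · exact ⟨_, Or.inr rfl, hX.symm⟩

lemma paramHom_eq_zero_of_mem {f : R₅} (hf : f ∈ surface) : paramHom f = 0 := by
  have hc : (surfaceGens.all fun g => Nat.blt g.1 7 &&
      Nat.beq 0 (xlin g.2 (codes (mulActs 0 0 nonicExps) 1 g.1))) = true := by decide +kernel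
  suffices h : surface ≤ RingHom.ker paramHom from h hf
  refine Ideal.span_le.2 ?_
  rintro _ ⟨g, hg, rfl⟩
  have := List.all_eq_true.1 hc g hg
  rw [Bool.and_eq_true] at this
  exact paramHom_form_eq_zero (Nat.le_of_ble_eq_true this.1) (Nat.eq_of_beq_eq_true this.2).symm

/-- The ideal of the curve in which the surface meets `x₄ = 0`. -/
noncomputable def curve : Ideal R₅ := formIdeal vars5 (surfaceGens ++ [(1, 16)])

/-- The ideal of the points in which the surface meets `x₃ = x₄ = 0`. -/
noncomputable def points : Ideal R₅ := formIdeal vars5 (surfaceGens ++ [(1, 16)] ++ [(1, 8)])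

lemma curve_eq : curve = surface ⊔ Ideal.span {X 4} := formIdeal_append_X _ 4

lemma points_eq : points = curve ⊔ Ideal.span {X 3} := formIdeal_append_X _ 3

lemma mem_points_of_degree_six {f : R₅} (hf : f ∈ homogeneousSubmodule (Fin 5) (ZMod 2) 6)
    (h : pointsHom (paramHom f) = 0) : f ∈ points :=
  -- The bound `3584 = 7 * 512` exceeds the largest Kronecker exponent `6 * 512` in degree 6.
  span_multiples_le _ _ _ (mem_span_of_comp_eq_zero (m := pointsModulus) (D := 11) (B := 3584)
    (by decide) (by decide) (by decide) (pointsHom.comp paramHom) pointsExps_spec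
    (by decide +kernel) hf h)

/-- Only the sample of the plane curve cut out by `y * z ^ 6 = x ^ 7` is used; in degree 6 its
linear conditions already force membership in the ideal. -/
lemma mem_curve_of_degree_six {f : R₅} (hf : f ∈ homogeneousSubmodule (Fin 5) (ZMod 2) 6)
    (h : curveHom (paramHom f) = 0) : f ∈ curve :=
  span_multiples_le _ _ _ (mem_span_of_comp_eq_zero (m := curveModulus) (D := 60) (B := 3584)
    (by decide) (by decide) (by decide) (curveHom.comp paramHom) curveExps_spec
    (by decide +kernel) hf h)

/-- The list of generators depends on `d` because the check admits only generators of degree at most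
`d`. There are none in degree 3, and only the quartic in degree 4. -/
lemma paramHom_low_degree {f : R₅} {d : ℕ} (hf : f ∈ homogeneousSubmodule (Fin 5) (ZMod 2) d)
    (h3 : 3 ≤ d) (h5 : d ≤ 5) (h : paramHom f = 0) :
    f ∈ Submodule.span (ZMod 2) {m | m ∈ multiples vars5
      (if d = 3 then [] else if d = 4 then lowGens.take 1 else lowGens) d} := by
  obtain rfl | rfl | rfl : d = 3 ∨ d = 4 ∨ d = 5 := by omega
  all_goals exact mem_span_of_paramHom_eq_zero (B := 3584) (by decide) (by decide +kernel) hf h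

/-- The points do not meet the hyperplane `x₂ = 0`, so the ideal of their section contains all forms
of some degree. Elimination with all monomials of degree 6 as targets shows that 6 suffices. -/
lemma artinian {f : R₅} (hf : f ∈ homogeneousSubmodule (Fin 5) (ZMod 2) 6) :
    f ∈ points ⊔ Ideal.span {X 2} := by
  rw [points, ← formIdeal_append_X]
  refine span_multiples_le _ _ 6 (mem_span_multiples (w := weights5) (kronInjective5 (by decide))
    (ts := codes (shifts [1, 8, 64, 512, 0]) 1 6) (fuel := 1000) ?_ ?_ hf ?_)
  · intro g hg
    have hc : ((surfaceGens ++ [(1, 16)] ++ [(1, 8)] ++ [(1, 2 ^ ((2 : Fin 5) : ℕ))]).all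
      fun g => Nat.ble g.1 6) = true := by decide +kernel
    exact Nat.le_of_ble_eq_true (List.all_eq_true.1 hc g hg)
  · rw [map_weights5]; decide +kernel
  · have h1 := forall₂_kron weights5 vars5 (q := 1) (a := 1) (by rw [map_one, toPoly_one]) 6
    rw [map_weights5] at h1
    have h2 : Submodule.span (ZMod 2) {g | g ∈ monos (varActs (ZMod 2) vars5) 1 6} ≤
        (polySpan (codes (shifts [1, 8, 64, 512, 0]) 1 6)).comap (kron weights5).toLinearMap := by
      rw [Submodule.span_le]
      intro m hm
      generalize codes (shifts [1, 8, 64, 512, 0]) 1 6 = rs at *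
      generalize monos (varActs (ZMod 2) vars5) 1 6 = ms at *
      induction h1 with
      | nil => simp at hm
      | cons h _ ih =>
        rw [SetLike.mem_coe, Submodule.mem_comap, polySpan_cons]
        rcases List.mem_cons.1 hm with rfl | hm
        · exact Submodule.mem_sup_left (Submodule.mem_span_singleton.2 ⟨1, by
            rw [one_smul, ← h]; rfl⟩)
        · exact Submodule.mem_sup_right (ih hm)
    exact h2 (mem_span_monos mem_vars5 hf)

end SurfaceIdeal

/-! ### Irreducibility of the last nonic. -/

section Irreducible

open MvPolynomial

lemma exists_toPoly {p : Polynomial (ZMod 2)} {k : ℕ} (h : p.degree < k) :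
    ∃ n < 2 ^ k, p = toPoly n := by
  induction k generalizing p with
  | zero =>
    refine ⟨0, by simp, ?_⟩
    rw [toPoly_zero]
    ext i
    rw [Polynomial.coeff_zero]
    exact Polynomial.coeff_eq_zero_of_degree_lt (h.trans_le (by exact_mod_cast Nat.zero_le i))
  | succ k ih =>
    have hlow : (p - Polynomial.C (p.coeff k) * Polynomial.X ^ k).degree < (k : WithBot ℕ) := by
      rw [Polynomial.degree_lt_iff_coeff_zero] at h ⊢
      intro m hm
      rw [Polynomial.coeff_sub, Polynomial.coeff_C_mul_X_pow]
      split_ifs with hmk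
      · rw [hmk, sub_self]
      · rw [h m (by omega), sub_zero]
    obtain ⟨n, hn, he⟩ := ih hlow
    have hp : p = toPoly n + Polynomial.C (p.coeff k) * Polynomial.X ^ k := by
      rw [← he]; ring
    have hc : p.coeff k = 0 ∨ p.coeff k = 1 := by
      generalize p.coeff k = c
      revert c; decide
    rcases hc with hc | hc
    · exact ⟨n, by rw [pow_succ]; omega, by rw [hp, hc]; simp⟩
    · refine ⟨n ^^^ (1 <<< k), ?_, ?_⟩
      · refine Nat.xor_lt_two_pow (hn.trans (Nat.pow_lt_pow_right (by omega) (by omega))) ?_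
        rw [Nat.one_shiftLeft]
        exact Nat.pow_lt_pow_right (by omega) (by omega)
      · rw [toPoly_xor, toPoly_two_pow]
        rw [hp, hc]; simp

/-- Trial division of binary polynomials. -/
lemma irreducible_toPoly {N k : ℕ} (h1 : 2 ^ k ≤ N) (h2 : N < 2 ^ (k + 1)) (hk : 0 < k)
    (hc : ((List.range (k / 2)).all fun j => (List.range (2 ^ (j + 1))).all fun i =>
      force (clmod (2 ^ (j + 1) + i) (j + 1) k N) fun r =>
        Nat.blt 0 r && Nat.blt r (2 ^ (j + 1))) = true) :
    Irreducible (toPoly N) := by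
  have hdeg := degree_toPoly h1 h2
  have hnat : (toPoly N).natDegree = k := Polynomial.natDegree_eq_of_degree_eq_some hdeg
  refine ((monic_toPoly h1 h2).irreducible_iff_lt_natDegree_lt (fun h => ?_)).2 ?_
  · rw [h, Polynomial.natDegree_one] at hnat; omega
  intro q hq hqd hdvd
  rw [Finset.mem_Ioc, hnat] at hqd
  obtain ⟨j, hj⟩ : ∃ j, q.natDegree = j + 1 := ⟨q.natDegree - 1, by omega⟩
  have hqdeg : q.degree = ((j + 1 : ℕ) : WithBot ℕ) := by
    rw [Polynomial.degree_eq_natDegree hq.ne_zero, hj]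
  obtain ⟨n, hn, rfl⟩ := exists_toPoly (p := q) (k := j + 2)
    (by rw [hqdeg]; exact_mod_cast Nat.lt_succ_self _)
  have hn' : 2 ^ (j + 1) ≤ n := by
    by_contra hlt
    have := degree_toPoly_lt (not_le.1 hlt)
    rw [hqdeg] at this
    exact lt_irrefl _ this
  -- The monic polynomials of degree `j + 1` have the codes `2 ^ (j + 1) + i` with `i < 2 ^ (j +
  -- 1)`. The check says that the remainder is nonzero and of smaller degree than the divisor.
  have h3 := List.all_eq_true.1 (List.all_eq_true.1 hc j (List.mem_range.2 (by omega)))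
    (n - 2 ^ (j + 1)) (List.mem_range.2 (by rw [pow_succ] at hn; omega))
  rw [force_eq, Nat.add_sub_cancel' hn', Bool.and_eq_true] at h3
  have hr0 := Nat.le_of_ble_eq_true h3.1
  have hr1 := degree_toPoly_lt (Nat.le_of_ble_eq_true h3.2)
  have hd := (dvd_add_left hdvd).1 (dvd_toPoly_clmod_add n (j + 1) k N)
  have hne : toPoly (clmod n (j + 1) k N) ≠ 0 := by
    intro h
    rw [← toPoly_zero] at h
    have := toPoly_injective h
    omega
  have := Polynomial.degree_le_of_dvd hd hne
  rw [hqdeg] at this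
  exact absurd (this.trans_lt hr1) (lt_irrefl _)

/-- The restriction of forms to the line `x = z`. -/
noncomputable def lineHom : MvPolynomial (Fin 3) (ZMod 2) →ₐ[ZMod 2] Polynomial (ZMod 2) :=
  kron ![1, 0, 1]

lemma lineHom_form (n : ℕ) : lineHom (form vars3 9 n) =
    toPoly (xlin n (codes (mulActs 0 0 [[1], [0], [1]]) 1 9)) :=
  apply_form lineHom (AlgHom.id (ZMod 2) _) (m := 0) (by rw [toPoly_zero, map_zero]) 0
    (kron_vars ![1, 0, 1]) 9 n

lemma lineHom_nonicForm : lineHom (nonicForm 4) = toPoly 0b1001101111 := by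
  have hc : xlin (nonicMasks.getD 4 0) (codes (mulActs 0 0 [[1], [0], [1]]) 1 9) =
    0b1001101111 := by decide +kernel
  rw [← hc]
  exact lineHom_form _

lemma natDegree_lineHom_le (f : MvPolynomial (Fin 3) (ZMod 2)) :
    (lineHom f).natDegree ≤ f.totalDegree := by
  have := MvPolynomial.aeval_natDegree_le f le_rfl
    (fun i => (Polynomial.X : Polynomial (ZMod 2)) ^ (![1, 0, 1] : Fin 3 → ℕ) i) (n := 1) (by
      intro i
      rw [Polynomial.natDegree_X_pow]
      fin_cases i <;> simp)
  rwa [mul_one] at this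

/-- The restriction to the line `(X : 1 : X)` keeps the full degree 9 and is irreducible by trial
division. If the nonic is a product, one factor becomes constant on the line; the other then has
degree 9 already, so the first factor is a constant. -/
lemma irreducible_nonicForm : Irreducible (nonicForm 4) := by
  have hirr : Irreducible (lineHom (nonicForm 4)) := by
    rw [lineHom_nonicForm]
    exact irreducible_toPoly (k := 9) (by decide) (by decide) (by decide) (by decide +kernel)
  have hdeg : (lineHom (nonicForm 4)).natDegree = 9 := by
    rw [lineHom_nonicForm]
    exact Polynomial.natDegree_eq_of_degree_eq_some (degree_toPoly (by decide) (by decide))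
  have hne : nonicForm 4 ≠ 0 := by
    intro h
    rw [h, map_zero, Polynomial.natDegree_zero] at hdeg
    omega
  have key : ∀ g h, nonicForm 4 = g * h → IsUnit (lineHom g) → IsUnit g := by
    intro g h hgh hu
    have hg0 : g ≠ 0 := by rintro rfl; exact hne (by rw [hgh, zero_mul])
    have hh0 : h ≠ 0 := by rintro rfl; exact hne (by rw [hgh, mul_zero])
    have h1 : (lineHom h).natDegree = 9 := by
      rw [hgh, map_mul] at hdeg
      have hl0 : lineHom h ≠ 0 := by
        intro h0; rw [h0, mul_zero, Polynomial.natDegree_zero] at hdeg; omega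
      rwa [Polynomial.natDegree_mul hu.ne_zero hl0, Polynomial.natDegree_eq_zero_of_isUnit hu,
        zero_add] at hdeg
    have h2 := natDegree_lineHom_le h
    have h3 := totalDegree_mul_of_isDomain hg0 hh0
    rw [← hgh, (nonicForm_homogeneous 4).totalDegree hne] at h3
    have h4 : g.totalDegree = 0 := by omega
    rw [totalDegree_eq_zero_iff_eq_C] at h4
    rw [h4] at hg0 ⊢
    refine IsUnit.map C (isUnit_iff_ne_zero.2 fun h0 => hg0 ?_)
    rw [h0, map_zero]
  refine ⟨fun hu => hirr.not_isUnit (hu.map lineHom), fun g h hgh => ?_⟩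
  rcases hirr.isUnit_or_isUnit (by rw [hgh, map_mul]) with hu | hu
  · exact Or.inl (key g h hgh hu)
  · exact Or.inr (key h g (by rw [hgh, mul_comm]) hu)

/-- On the line `x = z` the fourth nonic is nonzero of degree below 9, whereas the last one has
degree 9. -/
lemma not_nonicForm_dvd : ¬ nonicForm 4 ∣ nonicForm 3 := by
  intro h
  have h1 := lineHom_form (nonicMasks.getD 3 0)
  have h2 := map_dvd lineHom h
  rw [lineHom_nonicForm, nonicForm, show ((3 : Fin 5) : ℕ) = 3 from rfl, h1] at h2
  have hc : (Nat.blt 0 (xlin (nonicMasks.getD 3 0) (codes (mulActs 0 0 [[1], [0], [1]]) 1 9)) &&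
    Nat.blt (xlin (nonicMasks.getD 3 0) (codes (mulActs 0 0 [[1], [0], [1]]) 1 9)) (2 ^ 9)) =
      true := by decide +kernel
  rw [Bool.and_eq_true] at hc
  have h3 := Polynomial.degree_le_of_dvd h2 (fun h0 => by
    rw [← toPoly_zero] at h0
    have h4 := Nat.le_of_ble_eq_true hc.1
    have h5 := toPoly_injective h0
    omega)
  have h4 := degree_toPoly_lt (Nat.le_of_ble_eq_true hc.2)
  rw [degree_toPoly (D := 9) (by decide) (by decide)] at h3
  exact absurd (h3.trans_lt h4) (lt_irrefl _)

lemma nonicForm_dvd_of_dvd_mul {f : MvPolynomial (Fin 3) (ZMod 2)}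
    (h : nonicForm 4 ∣ nonicForm 3 * f) : nonicForm 4 ∣ f :=
  (irreducible_nonicForm.prime.dvd_or_dvd h).resolve_left not_nonicForm_dvd

end Irreducible

/-! ### Descent along hyperplane sections: the generators of the ideal. -/

section Generators

open MvPolynomial

local notation "R₅" => MvPolynomial (Fin 5) (ZMod 2)

local notation "H" => homogeneousSubmodule (Fin 5) (ZMod 2)

lemma curveHom_nonicForm : curveHom (nonicForm 4) = 0 := by
  have := curveExps_spec
  simp only [vars5, curveExps, List.forall₂_cons, AlgHom.comp_apply, paramHom_X] at this
  rw [this.2.2.2.2.1]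
  simp [expsPoly]

lemma pointsHom_nonicForm : pointsHom (nonicForm 3) = 0 ∧ pointsHom (nonicForm 4) = 0 := by
  have := pointsExps_spec
  simp only [vars5, pointsExps, List.forall₂_cons, AlgHom.comp_apply, paramHom_X] at this
  constructor
  · rw [this.2.2.2.1]; simp [expsPoly]
  · rw [this.2.2.2.2.1]; simp [expsPoly]

lemma isUnit_pointsHom : IsUnit (pointsHom (nonicForm 2)) := by
  have := pointsExps_spec
  simp only [vars5, pointsExps, List.forall₂_cons, AlgHom.comp_apply, paramHom_X] at this
  rw [this.2.2.1]
  -- 457 encodes the inverse of the third nonic modulo `pointsModulus`.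
  refine IsUnit.of_mul_eq_one (binaryMk pointsModulus (toPoly 457)) ?_
  rw [← apply_clmod_mulExps _ (binaryMk_self _) 11 11]
  have hc : clmod pointsModulus 11 11 (mulExps 457 (pointsExps.getD 2 []) 0) = 1 := by
    decide +kernel
  exact (congrArg (fun n => binaryMk pointsModulus (toPoly n)) hc).trans
    (by rw [toPoly_one, map_one])

lemma pointsHom_eq_zero_of_mem {f : R₅} (hf : f ∈ points) : pointsHom (paramHom f) = 0 := by
  suffices h : points ≤ RingHom.ker (pointsHom.comp paramHom) from h hf
  rw [points_eq, curve_eq]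
  refine sup_le (sup_le (fun f hf => ?_) ?_) ?_
  · rw [RingHom.mem_ker, AlgHom.comp_apply, paramHom_eq_zero_of_mem hf, map_zero]
  · rw [Ideal.span_singleton_le_iff_mem, RingHom.mem_ker, AlgHom.comp_apply, paramHom_X,
      pointsHom_nonicForm.2]
  · rw [Ideal.span_singleton_le_iff_mem, RingHom.mem_ker, AlgHom.comp_apply, paramHom_X,
      pointsHom_nonicForm.1]

/-- By `artinian` a sextic is `X 2 * g` modulo `points`, with `g` of degree 5. Multiplying by a
variable raises `g` to degree 6 and keeps the factor `X 2`. -/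
lemma degree_seven_le {f : R₅} (hf : f ∈ H 7) : ∃ g ∈ H 6, f - X 2 * g ∈ points := by
  have h : H 7 ≤ points.restrictScalars (ZMod 2) ⊔
      (H 6).map (LinearMap.mulLeft (ZMod 2) (X 2)) := by
    refine homogeneousSubmodule_succ_le fun i f hf => ?_
    obtain ⟨g, hg, hfg⟩ := exists_sub_X_mul_mem (formIdeal_homogeneous _) hf (artinian hf)
    have : X i * f = X i * (f - X 2 * g) + X 2 * (X i * g) := by ring
    rw [this]
    refine Submodule.add_mem_sup (points.mul_mem_left _ hfg) ⟨X i * g, ?_, rfl⟩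
    have := (isHomogeneous_X (ZMod 2) i).mul hg
    exact this
  obtain ⟨a, ha, _, ⟨g, hg, rfl⟩, rfl⟩ := Submodule.mem_sup.1 (h hf)
  exact ⟨g, hg, by simpa using ha⟩

lemma exists_sub_X_pow_mul_mem (k : ℕ) {f : R₅} (hf : f ∈ H (k + 6)) :
    ∃ g ∈ H 6, f - X 2 ^ k * g ∈ points := by
  induction k generalizing f with
  | zero => exact ⟨f, by simpa using hf, by simp⟩
  | succ k ih =>
    have h : H (k + 6 + 1) ≤ points.restrictScalars (ZMod 2) ⊔
        (H 6).map (LinearMap.mulLeft (ZMod 2) (X 2 ^ (k + 1))) := by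
      refine homogeneousSubmodule_succ_le fun i f hf => ?_
      obtain ⟨g, hg, hfg⟩ := ih hf
      obtain ⟨g', hg', hgg'⟩ := degree_seven_le (f := X i * g) (by
        have := (isHomogeneous_X (ZMod 2) i).mul hg
        exact this)
      have : X i * f = (X i * (f - X 2 ^ k * g) + X 2 ^ k * (X i * g - X 2 * g')) +
          X 2 ^ (k + 1) * g' := by ring
      rw [this]
      exact Submodule.add_mem_sup
        (add_mem (points.mul_mem_left _ hfg) (points.mul_mem_left _ hgg')) ⟨g', hg', rfl⟩
    rw [show k + 1 + 6 = k + 6 + 1 by ring] at hf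
    obtain ⟨a, ha, _, ⟨g, hg, rfl⟩, rfl⟩ := Submodule.mem_sup.1 (h hf)
    exact ⟨g, hg, by simpa using ha⟩

/-- Modulo `points`, a form of degree `k + 6` is `X 2 ^ k * g` with a sextic `g`. As `X 2` is
invertible at the points, `g` vanishes there too, and sextics have been checked. -/
lemma mem_points {k : ℕ} {f : R₅} (hf : f ∈ H (k + 6)) (h : pointsHom (paramHom f) = 0) :
    f ∈ points := by
  obtain ⟨g, hg, hfg⟩ := exists_sub_X_pow_mul_mem k hf
  have h1 := pointsHom_eq_zero_of_mem hfg
  rw [map_sub, map_sub, h, zero_sub, neg_eq_zero, map_mul, map_mul, map_pow, map_pow,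
    paramHom_X, (isUnit_pointsHom.pow k).mul_right_eq_zero] at h1
  have := add_mem hfg (points.mul_mem_left (X 2 ^ k) (mem_points_of_degree_six hg h1))
  rwa [sub_add_cancel] at this

/-- A form that vanishes on the curve vanishes at the points, hence is `X 3 * g` modulo `curve`. The
last nonic is prime and does not divide the fourth, so it divides the image of `g`, to which the
induction applies. -/
lemma mem_curve {k : ℕ} {f : R₅} (hf : f ∈ H (k + 6)) (h : nonicForm 4 ∣ paramHom f) :
    f ∈ curve := by
  induction k generalizing f with
  | zero =>
    refine mem_curve_of_degree_six (by simpa using hf) ?_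
    obtain ⟨c, hc⟩ := h
    rw [hc, map_mul, curveHom_nonicForm, zero_mul]
  | succ k ih =>
    have h1 : f ∈ points := mem_points hf (by
      obtain ⟨c, hc⟩ := h
      rw [hc, map_mul, pointsHom_nonicForm.2, zero_mul])
    rw [show k + 1 + 6 = k + 6 + 1 by ring] at hf
    rw [points_eq] at h1
    obtain ⟨g, hg, hfg⟩ := exists_sub_X_mul_mem (formIdeal_homogeneous _) hf h1
    have h2 : nonicForm 4 ∣ paramHom (f - X 3 * g) := by
      have h3 := hfg
      change _ ∈ curve at h3
      rw [curve_eq] at h3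
      obtain ⟨a, ha, b, hb, hab⟩ := Submodule.mem_sup.1 h3
      obtain ⟨c, rfl⟩ := Ideal.mem_span_singleton'.1 hb
      rw [← hab, map_add, paramHom_eq_zero_of_mem ha, zero_add, map_mul, paramHom_X]
      exact Dvd.intro_left _ rfl
    rw [map_sub, dvd_sub_right h, map_mul, paramHom_X] at h2
    have := add_mem hfg (curve.mul_mem_left (X 3) (ih hg (nonicForm_dvd_of_dvd_mul h2)))
    rwa [sub_add_cancel] at this

lemma nonicForm_ne_zero : nonicForm 4 ≠ 0 := irreducible_nonicForm.ne_zero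

lemma formIdeal_mono {g g' : List (ℕ × ℕ)} (h : g ⊆ g') :
    formIdeal vars5 g ≤ formIdeal vars5 g' :=
  Ideal.span_mono (by rintro _ ⟨x, hx, rfl⟩; exact ⟨x, h hx, rfl⟩)

lemma paramHom_degree_three {f : R₅} (hf : f ∈ H 3) (h : paramHom f = 0) : f = 0 := by
  have := paramHom_low_degree hf le_rfl (by decide) h
  simpa [multiples] using this

lemma eq_zero_of_degree_le_three {d : ℕ} (hd : d ≤ 3) {f : R₅} (hf : f ∈ H d)
    (h : paramHom f = 0) : f = 0 := by
  -- A power of a variable moves the question to degree 3, where it has been checked.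
  have h1 : X 4 ^ (3 - d) * f ∈ H 3 := by
    have := (isHomogeneous_X_pow (R := ZMod 2) (4 : Fin 5) (3 - d)).mul hf
    rwa [Nat.sub_add_cancel hd] at this
  have h2 := paramHom_degree_three h1 (by rw [map_mul, h, mul_zero])
  exact (mul_eq_zero.1 h2).resolve_left (pow_ne_zero _ (X_ne_zero _))

/-- Up to degree 5 this is linear algebra. From degree 6 on, `f` lies in `curve`, so `f` is `X 4 *
g` modulo `surface`; the last nonic is not zero, so `g` is again in the kernel, in one degree less.
-/
lemma mem_surface_of_homogeneous {d : ℕ} {f : R₅} (hf : f ∈ H d) (h : paramHom f = 0) :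
    f ∈ surface := by
  induction d generalizing f with
  | zero => rw [eq_zero_of_degree_le_three (by decide) hf h]; exact zero_mem _
  | succ d ih =>
    by_cases hd : d + 1 ≤ 3
    · rw [eq_zero_of_degree_le_three hd hf h]; exact zero_mem _
    by_cases hd5 : d + 1 ≤ 5
    · have h1 := span_multiples_le _ _ _ (paramHom_low_degree hf (by omega) hd5 h)
      refine formIdeal_mono ?_ h1
      rw [surfaceGens]
      split_ifs
      · exact fun x hx => absurd hx (by simp)
      · exact fun x hx => List.mem_append_left _ (List.mem_of_mem_take hx)
      · exact fun x hx => List.mem_append_left _ hx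
    obtain ⟨k, rfl⟩ : ∃ k, d = k + 5 := ⟨d - 5, by omega⟩
    have h1 : f ∈ curve := mem_curve hf (by rw [h]; exact dvd_zero _)
    rw [curve_eq] at h1
    obtain ⟨g, hg, hfg⟩ := exists_sub_X_mul_mem (formIdeal_homogeneous _) hf h1
    have h2 := paramHom_eq_zero_of_mem hfg
    rw [map_sub, h, zero_sub, neg_eq_zero, map_mul, paramHom_X] at h2
    have := add_mem hfg (surface.mul_mem_left (X 4)
      (ih hg ((mul_eq_zero.1 h2).resolve_left nonicForm_ne_zero)))
    rwa [sub_add_cancel] at this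

/-- `paramHom` multiplies degrees by 9, so the images of different components cannot cancel. -/
lemma paramHom_homogeneousComponent {f : R₅} (h : paramHom f = 0) (d : ℕ) :
    paramHom (homogeneousComponent d f) = 0 := by
  have h1 : homogeneousComponent (9 * d) (paramHom f) = paramHom (homogeneousComponent d f) := by
    conv_lhs => rw [← sum_homogeneousComponent f]
    rw [map_sum, map_sum]
    have h2 : ∀ i, homogeneousComponent (9 * d) (paramHom (homogeneousComponent i f)) =
        if i = d then paramHom (homogeneousComponent d f) else 0 := by
      intro i
      rw [homogeneousComponent_of_mem
        (paramHom_homogeneous (homogeneousComponent_isHomogeneous i f))]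
      by_cases hid : i = d
      · subst hid; simp
      · rw [if_neg (by omega), if_neg hid]
    rw [Finset.sum_congr rfl fun i _ => h2 i, Finset.sum_ite_eq']
    split_ifs with hd
    · rfl
    · rw [homogeneousComponent_eq_zero _ _ (by simpa using hd), map_zero]
  rw [← h1, h, map_zero]

/-- The ideal of the surface is generated by a quartic, five quintics and two sextics. -/
theorem ker_paramHom : RingHom.ker paramHom = surface :=
  le_antisymm
    (fun f hf => mem_of_components fun d => mem_surface_of_homogeneous
      (homogeneousComponent_mem d f) (paramHom_homogeneousComponent hf d))
    fun _ hf => paramHom_eq_zero_of_mem hf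

end Generators

/-! ### Restriction to a line and the length of an intersection. -/

section Lines

open MvPolynomial

variable {K : Type*} [Field K]

/-- The restriction of polynomials to the line through `u` with direction `w`. -/
noncomputable def lineMap (u w : Fin 5 → K) : MvPolynomial (Fin 5) K →ₐ[K] Polynomial K :=
  aeval fun i => Polynomial.C (u i) + Polynomial.C (w i) * Polynomial.X

lemma lineMap_X (u w : Fin 5 → K) (i : Fin 5) :
    lineMap u w (X i) = Polynomial.C (u i) + Polynomial.C (w i) * Polynomial.X := aeval_X _ _

lemma lineMap_mem_degreeLT (u w : Fin 5 → K) {d : ℕ} {f : MvPolynomial (Fin 5) K}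
    (hf : f ∈ homogeneousSubmodule (Fin 5) K d) :
    lineMap u w f ∈ Polynomial.degreeLT K (d + 1) := by
  refine homogeneousSubmodule_le
    (fun d => (Polynomial.degreeLT K (d + 1)).comap (lineMap u w).toLinearMap) ?_ ?_ d hf
  · change lineMap u w 1 ∈ Polynomial.degreeLT K (0 + 1)
    rw [map_one, Polynomial.mem_degreeLT]
    exact Polynomial.degree_one_le.trans_lt (by norm_num)
  · intro i d f hf
    change lineMap u w f ∈ Polynomial.degreeLT K (d + 1) at hf
    change lineMap u w (X i * f) ∈ Polynomial.degreeLT K (d + 1 + 1)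
    rw [Polynomial.mem_degreeLT, Polynomial.degree_lt_iff_coeff_zero] at hf ⊢
    intro m hm
    obtain ⟨n, rfl⟩ : ∃ n, m = n + 1 := ⟨m - 1, by omega⟩
    rw [map_mul, lineMap_X, add_mul, mul_assoc, Polynomial.coeff_add, Polynomial.coeff_C_mul,
      Polynomial.coeff_C_mul, Polynomial.coeff_X_mul, hf _ (by omega), hf _ (by omega)]
    simp

/-- The linear form with the given values. -/
noncomputable def dualForm (φ : (Fin 5 → K) →ₗ[K] K) : MvPolynomial (Fin 5) K :=
  ∑ i, C (φ (Pi.single i 1)) * X i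

lemma dualForm_mem (φ : (Fin 5 → K) →ₗ[K] K) :
    dualForm φ ∈ homogeneousSubmodule (Fin 5) K 1 :=
  sum_mem fun i _ => isHomogeneous_C_mul_X _ i

lemma eval_dualForm (φ : (Fin 5 → K) →ₗ[K] K) (v : Fin 5 → K) : eval v (dualForm φ) = φ v := by
  conv_rhs => rw [← LinearMap.sum_single_apply (fun _ : Fin 5 => K) v]
  rw [dualForm, map_sum, map_sum]
  refine Finset.sum_congr rfl fun i _ => ?_
  rw [map_mul, eval_C, eval_X]
  have : (Pi.single i (v i) : Fin 5 → K) = v i • Pi.single i (1 : K) := by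
    ext j
    by_cases h : j = i
    · subst h; simp
    · simp [h]
  change _ = φ (Pi.single i (v i))
  rw [this, map_smul, smul_eq_mul, mul_comm]

/-- Linear forms on a line. -/
lemma lineMap_of_mem_one (u w : Fin 5 → K) {f : MvPolynomial (Fin 5) K}
    (hf : f ∈ homogeneousSubmodule (Fin 5) K 1) :
    lineMap u w f = Polynomial.C (eval u f) + Polynomial.C (eval w f) * Polynomial.X := by
  rw [homogeneousSubmodule_one_eq_span_X] at hf
  induction hf using Submodule.span_induction with
  | mem f hf => obtain ⟨i, rfl⟩ := hf; simp [lineMap_X]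
  | zero => simp
  | add f g _ _ hf hg => rw [map_add, hf, hg]; simp only [map_add]; ring
  | smul c f _ hf => rw [map_smul, hf, smul_eq_C_mul]; simp [Polynomial.smul_eq_C_mul]; ring

lemma eval_add_smul {f : MvPolynomial (Fin 5) K} (hf : f ∈ homogeneousSubmodule (Fin 5) K 1)
    (a b : K) (u w : Fin 5 → K) : eval (a • u + b • w) f = a * eval u f + b * eval w f := by
  rw [homogeneousSubmodule_one_eq_span_X] at hf
  induction hf using Submodule.span_induction with
  | mem f hf => obtain ⟨i, rfl⟩ := hf; simp
  | zero => simp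
  | add f g _ _ hf hg => simp only [map_add, hf, hg]; ring
  | smul c f _ hf => simp only [smul_eq_C_mul, map_mul, eval_C, hf]; ring

lemma lineMap_eq_zero_of_mem_linearIdeal {u w : Fin 5 → K} {L : Submodule K (Fin 5 → K)}
    (hu : u ∈ L) (hw : w ∈ L) {f : MvPolynomial (Fin 5) K} (hf : f ∈ linearIdeal L) :
    lineMap u w f = 0 := by
  suffices h : linearIdeal L ≤ RingHom.ker (lineMap u w) from h hf
  refine Ideal.span_le.2 ?_
  rintro f ⟨h1, h2⟩
  rw [SetLike.mem_coe, RingHom.mem_ker, lineMap_of_mem_one u w h1, h2 u hu, h2 w hw]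
  simp

lemma eval_eq_zero_of_mem_linearIdeal {L : Submodule K (Fin 5 → K)} {v : Fin 5 → K} (hv : v ∈ L)
    {f : MvPolynomial (Fin 5) K} (hf : f ∈ linearIdeal L) : eval v f = 0 := by
  suffices h : linearIdeal L ≤ RingHom.ker (eval v) from h hf
  refine Ideal.span_le.2 ?_
  rintro f ⟨_, h2⟩
  exact h2 v hv

lemma linearIdeal_homogeneous (L : Submodule K (Fin 5 → K)) :
    HomogeneousIdeal (linearIdeal L) :=
  homogeneousIdeal_span fun _ hf => ⟨1, hf.1⟩

/-- The form of degree `d` with a given restriction to a line. -/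
noncomputable def homogenize (α β : MvPolynomial (Fin 5) K) (d : ℕ) :
    Polynomial K →ₗ[K] MvPolynomial (Fin 5) K :=
  ∑ j ∈ Finset.range (d + 1), (Polynomial.lcoeff K j).smulRight (α ^ (d - j) * β ^ j)

lemma homogenize_apply (α β : MvPolynomial (Fin 5) K) (d : ℕ) (p : Polynomial K) :
    homogenize α β d p =
      ∑ j ∈ Finset.range (d + 1), p.coeff j • (α ^ (d - j) * β ^ j) := by
  simp [homogenize]

lemma homogenize_succ {α β : MvPolynomial (Fin 5) K} {d : ℕ} {p : Polynomial K}
    (hp : p ∈ Polynomial.degreeLT K (d + 1)) :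
    homogenize α β (d + 1) p = α * homogenize α β d p := by
  rw [homogenize_apply, homogenize_apply, Finset.sum_range_succ, Finset.mul_sum]
  rw [Polynomial.mem_degreeLT, Polynomial.degree_lt_iff_coeff_zero] at hp
  rw [hp _ le_rfl, zero_smul, add_zero]
  refine Finset.sum_congr rfl fun j hj => ?_
  rw [Finset.mem_range] at hj
  rw [show d + 1 - j = (d - j) + 1 by omega, mul_smul_comm, pow_succ]
  congr 1
  ring

lemma homogenize_X_mul {α β : MvPolynomial (Fin 5) K} {d : ℕ} {p : Polynomial K} :
    homogenize α β (d + 1) (Polynomial.X * p) = β * homogenize α β d p := by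
  rw [homogenize_apply, homogenize_apply, Finset.sum_range_succ', Finset.mul_sum]
  rw [Polynomial.coeff_X_mul_zero, zero_smul, add_zero]
  refine Finset.sum_congr rfl fun j hj => ?_
  rw [Polynomial.coeff_X_mul, Nat.add_sub_add_right, mul_smul_comm, pow_succ]
  congr 1
  ring

lemma homogenize_mem {α β : MvPolynomial (Fin 5) K} (hα : α.IsHomogeneous 1)
    (hβ : β.IsHomogeneous 1) (d : ℕ) (p : Polynomial K) :
    homogenize α β d p ∈ homogeneousSubmodule (Fin 5) K d := by
  rw [homogenize_apply]
  refine sum_mem fun j hj => Submodule.smul_mem _ _ ?_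
  rw [Finset.mem_range] at hj
  have := (hα.pow (d - j)).mul (hβ.pow j)
  rwa [one_mul, one_mul, Nat.sub_add_cancel (by omega)] at this

/-- A line with a parametrization. -/
structure ParamLine (L : Submodule K (Fin 5 → K)) where
  u : Fin 5 → K
  w : Fin 5 → K
  hu : u ∈ L
  hw : w ∈ L
  span : ∀ v ∈ L, ∃ a b : K, v = a • u + b • w
  α : MvPolynomial (Fin 5) K
  β : MvPolynomial (Fin 5) K
  hα : α.IsHomogeneous 1
  hβ : β.IsHomogeneous 1
  map_α : lineMap u w α = 1
  map_β : lineMap u w β = Polynomial.X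

/-- The forms `α` and `β` come from functionals on `K⁵` that extend the coordinates of a basis of
`L`. -/
lemma nonempty_paramLine {L : Submodule K (Fin 5 → K)} (hL : Module.finrank K L = 2) :
    Nonempty (ParamLine L) := by
  have : FiniteDimensional K L := inferInstance
  let b : Module.Basis (Fin 2) K L := Module.finBasisOfFinrankEq K L hL
  obtain ⟨φ, hφ⟩ := LinearMap.exists_extend (b.coord 0)
  obtain ⟨ψ, hψ⟩ := LinearMap.exists_extend (b.coord 1)
  have h1 : ∀ i, φ (b i) = b.coord 0 (b i) := fun i => by rw [← hφ]; rfl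
  have h2 : ∀ i, ψ (b i) = b.coord 1 (b i) := fun i => by rw [← hψ]; rfl
  refine ⟨⟨b 0, b 1, (b 0).2, (b 1).2, ?_, dualForm φ, dualForm ψ, dualForm_mem φ,
    dualForm_mem ψ, ?_, ?_⟩⟩
  · intro v hv
    have := b.sum_repr ⟨v, hv⟩
    rw [Fin.sum_univ_two] at this
    exact ⟨_, _, (congrArg Subtype.val this).symm⟩
  · rw [lineMap_of_mem_one _ _ (dualForm_mem φ), eval_dualForm, eval_dualForm, h1, h1]
    simp
  · rw [lineMap_of_mem_one _ _ (dualForm_mem ψ), eval_dualForm, eval_dualForm, h2, h2]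
    simp

namespace ParamLine

variable {L : Submodule K (Fin 5 → K)} (P : ParamLine L)

/-- The restriction to the line. -/
noncomputable def res : MvPolynomial (Fin 5) K →ₐ[K] Polynomial K := lineMap P.u P.w

lemma mem_linearIdeal_of_one {f : MvPolynomial (Fin 5) K}
    (hf : f ∈ homogeneousSubmodule (Fin 5) K 1) (h : P.res f = 0) : f ∈ linearIdeal L := by
  rw [res, lineMap_of_mem_one _ _ hf] at h
  have h0 := congrArg (fun p => p.coeff 0) h
  have h1 := congrArg (fun p => p.coeff 1) h
  simp at h0 h1
  refine Ideal.subset_span ⟨hf, fun v hv => ?_⟩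
  obtain ⟨a, b, rfl⟩ := P.span v hv
  rw [eval_add_smul hf, h0, h1]
  simp

lemma res_homogenize {d : ℕ} {p : Polynomial K} (hp : p ∈ Polynomial.degreeLT K (d + 1)) :
    P.res (homogenize P.α P.β d p) = p := by
  rw [homogenize_apply, map_sum]
  rw [Polynomial.mem_degreeLT] at hp
  conv_rhs => rw [Polynomial.as_sum_range' p (d + 1) (by
    rcases eq_or_ne p 0 with rfl | h0
    · simp
    · exact (Polynomial.natDegree_lt_iff_degree_lt h0).2 hp)]
  refine Finset.sum_congr rfl fun j _ => ?_
  rw [map_smul, map_mul, map_pow, map_pow, res, P.map_α, P.map_β, one_pow, one_mul,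
    Polynomial.smul_X_eq_monomial]

/-- Modulo the ideal of the line, `X i` is `u i * α + w i * β`, so by induction on the degree a form
is congruent to the homogenization of its restriction. Restrictions are polynomials and not
functions, which makes this valid over finite fields. -/
lemma sub_homogenize_mem {d : ℕ} {f : MvPolynomial (Fin 5) K}
    (hf : f ∈ homogeneousSubmodule (Fin 5) K d) :
    f - homogenize P.α P.β d (P.res f) ∈ linearIdeal L := by
  let T : ℕ → MvPolynomial (Fin 5) K →ₗ[K] MvPolynomial (Fin 5) K := fun d =>
    LinearMap.id - (homogenize P.α P.β d).comp P.res.toLinearMap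
  -- Homogeneity is carried through the induction, because `homogenize_succ` needs the degree bound
  -- on the restriction.
  have key : homogeneousSubmodule (Fin 5) K d ≤ homogeneousSubmodule (Fin 5) K d ⊓
      ((linearIdeal L).restrictScalars K).comap (T d) := by
    refine homogeneousSubmodule_le (fun d => homogeneousSubmodule (Fin 5) K d ⊓
      ((linearIdeal L).restrictScalars K).comap (T d)) ?_ ?_ d
    · refine ⟨isHomogeneous_one _ _, ?_⟩
      change 1 - homogenize P.α P.β 0 (P.res 1) ∈ linearIdeal L
      rw [map_one, homogenize_apply]
      simp
    · rintro i d f ⟨hfd, hf⟩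
      change f - homogenize P.α P.β d (P.res f) ∈ linearIdeal L at hf
      refine ⟨?_, ?_⟩
      · have := (isHomogeneous_X K i).mul hfd
        rwa [add_comm] at this
      change X i * f - homogenize P.α P.β (d + 1) (P.res (X i * f)) ∈ linearIdeal L
      have hp : P.res f ∈ Polynomial.degreeLT K (d + 1) := lineMap_mem_degreeLT _ _ hfd
      have h1 : P.res (X i * f) = P.u i • P.res f + P.w i • (Polynomial.X * P.res f) := by
        rw [map_mul, res, lineMap_X, Polynomial.smul_eq_C_mul, Polynomial.smul_eq_C_mul]; ring
      rw [h1, map_add, map_smul, map_smul, homogenize_succ hp, homogenize_X_mul]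
      have h2 : X i - (P.u i • P.α + P.w i • P.β) ∈ linearIdeal L := by
        refine P.mem_linearIdeal_of_one (sub_mem (isHomogeneous_X K i)
          (add_mem (Submodule.smul_mem _ _ P.hα) (Submodule.smul_mem _ _ P.hβ))) ?_
        rw [map_sub, map_add, map_smul, map_smul, res, P.map_α, P.map_β, lineMap_X,
          Polynomial.smul_eq_C_mul, Polynomial.smul_eq_C_mul, mul_one, sub_self]
      have h3 : X i * f - (P.u i • (P.α * homogenize P.α P.β d (P.res f)) +
          P.w i • (P.β * homogenize P.α P.β d (P.res f))) =
          f * (X i - (P.u i • P.α + P.w i • P.β)) +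
          (P.u i • P.α + P.w i • P.β) * (f - homogenize P.α P.β d (P.res f)) := by
        simp only [smul_eq_C_mul]; ring
      rw [h3]
      exact add_mem (Ideal.mul_mem_left _ _ h2) (Ideal.mul_mem_left _ _ hf)
  exact (key hf).2

lemma mem_linearIdeal {d : ℕ} {f : MvPolynomial (Fin 5) K}
    (hf : f ∈ homogeneousSubmodule (Fin 5) K d) (h : P.res f = 0) : f ∈ linearIdeal L := by
  have := P.sub_homogenize_mem hf
  rwa [h, map_zero, sub_zero] at this

lemma res_eq_zero {f : MvPolynomial (Fin 5) K} (hf : f ∈ linearIdeal L) : P.res f = 0 :=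
  lineMap_eq_zero_of_mem_linearIdeal P.hu P.hw hf

/-- The restriction to the line of forms of degree `d`. -/
noncomputable def resDeg (d : ℕ) :
    homogeneousSubmodule (Fin 5) K d →ₗ[K] Polynomial.degreeLT K (d + 1) :=
  P.res.toLinearMap.restrict fun _ hf => lineMap_mem_degreeLT _ _ hf

lemma finrank_degreeLT (n : ℕ) : Module.finrank K (Polynomial.degreeLT K n) = n := by
  rw [(Polynomial.degreeLTEquiv K n).finrank_eq, Module.finrank_fin_fun]

lemma finite_degreeLT (n : ℕ) : Module.Finite K (Polynomial.degreeLT K n) :=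
  Module.Finite.equiv (Polynomial.degreeLTEquiv K n).symm

/-- Restriction maps the forms of degree `d` onto the polynomials of degree at most `d`, a space of
dimension `d + 1`. The Hilbert function is thus a codimension in that space. -/
lemma finrank_quotient {d : ℕ} {W : Submodule K (Polynomial K)}
    (hW : W ≤ Polynomial.degreeLT K (d + 1)) :
    Module.finrank K (homogeneousSubmodule (Fin 5) K d ⧸
      (W.comap P.res.toLinearMap).comap (homogeneousSubmodule (Fin 5) K d).subtype) +
      Module.finrank K W = d + 1 := by
  have := finite_degreeLT (K := K) (d + 1)
  set W' := W.comap (Polynomial.degreeLT K (d + 1)).subtype with hW'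
  have hsurj : Function.Surjective (W'.mkQ.comp (P.resDeg d)) := by
    refine W'.mkQ_surjective.comp fun p => ?_
    refine ⟨⟨homogenize P.α P.β d p, homogenize_mem P.hα P.hβ d p⟩, ?_⟩
    exact Subtype.ext (P.res_homogenize p.2)
  have hker : LinearMap.ker (W'.mkQ.comp (P.resDeg d)) =
      (W.comap P.res.toLinearMap).comap (homogeneousSubmodule (Fin 5) K d).subtype := by
    rw [LinearMap.ker_comp, Submodule.ker_mkQ]
    rfl
  rw [← hker, ((W'.mkQ.comp (P.resDeg d)).quotKerEquivOfSurjective hsurj).finrank_eq,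
    ← (Submodule.comapSubtypeEquivOfLe hW).finrank_eq, ← hW',
    Submodule.finrank_quotient_add_finrank, finrank_degreeLT]

lemma finite_quotient (d : ℕ) (N : Submodule K (homogeneousSubmodule (Fin 5) K d)) :
    Module.Finite K (homogeneousSubmodule (Fin 5) K d ⧸ N) := by
  have : Module.Finite K (homogeneousSubmodule (Fin 5) K d) :=
    Module.Finite.iff_fg.2 (homogeneousSubmodule_fg _ _ d)
  infer_instance

/-- The multiples of `h` by polynomials of small degree. -/
noncomputable def mulSpace (h : Polynomial K) (n : ℕ) : Submodule K (Polynomial K) :=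
  (Polynomial.degreeLT K n).map (LinearMap.mulLeft K h)

lemma finrank_mulSpace {h : Polynomial K} (h0 : h ≠ 0) (n : ℕ) :
    Module.finrank K (mulSpace h n) = n := by
  rw [mulSpace, ← (Submodule.equivMapOfInjective (LinearMap.mulLeft K h)
    (fun a b hab => mul_left_cancel₀ h0 hab) (Polynomial.degreeLT K n)).finrank_eq,
    finrank_degreeLT]

lemma mulSpace_le {h : Polynomial K} {e d : ℕ} (he : h ∈ Polynomial.degreeLT K (e + 1))
    (hd : e ≤ d) : mulSpace h (d - e + 1) ≤ Polynomial.degreeLT K (d + 1) := by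
  rintro _ ⟨g, hg, rfl⟩
  rw [SetLike.mem_coe, Polynomial.mem_degreeLT] at hg
  rw [Polynomial.mem_degreeLT] at he ⊢
  change (h * g).degree < _
  rcases eq_or_ne h 0 with rfl | h0
  · simp
  rcases eq_or_ne g 0 with rfl | g0
  · simp
  rw [← Polynomial.natDegree_lt_iff_degree_lt h0] at he
  rw [← Polynomial.natDegree_lt_iff_degree_lt g0] at hg
  rw [← Polynomial.natDegree_lt_iff_degree_lt (mul_ne_zero h0 g0),
    Polynomial.natDegree_mul h0 g0]
  omega

/-- A form in `I` that does not vanish on the line bounds the length of the intersection. -/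
lemma hilbertFn_le {I : Ideal (MvPolynomial (Fin 5) K)} {e d : ℕ} (hd : e ≤ d)
    {f : MvPolynomial (Fin 5) K} (hf : f ∈ homogeneousSubmodule (Fin 5) K e) (hfI : f ∈ I)
    (h0 : P.res f ≠ 0) : hilbertFn (I ⊔ linearIdeal L) d ≤ e := by
  have hle := mulSpace_le (lineMap_mem_degreeLT P.u P.w hf) hd
  have h1 := P.finrank_quotient hle
  -- The multiples of the restriction of `f` have codimension `(d + 1) - (d - e + 1) = e`.
  have h2 := finrank_mulSpace h0 (d - e + 1)
  rw [res] at h2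
  have hsub : ((mulSpace (lineMap P.u P.w f) (d - e + 1)).comap P.res.toLinearMap).comap
      (homogeneousSubmodule (Fin 5) K d).subtype ≤
      ((I ⊔ linearIdeal L).restrictScalars K).comap
        (homogeneousSubmodule (Fin 5) K d).subtype := by
    rintro ⟨g, hg⟩ ⟨p, hp, hpg⟩
    change P.res f * p = P.res g at hpg
    change g ∈ I ⊔ linearIdeal L
    have h3 : g - f * homogenize P.α P.β (d - e) p ∈ linearIdeal L := by
      refine P.mem_linearIdeal (d := d) (sub_mem hg ?_) ?_
      · have := IsHomogeneous.mul hf (homogenize_mem P.hα P.hβ (d - e) p)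
        rwa [Nat.add_sub_cancel' hd] at this
      · rw [map_sub, map_mul, P.res_homogenize hp, hpg, sub_self]
    have := add_mem (Submodule.mem_sup_right (S := I) h3)
      (Submodule.mem_sup_left (T := linearIdeal L)
        (I.mul_mem_right (homogenize P.α P.β (d - e) p) hfI))
    rwa [sub_add_cancel] at this
  have := finite_quotient d (((mulSpace (lineMap P.u P.w f) (d - e + 1)).comap
    P.res.toLinearMap).comap (homogeneousSubmodule (Fin 5) K d).subtype)
  have h3 : hilbertFn (I ⊔ linearIdeal L) d ≤ Module.finrank K
      (homogeneousSubmodule (Fin 5) K d ⧸ ((mulSpace (lineMap P.u P.w f) (d - e + 1)).comap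
        P.res.toLinearMap).comap (homogeneousSubmodule (Fin 5) K d).subtype) :=
    LinearMap.finrank_le_finrank_of_surjective (Submodule.factor_surjective hsub)
  omega

lemma hilbertFn_eq {I : Ideal (MvPolynomial (Fin 5) K)} {d : ℕ} {W : Submodule K (Polynomial K)}
    (hW : W ≤ Polynomial.degreeLT K (d + 1))
    (h : ∀ g ∈ homogeneousSubmodule (Fin 5) K d, g ∈ I ⊔ linearIdeal L ↔ P.res g ∈ W) :
    hilbertFn (I ⊔ linearIdeal L) d + Module.finrank K W = d + 1 := by
  have hN : ((I ⊔ linearIdeal L).restrictScalars K).comap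
      (homogeneousSubmodule (Fin 5) K d).subtype =
      (W.comap P.res.toLinearMap).comap (homogeneousSubmodule (Fin 5) K d).subtype :=
    Submodule.ext fun g => h g.1 g.2
  rw [← P.finrank_quotient hW, hilbertFn, hN]

/-- A line contained in a subscheme does not meet it in a finite scheme. -/
lemma not_hasLength {I : Ideal (MvPolynomial (Fin 5) K)} (h : ∀ f ∈ I, P.res f = 0) (n : ℕ) :
    ¬ HasLength (I ⊔ linearIdeal L) n := by
  intro hn
  obtain ⟨N, hN⟩ := Filter.eventually_atTop.1 hn
  have key : ∀ d, hilbertFn (I ⊔ linearIdeal L) d = d + 1 := by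
    intro d
    have := P.hilbertFn_eq (I := I) (d := d) (W := ⊥) bot_le fun g hg => by
      rw [Submodule.mem_bot]
      constructor
      · intro hgI
        obtain ⟨a, ha, b, hb, rfl⟩ := Submodule.mem_sup.1 hgI
        rw [map_add, h a ha, P.res_eq_zero hb, add_zero]
      · exact fun h0 => Submodule.mem_sup_right (P.mem_linearIdeal hg h0)
    rwa [finrank_bot, add_zero] at this
  have h1 := hN N le_rfl
  have h2 := hN (N + 1) (by omega)
  rw [key] at h1 h2
  omega

/-- A line on which a homogeneous ideal restricts to the multiples of a form of degree `e`. -/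
lemma hasLength {I : Ideal (MvPolynomial (Fin 5) K)} {e : ℕ} {f : MvPolynomial (Fin 5) K}
    (hI : HomogeneousIdeal I) (hf : f ∈ homogeneousSubmodule (Fin 5) K e) (hfI : f ∈ I)
    (h0 : P.res f ≠ 0)
    (h : ∀ d, e ≤ d → ∀ g ∈ homogeneousSubmodule (Fin 5) K d, g ∈ I →
      ∃ p ∈ homogeneousSubmodule (Fin 5) K (d - e), P.res g = P.res f * P.res p) :
    HasLength (I ⊔ linearIdeal L) e := by
  refine Filter.eventually_atTop.2 ⟨e, fun d hd => ?_⟩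
  have h1 := P.hilbertFn_eq (I := I) (mulSpace_le (lineMap_mem_degreeLT P.u P.w hf) hd)
    fun g hg => by
    constructor
    · intro hgI
      obtain ⟨a, ha, b, hb, rfl⟩ := Submodule.mem_sup.1 hgI
      -- The summand `a` need not be homogeneous; only its component of degree `d` matters.
      have h2 := homogeneousComponent_of_mem (m := d) (n := d) hg
      rw [if_pos rfl, map_add] at h2
      rw [← h2, map_add, P.res_eq_zero (linearIdeal_homogeneous L b hb d), add_zero]
      obtain ⟨p, hp, hpa⟩ := h d hd _ (homogeneousComponent_mem d a) (hI a ha d)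
      rw [hpa]
      exact ⟨P.res p, lineMap_mem_degreeLT _ _ hp, rfl⟩
    · rintro ⟨p, hp, hpg⟩
      change P.res f * p = P.res g at hpg
      have h3 : g - f * homogenize P.α P.β (d - e) p ∈ linearIdeal L := by
        refine P.mem_linearIdeal (d := d) (sub_mem hg ?_) ?_
        · have := IsHomogeneous.mul hf (homogenize_mem P.hα P.hβ (d - e) p)
          rwa [Nat.add_sub_cancel' hd] at this
        · rw [map_sub, map_mul, P.res_homogenize hp, hpg, sub_self]
      have := add_mem (Submodule.mem_sup_right (S := I) h3)
        (Submodule.mem_sup_left (T := linearIdeal L)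
          (I.mul_mem_right (homogenize P.α P.β (d - e) p) hfI))
      rwa [sub_add_cancel] at this
  rw [finrank_mulSpace (h := lineMap P.u P.w f) h0] at h1
  omega

end ParamLine

end Lines

/-! ### The two lines and the secants over an arbitrary field. -/

section OverField

open MvPolynomial

variable (K : Type*) [Field K] [Algebra (ZMod 2) K]

/-- Extension of scalars. -/
noncomputable def scalars : MvPolynomial (Fin 5) (ZMod 2) →+* MvPolynomial (Fin 5) K :=
  MvPolynomial.map (algebraMap (ZMod 2) K)

lemma two_eq_zero : (2 : K) = 0 := by
  have h : algebraMap (ZMod 2) K 2 = algebraMap (ZMod 2) K 0 := congrArg _ (by decide)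
  rwa [map_ofNat, map_zero] at h

/-- The generators of the ideal of the surface over `K`. -/
noncomputable def genOver (g : ℕ × ℕ) : MvPolynomial (Fin 5) K := scalars K (form vars5 g.1 g.2)

lemma genOver_mem (g : ℕ × ℕ) : genOver K g ∈ homogeneousSubmodule (Fin 5) K g.1 :=
  (form_mem vars5 g.1 g.2 : IsHomogeneous _ _).map _

/-- The ideal generated by some of the generators over `K`. -/
noncomputable def idealOver (gens : List (ℕ × ℕ)) : Ideal (MvPolynomial (Fin 5) K) :=
  (formIdeal vars5 gens).map (scalars K)

lemma idealOver_eq (gens : List (ℕ × ℕ)) :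
    idealOver K gens = Ideal.span {f | ∃ g ∈ gens, f = genOver K g} := by
  rw [idealOver, formIdeal, Ideal.map_span]
  congr 1
  ext f
  simp only [Set.mem_image, Set.mem_ofPred_eq]
  constructor
  · rintro ⟨_, ⟨g, hg, rfl⟩, rfl⟩; exact ⟨g, hg, rfl⟩
  · rintro ⟨g, hg, rfl⟩; exact ⟨_, ⟨g, hg, rfl⟩, rfl⟩

lemma genOver_mem_idealOver {gens : List (ℕ × ℕ)} {g : ℕ × ℕ} (hg : g ∈ gens) :
    genOver K g ∈ idealOver K gens := by
  rw [idealOver_eq]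
  exact Ideal.subset_span ⟨g, hg, rfl⟩

lemma idealOver_homogeneous (gens : List (ℕ × ℕ)) : HomogeneousIdeal (idealOver K gens) := by
  rw [idealOver_eq]
  exact homogeneousIdeal_span (by rintro _ ⟨g, _, rfl⟩; exact ⟨g.1, genOver_mem K g⟩)

/-- The sextic that does not vanish on the `c`-th line. -/
def sexticGen (c : Fin 2) : ℕ × ℕ := sexticGens.getD c (0, 0)

/-- The ideal of the surface over `K`. -/
noncomputable def surfaceOver : Ideal (MvPolynomial (Fin 5) K) := idealOver K surfaceGens

lemma mem_sexticGens {g : ℕ × ℕ} (hg : g ∈ sexticGens) : g = sexticGen 0 ∨ g = sexticGen 1 := by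
  rw [show sexticGens = [sexticGen 0, sexticGen 1] from rfl] at hg
  rcases List.mem_cons.1 hg with h | h
  · exact Or.inl h
  · exact Or.inr (List.mem_singleton.1 h)

lemma surfaceOver_le : surfaceOver K ≤ idealOver K lowGens ⊔
    (Ideal.span {genOver K (sexticGen 0)} ⊔ Ideal.span {genOver K (sexticGen 1)}) := by
  rw [surfaceOver, idealOver_eq]
  refine Ideal.span_le.2 ?_
  rintro _ ⟨g, hg, rfl⟩
  rw [surfaceGens] at hg
  rcases List.mem_append.1 hg with hg | hg
  · exact Submodule.mem_sup_left (genOver_mem_idealOver K hg)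
  · refine Submodule.mem_sup_right ?_
    rcases mem_sexticGens hg with h | h
    · rw [h]
      exact Submodule.mem_sup_left (Ideal.mem_span_singleton_self _)
    · rw [h]
      exact Submodule.mem_sup_right (Ideal.mem_span_singleton_self _)

lemma exists_of_mem_sup_span {R : Type*} [CommRing R] {I : Ideal R} {s t f : R}
    (h : f ∈ I ⊔ (Ideal.span {s} ⊔ Ideal.span {t})) :
    ∃ a ∈ I, ∃ b c, f = a + b * s + c * t := by
  obtain ⟨a, ha, y, hy, e1⟩ := Submodule.mem_sup.1 h
  obtain ⟨p, hp, q, hq, e2⟩ := Submodule.mem_sup.1 hy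
  obtain ⟨b, e3⟩ := Ideal.mem_span_singleton'.1 hp
  obtain ⟨c, e4⟩ := Ideal.mem_span_singleton'.1 hq
  exact ⟨a, ha, b, c, by rw [e3, e4, add_assoc, e2, e1]⟩

lemma exists_of_mem_surfaceOver {f : MvPolynomial (Fin 5) K} (hf : f ∈ surfaceOver K) :
    ∃ a ∈ idealOver K lowGens, ∃ b c, f = a + b * genOver K (sexticGen 0) +
      c * genOver K (sexticGen 1) :=
  exists_of_mem_sup_span (surfaceOver_le K hf)

lemma sexticGen_fst (c : Fin 2) : (sexticGen c).1 = 6 := by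
  fin_cases c <;> rfl

lemma genOver_sexticGen_mem (c : Fin 2) :
    genOver K (sexticGen c) ∈ homogeneousSubmodule (Fin 5) K 6 := by
  have := genOver_mem K (sexticGen c)
  rwa [sexticGen_fst] at this

/-- Multiples of the sextics have no components of degree below 6. -/
lemma mem_lowGens_of_degree_le_five {f : MvPolynomial (Fin 5) K} (hf : f ∈ surfaceOver K) {d : ℕ}
    (hd : d ≤ 5) (hfd : f.IsHomogeneous d) : f ∈ idealOver K lowGens := by
  obtain ⟨a, ha, b, c, rfl⟩ := exists_of_mem_surfaceOver K hf
  have h := homogeneousComponent_of_mem (m := d) (n := d) hfd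
  rw [if_pos rfl, map_add, map_add,
    homogeneousComponent_mul_right_of_lt (genOver_sexticGen_mem K 0) (by omega),
    homogeneousComponent_mul_right_of_lt (genOver_sexticGen_mem K 1) (by omega), add_zero,
    add_zero] at h
  rw [← h]
  exact idealOver_homogeneous K _ a ha d

lemma exists_of_degree_ge_six {f : MvPolynomial (Fin 5) K} (hf : f ∈ surfaceOver K) {d : ℕ}
    (hd : 6 ≤ d) (hfd : f ∈ homogeneousSubmodule (Fin 5) K d) :
    ∃ a ∈ idealOver K lowGens, ∃ b ∈ homogeneousSubmodule (Fin 5) K (d - 6),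
      ∃ c ∈ homogeneousSubmodule (Fin 5) K (d - 6), f = a + b * genOver K (sexticGen 0) +
      c * genOver K (sexticGen 1) := by
  obtain ⟨a, ha, b, c, rfl⟩ := exists_of_mem_surfaceOver K hf
  have h := homogeneousComponent_of_mem (m := d) (n := d) hfd
  obtain ⟨e, rfl⟩ : ∃ e, d = e + 6 := ⟨d - 6, by omega⟩
  rw [if_pos rfl, map_add, map_add,
    homogeneousComponent_mul_right (genOver_sexticGen_mem K 0),
    homogeneousComponent_mul_right (genOver_sexticGen_mem K 1)] at h
  exact ⟨_, idealOver_homogeneous K _ a ha (e + 6), _, homogeneousComponent_mem _ b, _,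
    homogeneousComponent_mem _ c, h.symm⟩

/-- The supports of linear equations of the two lines. -/
def lineEqns : Fin 2 → List (List (Fin 5)) :=
  ![[[1, 2], [0, 3], [0, 1, 4]], [[0], [1, 2], [3, 4]]]

/-- A point on each of the two lines. -/
def linePoint : Fin 2 → Fin 5 → ZMod 2 := ![![1, 0, 0, 1, 1], ![0, 1, 1, 0, 0]]

/-- A second point on each of the two lines. -/
def lineDir : Fin 2 → Fin 5 → ZMod 2 := ![![0, 1, 1, 0, 1], ![0, 0, 0, 1, 1]]

/-- The coordinates on the two lines. -/
def lineExps : Fin 2 → List (List ℕ) :=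
  ![[[0], [1], [1], [0], [0, 1]], [[], [0], [0], [1], [1]]]

/-- The sum of some variables. -/
noncomputable def linSum (k : Type*) [Field k] (is : List (Fin 5)) : MvPolynomial (Fin 5) k :=
  (is.map X).sum

lemma degree_lowGens : ∀ g ∈ lowGens, g.1 ≤ 5 := by decide

lemma linSum_mem (k : Type*) [Field k] (is : List (Fin 5)) :
    linSum k is ∈ homogeneousSubmodule (Fin 5) k 1 := by
  refine list_sum_mem fun f hf => ?_
  obtain ⟨i, _, rfl⟩ := List.mem_map.1 hf
  exact isHomogeneous_X k i

lemma scalars_linSum (is : List (Fin 5)) : scalars K (linSum (ZMod 2) is) = linSum K is := by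
  rw [linSum, linSum, map_list_sum, List.map_map]
  congr 1
  refine List.map_congr_left fun i _ => ?_
  exact map_X _ i

lemma eval_linSum {k : Type*} [Field k] (is : List (Fin 5)) (v : Fin 5 → k) :
    eval v (linSum k is) = (is.map v).sum := by
  rw [linSum, map_list_sum, List.map_map]
  congr 1
  refine List.map_congr_left fun i _ => ?_
  exact eval_X i

lemma mul_linSum_mem {n : ℕ} {is : List (Fin 5)}
    (hc : spanCheck 1000 (multipleCodes [1, 8, 64, 512, 0] lowGens 7)
      [mulExps (xlin n (codes (shifts [1, 8, 64, 512, 0]) 1 6)) (is.map weights5) 0] = true) :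
    form vars5 6 n * linSum (ZMod 2) is ∈ formIdeal vars5 lowGens := by
  rw [← map_weights5] at hc
  have hdeg : ∀ g ∈ lowGens, g.1 ≤ 7 := fun g hg => (degree_lowGens g hg).trans (by norm_num)
  refine span_multiples_le _ _ 7 (mem_span_multiples (kronInjective5 (by decide)) hdeg hc ?_ ?_)
  · exact (form_mem vars5 6 n : IsHomogeneous _ _).mul (linSum_mem _ is)
  · rw [map_mul, kron_form, mul_comm]
    have h1 : kron weights5 (linSum (ZMod 2) is) = expsPoly (is.map weights5) := by
      simp [linSum, map_list_sum, expsPoly, kron, Function.comp_def]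
    have h2 := toPoly_mulExps (xlin n (codes (shifts (vars5.map weights5)) 1 6))
      (is.map weights5) 0
    rw [toPoly_zero, zero_add] at h2
    rw [h1, ← h2]
    exact toPoly_mem_polySpan (by simp)

/-- This is what singles out the two lines: where `lowGens` vanish, either the sextic vanishes or
all linear equations of its line do. The membership is verified in degree 7 over `𝔽₂` and extended
to `K`. -/
lemma sextic_mul_linSum_mem (c : Fin 2) : ∀ is ∈ lineEqns c,
    genOver K (sexticGen c) * linSum K is ∈ idealOver K lowGens := by
  have hc : ∀ c : Fin 2, ((lineEqns c).all fun is =>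
      spanCheck 1000 (multipleCodes [1, 8, 64, 512, 0] lowGens 7)
        [mulExps (xlin (sexticGen c).2 (codes (shifts [1, 8, 64, 512, 0]) 1 6))
          (is.map weights5) 0]) = true := by decide +kernel
  intro is his
  have h := Ideal.mem_map_of_mem (scalars K)
    (mul_linSum_mem (List.all_eq_true.1 (hc c) is his))
  rw [map_mul, scalars_linSum] at h
  rwa [genOver, sexticGen_fst]

/-- Extension of scalars for vectors. -/
def vecOver (v : Fin 5 → ZMod 2) : Fin 5 → K := fun i => algebraMap (ZMod 2) K (v i)

lemma lineMap_scalars (u w : Fin 5 → ZMod 2) (f : MvPolynomial (Fin 5) (ZMod 2)) :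
    lineMap (vecOver K u) (vecOver K w) (scalars K f) =
      (lineMap u w f).map (algebraMap (ZMod 2) K) := by
  have : ((lineMap (vecOver K u) (vecOver K w)).toRingHom.comp (scalars K)) =
      (Polynomial.mapRingHom (algebraMap (ZMod 2) K)).comp (lineMap u w).toRingHom := by
    refine MvPolynomial.ringHom_ext (fun r => ?_) fun i => ?_
    · simp [scalars, lineMap]
    · simp [scalars, lineMap, vecOver]
  exact RingHom.congr_fun this f

lemma lineMap_form (c : Fin 2) (e n : ℕ) : lineMap (linePoint c) (lineDir c) (form vars5 e n) =
    toPoly (xlin n (codes (mulActs 0 0 (lineExps c)) 1 e)) := by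
  refine apply_form (lineMap (linePoint c) (lineDir c)) (AlgHom.id (ZMod 2) _) (m := 0)
    (by rw [toPoly_zero, map_zero]) 0 ?_ e n
  fin_cases c <;>
    simp [vars5, lineExps, linePoint, lineDir, lineMap, expsPoly]

lemma lineMap_genOver (c : Fin 2) (g : ℕ × ℕ) :
    lineMap (vecOver K (linePoint c)) (vecOver K (lineDir c)) (genOver K g) =
      (toPoly (xlin g.2 (codes (mulActs 0 0 (lineExps c)) 1 g.1))).map
        (algebraMap (ZMod 2) K) := by
  rw [genOver, lineMap_scalars, lineMap_form]

/-- The two `6`-secants. -/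
def secantLine (c : Fin 2) : Submodule K (Fin 5 → K) :=
  Submodule.span K {vecOver K (linePoint c), vecOver K (lineDir c)}

lemma mem_secantLine {c : Fin 2} {v : Fin 5 → K} :
    (∀ is ∈ lineEqns c, (is.map v).sum = 0) ↔ v ∈ secantLine K c := by
  have h2 := two_eq_zero K
  rw [secantLine, Submodule.mem_span_pair]
  constructor
  · intro h
    fin_cases c
    · simp only [lineEqns, Fin.zero_eta, Matrix.cons_val_zero, List.mem_cons, List.not_mem_nil,
        or_false, forall_eq_or_imp, forall_eq, List.map_cons, List.map_nil, List.sum_cons,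
        List.sum_nil, add_zero] at h
      obtain ⟨h3, h4, h5⟩ := h
      -- The coordinates `x₀`, `x₁` are parameters on this line: they are `(1, 0)` and `(0, 1)` at
      -- the two spanning points. On the other line `x₁` and `x₃` play this role. Signs disappear
      -- since `2 = 0`.
      refine ⟨v 0, v 1, funext fun i => ?_⟩
      fin_cases i <;> simp [vecOver, linePoint, lineDir]
      · linear_combination h2 * v 1 - h3
      · linear_combination h2 * v 0 - h4
      · linear_combination h2 * (v 0 + v 1) - h5
    · simp only [lineEqns, Fin.mk_one, Matrix.cons_val_one, Matrix.cons_val_fin_one,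
        List.mem_cons, List.not_mem_nil,
        or_false, forall_eq_or_imp, forall_eq, List.map_cons, List.map_nil, List.sum_cons,
        List.sum_nil, add_zero] at h
      obtain ⟨h3, h4, h5⟩ := h
      refine ⟨v 1, v 3, funext fun i => ?_⟩
      fin_cases i <;> simp [vecOver, linePoint, lineDir]
      · exact h3.symm
      · linear_combination h2 * v 1 - h4
      · linear_combination h2 * v 3 - h5
  · rintro ⟨a, b, rfl⟩ is his
    fin_cases c
    · simp only [lineEqns, Fin.zero_eta, Matrix.cons_val_zero, List.mem_cons, List.not_mem_nil,
        or_false] at his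
      rcases his with rfl | rfl | rfl <;> simp [vecOver, linePoint, lineDir]
      · linear_combination h2 * b
      · linear_combination h2 * a
      · linear_combination h2 * (a + b)
    · simp only [lineEqns, Fin.mk_one, Matrix.cons_val_one, Matrix.cons_val_fin_one,
        List.mem_cons, List.not_mem_nil, or_false] at his
      rcases his with rfl | rfl | rfl <;> simp [vecOver, linePoint, lineDir]
      · linear_combination h2 * a
      · linear_combination h2 * b

lemma finrank_secantLine (c : Fin 2) : Module.finrank K (secantLine K c) = 2 := by
  have hli : LinearIndependent K ![vecOver K (linePoint c), vecOver K (lineDir c)] := by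
    rw [LinearIndependent.pair_iff]
    intro s t h
    fin_cases c
    · have h0 := congrFun h 0
      have h1 := congrFun h 1
      simp [vecOver, linePoint, lineDir] at h0 h1
      exact ⟨h0, h1⟩
    · have h0 := congrFun h 1
      have h1 := congrFun h 3
      simp [vecOver, linePoint, lineDir] at h0 h1
      exact ⟨h0, h1⟩
  have := finrank_span_eq_card hli
  rwa [Matrix.range_cons_cons_empty, Fintype.card_fin] at this

/-- The parametrizations of the two `6`-secants. -/
noncomputable def secantParam (c : Fin 2) : ParamLine (secantLine K c) where
  u := vecOver K (linePoint c)
  w := vecOver K (lineDir c)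
  hu := Submodule.subset_span (by simp)
  hw := Submodule.subset_span (by simp)
  span v hv := by
    obtain ⟨a, b, h⟩ := Submodule.mem_span_pair.1 hv
    exact ⟨a, b, h.symm⟩
  α := X (![0, 1] c)
  β := X (![1, 3] c)
  hα := isHomogeneous_X _ _
  hβ := isHomogeneous_X _ _
  map_α := by
    rw [lineMap_X]
    fin_cases c <;> simp [vecOver, linePoint, lineDir]
  map_β := by
    rw [lineMap_X]
    fin_cases c <;> simp [vecOver, linePoint, lineDir]

lemma res_genOver (c : Fin 2) (g : ℕ × ℕ) : (secantParam K c).res (genOver K g) =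
    (toPoly (xlin g.2 (codes (mulActs 0 0 (lineExps c)) 1 g.1))).map (algebraMap (ZMod 2) K) :=
  lineMap_genOver K c g

lemma res_low (c : Fin 2) {f : MvPolynomial (Fin 5) K} (hf : f ∈ idealOver K lowGens) :
    (secantParam K c).res f = 0 := by
  have hc : ∀ c : Fin 2, (lowGens.all fun g =>
      Nat.beq 0 (xlin g.2 (codes (mulActs 0 0 (lineExps c)) 1 g.1))) = true := by
    decide +kernel
  suffices h : idealOver K lowGens ≤ RingHom.ker (secantParam K c).res from h hf
  rw [idealOver_eq]
  refine Ideal.span_le.2 ?_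
  rintro _ ⟨g, hg, rfl⟩
  rw [SetLike.mem_coe, RingHom.mem_ker, res_genOver,
    ← Nat.eq_of_beq_eq_true (List.all_eq_true.1 (hc c) g hg), toPoly_zero, Polynomial.map_zero]

lemma res_sextic_of_ne {c c' : Fin 2} (h : c ≠ c') :
    (secantParam K c).res (genOver K (sexticGen c')) = 0 := by
  have hc : ∀ c c' : Fin 2, c ≠ c' →
      Nat.beq 0 (xlin (sexticGen c').2 (codes (mulActs 0 0 (lineExps c)) 1 (sexticGen c').1)) =
        true := by decide +kernel
  rw [res_genOver, ← Nat.eq_of_beq_eq_true (hc c c' h), toPoly_zero, Polynomial.map_zero]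

lemma res_sextic_ne_zero (c : Fin 2) : (secantParam K c).res (genOver K (sexticGen c)) ≠ 0 := by
  have hc : ∀ c : Fin 2,
      Nat.blt 0 (xlin (sexticGen c).2 (codes (mulActs 0 0 (lineExps c)) 1 (sexticGen c).1)) =
        true := by decide +kernel
  rw [res_genOver, Ne, Polynomial.map_eq_zero, ← toPoly_zero]
  intro h
  have h1 := Nat.le_of_ble_eq_true (hc c)
  rw [toPoly_injective h] at h1
  omega

lemma secantLine_injective : secantLine K 0 ≠ secantLine K 1 := by
  intro h
  have h1 : vecOver K (linePoint 0) ∈ secantLine K 1 := by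
    rw [← h]; exact (secantParam K 0).hu
  have h2 := (mem_secantLine K).2 h1 [0] (by simp [lineEqns])
  simp [vecOver, linePoint] at h2

lemma hasLength_unique {k : Type*} [Field k] {I : Ideal (MvPolynomial (Fin 5) k)} {m n : ℕ}
    (hm : HasLength I m)
    (hn : HasLength I n) : m = n := by
  obtain ⟨d, h1, h2⟩ := (hm.and hn).exists
  exact h1.symm.trans h2

/-- On this line only one generator survives, so every form of the ideal restricts to a multiple of
a single binary sextic. -/
lemma hasLength_secantLine (c : Fin 2) :
    HasLength (surfaceOver K ⊔ linearIdeal (secantLine K c)) 6 := by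
  have hmem : genOver K (sexticGen c) ∈ surfaceOver K :=
    genOver_mem_idealOver K (by fin_cases c <;> simp [surfaceGens, sexticGens, sexticGen])
  refine (secantParam K c).hasLength (idealOver_homogeneous K _) (genOver_sexticGen_mem K c) hmem
    (res_sextic_ne_zero K c) fun d hd g hg hgI => ?_
  obtain ⟨a, ha, b, hb, b', hb', rfl⟩ := exists_of_degree_ge_six K hgI hd hg
  rw [map_add, map_add, res_low K c ha, zero_add, map_mul, map_mul]
  fin_cases c
  · refine ⟨b, hb, ?_⟩
    rw [res_sextic_of_ne K (c := _) (c' := 1) (by decide), mul_zero, add_zero, mul_comm]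
    rfl
  · refine ⟨b', hb', ?_⟩
    rw [res_sextic_of_ne K (c := _) (c' := 0) (by decide), mul_zero, zero_add, mul_comm]
    rfl

/-- A line that meets the surface in a scheme of length at least `6` is one of the two lines. -/
lemma eq_secantLine {L : Submodule K (Fin 5 → K)} (hL : Module.finrank K L = 2) {n : ℕ}
    (hn : 6 ≤ n) (h : HasLength (surfaceOver K ⊔ linearIdeal L) n) :
    L = secantLine K 0 ∨ L = secantLine K 1 := by
  obtain ⟨P⟩ := nonempty_paramLine hL
  -- A generator of degree at most 5 that did not vanish on `L` would bound the length by 5.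
  have hlow : idealOver K lowGens ≤ RingHom.ker P.res := by
    rw [idealOver_eq]
    refine Ideal.span_le.2 ?_
    rintro _ ⟨g, hg, rfl⟩
    rw [SetLike.mem_coe, RingHom.mem_ker]
    by_contra h0
    have hmem : genOver K g ∈ surfaceOver K :=
      genOver_mem_idealOver K (List.mem_append_left _ hg)
    obtain ⟨d, h1, h2⟩ := (h.and (Filter.eventually_ge_atTop g.1)).exists
    have h3 := P.hilbertFn_le h2 (genOver_mem K g) hmem h0
    have := degree_lowGens g hg
    omega
  have key : ∀ c, P.res (genOver K (sexticGen c)) = 0 ∨ L = secantLine K c := by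
    intro c
    by_cases h0 : P.res (genOver K (sexticGen c)) = 0
    · exact Or.inl h0
    right
    have hlin : ∀ is ∈ lineEqns c, (is.map P.u).sum = 0 ∧ (is.map P.w).sum = 0 := by
      intro is his
      have h1 : P.res (genOver K (sexticGen c) * linSum K is) = 0 :=
        hlow (sextic_mul_linSum_mem K c is his)
      rw [map_mul] at h1
      have h2 := (mul_eq_zero.1 h1).resolve_left h0
      rw [ParamLine.res, lineMap_of_mem_one _ _ (linSum_mem K is)] at h2
      have h3 := congrArg (fun p => p.coeff 0) h2
      have h4 := congrArg (fun p => p.coeff 1) h2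
      simp [eval_linSum] at h3 h4
      exact ⟨h3, h4⟩
    have hu := (mem_secantLine K).1 fun is his => (hlin is his).1
    have hw := (mem_secantLine K).1 fun is his => (hlin is his).2
    refine Submodule.eq_of_le_of_finrank_eq (fun v hv => ?_) (by rw [hL, finrank_secantLine])
    obtain ⟨a, b, rfl⟩ := P.span v hv
    exact add_mem (Submodule.smul_mem _ _ hu) (Submodule.smul_mem _ _ hw)
  rcases key 0 with h0 | h0
  · rcases key 1 with h1 | h1
    -- If both sextics vanish on `L`, the line lies in the surface and the intersection is not
    -- finite.
    · refine absurd h (P.not_hasLength (fun f hf => ?_) n)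
      obtain ⟨a, ha, b, c, rfl⟩ := exists_of_mem_surfaceOver K hf
      rw [map_add, map_add, map_mul, map_mul, h0, h1, mul_zero, mul_zero, add_zero, add_zero]
      exact hlow ha
    · exact Or.inr h1
  · exact Or.inl h0

theorem secants_surfaceOver : secants 6 (surfaceOver K) = {secantLine K 0, secantLine K 1} := by
  ext L
  constructor
  · rintro ⟨h1, h2⟩
    exact eq_secantLine K h1 le_rfl h2
  · rintro (rfl | rfl)
    · exact ⟨finrank_secantLine K 0, hasLength_secantLine K 0⟩
    · exact ⟨finrank_secantLine K 1, hasLength_secantLine K 1⟩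

theorem secants_surfaceOver_eq_empty {n : ℕ} (hn : 6 < n) : secants n (surfaceOver K) = ∅ := by
  refine Set.eq_empty_of_forall_notMem ?_
  rintro L ⟨h1, h2⟩
  rcases eq_secantLine K h1 hn.le h2 with rfl | rfl
  · exact hn.ne (hasLength_unique (hasLength_secantLine K 0) h2)
  · exact hn.ne (hasLength_unique (hasLength_secantLine K 1) h2)

/-- The argument for lines, applied to a point `v`: for each `c`, either the sextic vanishes at `v`
or `v` satisfies the linear equations of the corresponding line. If both sextics vanish, `v` lies on
the surface. -/
theorem cone_quinticPart_surfaceOver : cone (quinticPart (surfaceOver K)) =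
    cone (surfaceOver K) ∪ ⋃ L ∈ secants 6 (surfaceOver K), (L : Set (Fin 5 → K)) := by
  rw [secants_surfaceOver, Set.biUnion_pair]
  have hq : quinticPart (surfaceOver K) ≤ idealOver K lowGens := by
    refine Ideal.span_le.2 ?_
    rintro f ⟨hf, d, hd, hfd⟩
    exact mem_lowGens_of_degree_le_five K hf hd hfd
  have hq' : idealOver K lowGens ≤ quinticPart (surfaceOver K) := by
    rw [idealOver_eq]
    refine Ideal.span_le.2 ?_
    rintro _ ⟨g, hg, rfl⟩
    exact Ideal.subset_span ⟨genOver_mem_idealOver K (List.mem_append_left _ hg), g.1,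
      degree_lowGens g hg, genOver_mem K g⟩
  have hline : ∀ c, ∀ v ∈ secantLine K c, v ∈ cone (quinticPart (surfaceOver K)) := by
    intro c v hv f hf
    suffices h : idealOver K lowGens ≤ RingHom.ker (eval v) from h (hq hf)
    rw [idealOver_eq]
    refine Ideal.span_le.2 ?_
    rintro _ ⟨g, hg, rfl⟩
    exact eval_eq_zero_of_mem_linearIdeal hv ((secantParam K c).mem_linearIdeal (genOver_mem K g)
      (res_low K c (genOver_mem_idealOver K hg)))
  ext v
  constructor
  · intro hv
    have key : ∀ c, eval v (genOver K (sexticGen c)) = 0 ∨ v ∈ secantLine K c := by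
      intro c
      by_cases h0 : eval v (genOver K (sexticGen c)) = 0
      · exact Or.inl h0
      refine Or.inr ((mem_secantLine K).1 fun is his => ?_)
      have h1 := hv _ (hq' (sextic_mul_linSum_mem K c is his))
      rw [map_mul, eval_linSum] at h1
      exact (mul_eq_zero.1 h1).resolve_left h0
    rcases key 0 with h0 | h0
    · rcases key 1 with h1 | h1
      · refine Or.inl fun f hf => ?_
        obtain ⟨a, ha, b, c, rfl⟩ := exists_of_mem_surfaceOver K hf
        rw [map_add, map_add, map_mul, map_mul, h0, h1, mul_zero, mul_zero, add_zero, add_zero]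
        exact hv a (hq' ha)
      · exact Or.inr (Or.inr h1)
    · exact Or.inr (Or.inl h0)
  · rintro (hv | hv | hv)
    · intro f hf
      have : quinticPart (surfaceOver K) ≤ surfaceOver K := Ideal.span_le.2 fun g hg => hg.1
      exact hv f (this hf)
    · exact hline 0 v hv
    · exact hline 1 v hv

end OverField

/-! ### Multiplicities in terms of values and first derivatives. -/

section Multiplicity

open MvPolynomial

variable {A : Type*} [CommRing A]

lemma pointIdeal_le_ker (p : Fin 3 → A) : pointIdeal p ≤ RingHom.ker (eval p) := by
  refine Ideal.span_le.2 ?_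
  rintro _ ⟨ij, rfl⟩
  simp [mul_comm]

variable [Algebra (ZMod 2) A]

/-- Over `𝔽₂`, substituting the squares of the variables squares the polynomial. Hence vanishing at
a point implies vanishing at its conjugates. -/
lemma aeval_frobConj (p : Fin 3 → A) (i : ℕ) (f : MvPolynomial (Fin 3) (ZMod 2)) :
    aeval (frobConj p i) f = aeval p f ^ 2 ^ i := by
  induction i with
  | zero => rw [pow_zero, pow_one, show frobConj p 0 = p from funext fun j => by simp [frobConj]]
  | succ i ih =>
    have h : aeval (frobConj p (i + 1)) f = aeval (frobConj p i) (expand 2 f) := by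
      rw [expand, aeval_bind₁]
      congr 2
      funext j
      simp only [map_pow, aeval_X, frobConj]
      rw [← pow_mul, pow_succ]
    rw [h, expand_zmod, map_pow, ih, ← pow_mul, pow_succ]

lemma mem_multAtLeast {p : Fin 3 → A} {m : ℕ} {f : MvPolynomial (Fin 3) (ZMod 2)} :
    f ∈ multAtLeast p m ↔ map (algebraMap (ZMod 2) A) f ∈ pointIdeal p ^ m := Iff.rfl

lemma eval_map_algebraMap_eq (p : Fin 3 → A) (f : MvPolynomial (Fin 3) (ZMod 2)) :
    eval p (map (algebraMap (ZMod 2) A) f) = aeval p f := by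
  rw [eval_map, aeval_def]

lemma aeval_eq_zero_of_mem {p : Fin 3 → A} {f : MvPolynomial (Fin 3) (ZMod 2)}
    (h : f ∈ multAtLeast p 1) : aeval p f = 0 := by
  rw [mem_multAtLeast, pow_one] at h
  rw [← eval_map_algebraMap_eq]
  exact pointIdeal_le_ker p h

/-- By the Leibniz rule, a product of two polynomials vanishing at `p` has vanishing value and
derivatives at `p`. -/
lemma jet_eq_zero_of_mem {p : Fin 3 → A} {f : MvPolynomial (Fin 3) (ZMod 2)}
    (h : f ∈ multAtLeast p 2) : aeval p f = 0 ∧ ∀ i, aeval p (pderiv i f) = 0 := by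
  rw [mem_multAtLeast, pow_two] at h
  suffices h' : eval p (map (algebraMap (ZMod 2) A) f) = 0 ∧
      ∀ i, eval p (pderiv i (map (algebraMap (ZMod 2) A) f)) = 0 by
    simpa only [pderiv_map, eval_map_algebraMap_eq] using h'
  refine Submodule.mul_induction_on h (fun f hf g hg => ?_) fun f g hf hg => ?_
  · have h1 : eval p f = 0 := pointIdeal_le_ker p hf
    have h2 : eval p g = 0 := pointIdeal_le_ker p hg
    simp [h1, h2, Derivation.leibniz]
  · simp [hf.1, hg.1, hf.2, hg.2]

/-- A form is determined by its value at `p` modulo the ideal of `p`. -/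
lemma sub_value_mem {p : Fin 3 → A} (hp : p 2 = 1) (d : ℕ) :
    ∀ f ∈ homogeneousSubmodule (Fin 3) (ZMod 2) d,
      map (algebraMap (ZMod 2) A) f - C (aeval p f) * X 2 ^ d ∈ pointIdeal p := by
  have hu : ∀ i, X i - C (p i) * X 2 ∈ pointIdeal p := fun i => by
    have : C (p 2) * X i - C (p i) * X 2 ∈ pointIdeal p := Ideal.subset_span ⟨(2, i), rfl⟩
    rwa [hp, map_one, one_mul] at this
  let S (d : ℕ) : Submodule (ZMod 2) (MvPolynomial (Fin 3) (ZMod 2)) :=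
    { carrier := {f | map (algebraMap (ZMod 2) A) f - C (aeval p f) * X 2 ^ d ∈ pointIdeal p}
      add_mem' := fun {f g} hf hg => by
        rw [Set.mem_ofPred_eq]
        convert add_mem (show _ ∈ pointIdeal p from hf) hg using 1
        simp only [map_add]; ring
      zero_mem' := by simp
      smul_mem' := fun c f hf => by
        rw [Set.mem_ofPred_eq]
        convert Ideal.mul_mem_left (pointIdeal p) (C (algebraMap (ZMod 2) A c)) hf using 1
        simp only [smul_eq_C_mul, map_mul, map_C, aeval_C]; ring }
  refine homogeneousSubmodule_le S (by simp [S]) (fun i d f hf => ?_) d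
  change _ ∈ pointIdeal p at hf
  change _ ∈ pointIdeal p
  convert add_mem (Ideal.mul_mem_left (pointIdeal p) (X i) hf)
    (Ideal.mul_mem_left (pointIdeal p) (C (aeval p f) * X 2 ^ d) (hu i)) using 1
  simp only [map_mul, map_X, aeval_X]; ring

lemma mem_multAtLeast_one {p : Fin 3 → A} (hp : p 2 = 1) {d : ℕ}
    {f : MvPolynomial (Fin 3) (ZMod 2)} (hf : f ∈ homogeneousSubmodule (Fin 3) (ZMod 2) d)
    (h : aeval p f = 0) : f ∈ multAtLeast p 1 := by
  have := sub_value_mem hp d f hf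
  rwa [h, map_zero, zero_mul, sub_zero, ← pow_one (pointIdeal p)] at this

/-- A form is determined by its first order Taylor polynomial at `p` modulo the square of the ideal
of `p`. -/
lemma sub_jet_mem {p : Fin 3 → A} (hp : p 2 = 1) (d : ℕ) :
    ∀ f ∈ homogeneousSubmodule (Fin 3) (ZMod 2) (d + 1),
      map (algebraMap (ZMod 2) A) f - (C (aeval p f) * X 2 ^ (d + 1) +
        C (aeval p (pderiv 0 f)) * (X 0 - C (p 0) * X 2) * X 2 ^ d +
        C (aeval p (pderiv 1 f)) * (X 1 - C (p 1) * X 2) * X 2 ^ d) ∈ pointIdeal p ^ 2 := by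
  have hu : ∀ i, X i - C (p i) * X 2 ∈ pointIdeal p := fun i => by
    have : C (p 2) * X i - C (p i) * X 2 ∈ pointIdeal p := Ideal.subset_span ⟨(2, i), rfl⟩
    rwa [hp, map_one, one_mul] at this
  have huu : ∀ i j, (X i - C (p i) * X 2) * (X j - C (p j) * X 2) ∈ pointIdeal p ^ 2 :=
    fun i j => by rw [pow_two]; exact Ideal.mul_mem_mul (hu i) (hu j)
  let S (d : ℕ) : Submodule (ZMod 2) (MvPolynomial (Fin 3) (ZMod 2)) :=
    { carrier := {f | map (algebraMap (ZMod 2) A) f - (C (aeval p f) * X 2 ^ (d + 1) +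
        C (aeval p (pderiv 0 f)) * (X 0 - C (p 0) * X 2) * X 2 ^ d +
        C (aeval p (pderiv 1 f)) * (X 1 - C (p 1) * X 2) * X 2 ^ d) ∈ pointIdeal p ^ 2}
      add_mem' := fun {f g} hf hg => by
        rw [Set.mem_ofPred_eq]
        convert add_mem (show _ ∈ pointIdeal p ^ 2 from hf) hg using 1
        simp only [map_add]; ring
      zero_mem' := by simp
      smul_mem' := fun c f hf => by
        rw [Set.mem_ofPred_eq]
        convert Ideal.mul_mem_left (pointIdeal p ^ 2) (C (algebraMap (ZMod 2) A c)) hf using 1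
        simp only [smul_eq_C_mul, map_mul, map_C, aeval_C, pderiv_C_mul]; ring }
  change homogeneousSubmodule (Fin 3) (ZMod 2) (d + 1) ≤ S d
  -- The linear part of `X i` in the local coordinates `X 0 - p 0 * X 2` and `X 1 - p 1 * X 2`; it
  -- is zero for `i = 2` because `p 2 = 1`.
  have hstep : ∀ i : Fin 3, pderiv 0 (X i : MvPolynomial (Fin 3) (ZMod 2)) =
      C (if i = 0 then 1 else 0) ∧ pderiv 1 (X i : MvPolynomial (Fin 3) (ZMod 2)) =
      C (if i = 1 then 1 else 0) ∧ (X i - C (p i) * X 2 : MvPolynomial (Fin 3) A) =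
      C (algebraMap (ZMod 2) A (if i = 0 then 1 else 0)) * (X 0 - C (p 0) * X 2) +
      C (algebraMap (ZMod 2) A (if i = 1 then 1 else 0)) * (X 1 - C (p 1) * X 2) := by
    intro i
    fin_cases i <;> simp [pderiv_X, hp]
  induction d with
  | zero =>
    refine homogeneousSubmodule_succ_le fun i f hf => ?_
    rw [mem_homogeneousSubmodule, ← totalDegree_zero_iff_isHomogeneous,
      totalDegree_eq_zero_iff_eq_C] at hf
    obtain ⟨h1, h2, h3⟩ := hstep i
    rw [hf]
    change _ ∈ pointIdeal p ^ 2
    convert zero_mem (pointIdeal p ^ 2) using 1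
    simp only [map_mul, map_X, map_C, aeval_X, aeval_C, Derivation.leibniz, h1, h2, pderiv_C,
      smul_eq_mul, mul_zero, zero_add, pow_zero, pow_one, mul_one]
    linear_combination C (algebraMap (ZMod 2) A (coeff 0 f)) * h3
  | succ d ih =>
    refine homogeneousSubmodule_succ_le fun i f hf => ?_
    obtain ⟨h1, h2, h3⟩ := hstep i
    have hf' := ih hf
    change _ ∈ pointIdeal p ^ 2 at hf'
    change _ ∈ pointIdeal p ^ 2
    -- In the Taylor expansion of `X i * f`, the terms beyond first order contain products of two
    -- local coordinates, which lie in the square of the ideal.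
    convert add_mem (Ideal.mul_mem_left (pointIdeal p ^ 2) (X i) hf') (add_mem
      (Ideal.mul_mem_left (pointIdeal p ^ 2) (C (aeval p (pderiv 0 f)) * X 2 ^ d) (huu i 0))
      (Ideal.mul_mem_left (pointIdeal p ^ 2) (C (aeval p (pderiv 1 f)) * X 2 ^ d) (huu i 1)))
      using 1
    simp only [map_mul, map_X, aeval_X, aeval_C, Derivation.leibniz, h1, h2,
      smul_eq_mul, map_add, pow_succ]
    linear_combination C (aeval p f) * X 2 ^ d * X 2 * h3

lemma mem_multAtLeast_two {p : Fin 3 → A} (hp : p 2 = 1) {d : ℕ}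
    {f : MvPolynomial (Fin 3) (ZMod 2)} (hf : f ∈ homogeneousSubmodule (Fin 3) (ZMod 2) (d + 1))
    (h : aeval p f = 0) (h0 : aeval p (pderiv 0 f) = 0) (h1 : aeval p (pderiv 1 f) = 0) :
    f ∈ multAtLeast p 2 := by
  have := sub_jet_mem hp d f hf
  rw [mem_multAtLeast]
  simpa [h, h0, h1] using this

end Multiplicity

/-! ### Powers and first-order jets in residue rings. -/

section Conditions

open MvPolynomial

variable {A : Type*} [CommRing A] [Algebra (ZMod 2) A]

lemma toPoly_eq_expsPoly {D r : ℕ} (hr : r < 2 ^ D) :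
    toPoly r = expsPoly ((List.range D).filter fun i => r.testBit i) := by
  have h : ∀ D, expsPoly ((List.range D).filter fun i => r.testBit i) =
      ∑ i ∈ Finset.range D, if r.testBit i then Polynomial.X ^ i else 0 := by
    intro D
    induction D with
    | zero => simp [expsPoly]
    | succ D ih =>
      rw [Finset.sum_range_succ, ← ih, List.range_succ, List.filter_append, expsPoly, expsPoly,
        List.map_append, List.sum_append]
      congr 1
      by_cases hD : r.testBit D <;> simp [hD]
  ext j
  rw [h, coeff_toPoly, Polynomial.finsetSum_coeff]
  by_cases hj : r.testBit j
  · have hjD : j < D := by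
      by_contra hcon
      rw [Nat.testBit_lt_two_pow (hr.trans_le (Nat.pow_le_pow_right two_pos (not_lt.1 hcon)))] at hj
      simp at hj
    rw [Finset.sum_eq_single j]
    · simp [hj]
    · intro i _ hij
      split_ifs <;> simp [Polynomial.coeff_X_pow, hij.symm]
    · simp [hjD]
  · rw [if_neg hj]
    refine (Finset.sum_eq_zero fun i _ => ?_).symm
    by_cases hij : i = j
    · simp [hij, hj]
    · split_ifs <;> simp [Polynomial.coeff_X_pow, Ne.symm hij]

/-- The square of a polynomial of degree less than `D`, times `X ^ b`, modulo `m`. -/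
def sqCode (m D : ℕ) (r b : ℕ) : ℕ :=
  clmod m D (D + 1) (mulExps 1 (((List.range D).filter fun i => r.testBit i).map
    fun i => 2 * i + b) 0)

/-- The power of `X`, with exponent given by its binary digits, modulo `m` of degree `D`. -/
def powCode (m D : ℕ) (bits : List ℕ) : Option ℕ :=
  bits.foldlM (fun r b => if r < 2 ^ D then some (sqCode m D r b) else none) 1

lemma expsPoly_sq (es : List ℕ) (b : ℕ) :
    expsPoly (es.map fun i => 2 * i + b) = Polynomial.X ^ b * expsPoly es ^ 2 := by
  induction es with
  | nil => simp [expsPoly]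
  | cons e es ih =>
    have hcons : ∀ e es, expsPoly (e :: es) = Polynomial.X ^ e + expsPoly es := fun e es => by
      rw [expsPoly, List.map_cons, List.sum_cons, expsPoly]
    rw [List.map_cons, hcons, ih, hcons]
    have := xor_self_eq_zero_poly (Polynomial.X ^ e * expsPoly es)
    linear_combination (-Polynomial.X ^ b) * this

lemma map_sqCode (π : Polynomial (ZMod 2) →ₐ[ZMod 2] A) {m D r : ℕ} (hm : π (toPoly m) = 0)
    (hr : r < 2 ^ D) (b : ℕ) :
    π (toPoly (sqCode m D r b)) = π Polynomial.X ^ b * π (toPoly r) ^ 2 := by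
  have := apply_clmod_mulExps π hm D (D + 1)
    (((List.range D).filter fun i => r.testBit i).map fun i => 2 * i + b) 1
  rw [sqCode, this, expsPoly_sq, ← toPoly_eq_expsPoly hr, toPoly_one, map_one, mul_one, map_mul,
    map_pow, map_pow]

/-- Repeated squaring, with the leading digit of the exponent first. The guard `r < 2 ^ D` ensures
that squaring sees all digits of `r`. -/
lemma map_powCode (π : Polynomial (ZMod 2) →ₐ[ZMod 2] A) {m D : ℕ} (hm : π (toPoly m) = 0)
    {bits : List ℕ} {r : ℕ} (h : powCode m D bits = some r) :
    π (toPoly r) = π Polynomial.X ^ (bits.foldl (fun n b => 2 * n + b) 0) := by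
  suffices key : ∀ (bits : List ℕ) (s n : ℕ), π (toPoly s) = π Polynomial.X ^ n →
      bits.foldlM (fun r b => if r < 2 ^ D then some (sqCode m D r b) else none) s = some r →
      π (toPoly r) = π Polynomial.X ^ (bits.foldl (fun n b => 2 * n + b) n) from
    key bits 1 0 (by rw [toPoly_one, map_one, pow_zero]) h
  intro bits
  induction bits with
  | nil => rintro s n hs ⟨⟩; exact hs
  | cons b bits ih =>
    intro s n hs h
    rw [List.foldlM_cons] at h
    split_ifs at h with hlt
    · refine ih _ _ ?_ h
      rw [map_sqCode π hm hlt, hs, ← pow_mul, ← pow_add, mul_comm n, add_comm b]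
    · simp at h

lemma forall₂_pack {ms : List (MvPolynomial (Fin 3) (ZMod 2))} {rs rs' : List ℕ}
    {T T' : MvPolynomial (Fin 3) (ZMod 2) →ₗ[ZMod 2] Polynomial (ZMod 2)} (B : ℕ)
    (h : List.Forall₂ (fun m r => T m = toPoly r) ms rs)
    (h' : List.Forall₂ (fun m r => T' m = toPoly r) ms rs') :
    List.Forall₂ (fun m r => ((LinearMap.mulLeft (ZMod 2) (Polynomial.X ^ B)).comp T + T') m =
      toPoly r) ms (shiftZip B rs rs') := by
  induction h generalizing rs' with
  | nil => exact List.Forall₂.nil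
  | cons h1 _ ih =>
    cases h' with
    | cons h2 h' =>
      rw [shiftZip, force_eq]
      refine List.Forall₂.cons ?_ (ih h')
      rw [toPoly_xor, toPoly_shiftLeft, ← h1, ← h2]
      rfl

/-- The value and the two partial derivatives of a product with one of the variables. -/
def jetActs (m D : ℕ) (a b : List ℕ) : List (ℕ × ℕ × ℕ → ℕ × ℕ × ℕ) :=
  [fun r => force (clmod m D D (mulExps r.1 a 0)) fun s =>
      force (r.1 ^^^ clmod m D D (mulExps r.2.1 a 0)) fun s' =>
      force (clmod m D D (mulExps r.2.2 a 0)) fun s'' => (s, s', s''),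
    fun r => force (clmod m D D (mulExps r.1 b 0)) fun s =>
      force (clmod m D D (mulExps r.2.1 b 0)) fun s' =>
      force (r.1 ^^^ clmod m D D (mulExps r.2.2 b 0)) fun s'' => (s, s', s''),
    id]

/-- The product rule on triples of a value and two derivatives: multiplication by `x` or `y` also
adds the value to the corresponding derivative, and `z` acts as the identity because `p 2 = 1`. -/
lemma forall₂_jetActs (π : Polynomial (ZMod 2) →ₐ[ZMod 2] A) {m D : ℕ} (hm : π (toPoly m) = 0)
    {p : Fin 3 → A} {a b : List ℕ} (ha : p 0 = π (expsPoly a)) (hb : p 1 = π (expsPoly b))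
    (h1 : p 2 = 1) (d : ℕ) :
    List.Forall₂ (fun f r => aeval p f = π (toPoly r.1) ∧
      aeval p (pderiv 0 f) = π (toPoly r.2.1) ∧ aeval p (pderiv 1 f) = π (toPoly r.2.2))
      (monos (varActs (ZMod 2) vars3) 1 d) (monos (jetActs m D a b) (1, 0, 0) d) := by
  refine forall₂_monos ?_ (by simp [toPoly_one, toPoly_zero]) d
  refine List.Forall₂.cons ?_ (List.Forall₂.cons ?_ (List.Forall₂.cons ?_ List.Forall₂.nil))
  · rintro f ⟨r, r', r''⟩ ⟨h, h', h''⟩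
    simp only [force_eq, toPoly_xor, map_add, apply_clmod_mulExps π hm] at h h' h'' ⊢
    simp [pderiv_X, h, h', h'', ha, add_comm]
  · rintro f ⟨r, r', r''⟩ ⟨h, h', h''⟩
    simp only [force_eq, toPoly_xor, map_add, apply_clmod_mulExps π hm] at h h' h'' ⊢
    simp [pderiv_X, h, h', h'', hb, add_comm]
  · rintro f ⟨r, r', r''⟩ ⟨h, h', h''⟩
    simp only [id] at h h' h'' ⊢
    simp [pderiv_X, h, h', h'', h1]

/-- Passing to representatives of smallest degree in `𝔽₂[X] / (g)`. -/
lemma exists_reduce {g : Polynomial (ZMod 2)} {m D : ℕ} (hg : toPoly m = g) (h1 : 2 ^ D ≤ m)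
    (h2 : m < 2 ^ (D + 1)) : ∃ ρ : AdjoinRoot g →ₗ[ZMod 2] Polynomial (ZMod 2),
      Function.Injective ρ ∧ ∀ r < 2 ^ D, ρ (AdjoinRoot.mkₐ g (toPoly r)) = toPoly r := by
  subst hg
  exact ⟨reduce (monic_toPoly h1 h2), (AdjoinRoot.mk_leftInverse (monic_toPoly h1 h2)).injective,
    fun r hr => reduce_mk h1 h2 hr⟩

end Conditions

/-! ### The linear system of nonics and its dimension. -/

section LinearSystem

open MvPolynomial

/-- The modulus of `F14`. -/
def mod14 : ℕ := 27987

/-- The modulus of `F5`. -/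
def mod5 : ℕ := 47

lemma toPoly_mod14 : toPoly mod14 = Polynomial.X ^ 14 + Polynomial.X ^ 13 + Polynomial.X ^ 11 +
    Polynomial.X ^ 10 + Polynomial.X ^ 8 + Polynomial.X ^ 6 + Polynomial.X ^ 4 + Polynomial.X +
    1 := by
  rw [toPoly_eq_expsPoly (D := 15) (by decide),
    show ((List.range 15).filter fun i => mod14.testBit i) = [0, 1, 4, 6, 8, 10, 11, 13, 14] by
      decide +kernel]
  simp only [expsPoly, List.map_cons, List.map_nil, List.sum_cons, List.sum_nil]
  ring

lemma toPoly_mod5 : toPoly mod5 = Polynomial.X ^ 5 + Polynomial.X ^ 3 + Polynomial.X ^ 2 +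
    Polynomial.X + 1 := by
  rw [toPoly_eq_expsPoly (D := 6) (by decide),
    show ((List.range 6).filter fun i => mod5.testBit i) = [0, 1, 2, 3, 5] by decide +kernel]
  simp only [expsPoly, List.map_cons, List.map_nil, List.sum_cons, List.sum_nil]
  ring

/-- The projection to `F14`. -/
noncomputable def mk14 : Polynomial (ZMod 2) →ₐ[ZMod 2] F14 := AdjoinRoot.mkₐ _

/-- The projection to `F5`. -/
noncomputable def mk5 : Polynomial (ZMod 2) →ₐ[ZMod 2] F5 := AdjoinRoot.mkₐ _

lemma mk14_mod14 : mk14 (toPoly mod14) = 0 := by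
  rw [toPoly_mod14]; exact AdjoinRoot.mk_self

lemma mk5_mod5 : mk5 (toPoly mod5) = 0 := by
  rw [toPoly_mod5]; exact AdjoinRoot.mk_self

/-- The coordinates of `Q`. -/
def expsQ : Fin 2 → List ℕ := ![[1, 2, 3, 4, 8, 9, 11, 12], [0, 1, 3, 5, 6, 7, 11, 12]]

/-- The coordinates of `R`. -/
def expsR : Fin 2 → List ℕ := ![[1, 2, 3, 4], [3, 4]]

lemma t14_pow {bits : List ℕ} {r : ℕ} (h : powCode mod14 14 bits = some r) (hr : r < 2 ^ 14) :
    t14 ^ (bits.foldl (fun n b => 2 * n + b) 0) =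
      mk14 (expsPoly ((List.range 14).filter fun i => r.testBit i)) := by
  rw [← toPoly_eq_expsPoly hr, map_powCode mk14 mk14_mod14 h]
  rfl

lemma t5_pow {bits : List ℕ} {r : ℕ} (h : powCode mod5 5 bits = some r) (hr : r < 2 ^ 5) :
    t5 ^ (bits.foldl (fun n b => 2 * n + b) 0) =
      mk5 (expsPoly ((List.range 5).filter fun i => r.testBit i)) := by
  rw [← toPoly_eq_expsPoly hr, map_powCode mk5 mk5_mod5 h]
  rfl

/-- The list holds the binary digits of 11898, and 6942 encodes the reduced power. -/
lemma pointQ_zero : pointQ 0 = mk14 (expsPoly (expsQ 0)) :=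
  t14_pow (bits := [1, 0, 1, 1, 1, 0, 0, 1, 1, 1, 1, 0, 1, 0]) (r := 6942) (by decide +kernel)
    (by decide)

lemma pointQ_one : pointQ 1 = mk14 (expsPoly (expsQ 1)) :=
  t14_pow (bits := [1, 0, 0, 0, 1, 0, 0, 1]) (r := 6379) (by decide +kernel) (by decide)

lemma pointR_zero : pointR 0 = mk5 (expsPoly (expsR 0)) :=
  t5_pow (bits := [1, 1, 0]) (r := 30) (by decide +kernel) (by decide)

lemma pointR_one : pointR 1 = mk5 (expsPoly (expsR 1)) :=
  t5_pow (bits := [1, 1, 1, 1]) (r := 24) (by decide +kernel) (by decide)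

/-- The values and partial derivatives of the monomials of degree `9` at `Q`. -/
def rowsQ : List (ℕ × ℕ × ℕ) := monos (jetActs mod14 14 (expsQ 0) (expsQ 1)) (1, 0, 0) 9

/-- The values of the monomials of degree `9` at `R`. -/
def rowsR : List ℕ := codes (mulActs mod5 5 [expsR 0, expsR 1, [0]]) 1 9

/-- The values of the monomials of degree `9` at `(X ^ 3, X ^ 4, 1)` modulo `X ^ 9`. -/
def rowsP : List ℕ := codes (mulActs 512 9 [[3], [4], [0]]) 1 9

/-- The conditions that define the linear system. -/
structure NonicConditions (f : MvPolynomial (Fin 3) (ZMod 2)) : Prop where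
  hom : f ∈ homogeneousSubmodule (Fin 3) (ZMod 2) 9
  valP : (binaryMk 512).comp (kron ![3, 4, 0]) f = 0
  valQ : aeval pointQ f = 0
  dxQ : aeval pointQ (pderiv 0 f) = 0
  dyQ : aeval pointQ (pderiv 1 f) = 0
  valR : aeval pointR f = 0

lemma rowsQ_spec : List.Forall₂ (fun f r => aeval pointQ f = mk14 (toPoly r.1) ∧
      aeval pointQ (pderiv 0 f) = mk14 (toPoly r.2.1) ∧
      aeval pointQ (pderiv 1 f) = mk14 (toPoly r.2.2))
      (monos (varActs (ZMod 2) vars3) 1 9) rowsQ :=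
  forall₂_jetActs mk14 mk14_mod14 pointQ_zero pointQ_one rfl 9

lemma rowsR_spec : List.Forall₂ (fun f r => aeval pointR f = mk5 (toPoly r))
    (monos (varActs (ZMod 2) vars3) 1 9) rowsR := by
  refine forall₂_mulActs (aeval pointR) mk5 mk5_mod5 5 ?_ 9
  refine List.Forall₂.cons ?_ (List.Forall₂.cons ?_ (List.Forall₂.cons ?_ List.Forall₂.nil))
  · rw [aeval_X]; exact pointR_zero
  · rw [aeval_X]; exact pointR_one
  · simp [expsPoly, pointR]

/-- The monomials of order at most 2 in `x`, `y` go to the distinct powers 0, 3, 4, 6, 7, 8 of `X`,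
those of higher order to multiples of `X ^ 9`. Vanishing modulo `512 = 2 ^ 9`, the code of `X ^ 9`,
therefore expresses the triple point at `P`. -/
lemma rowsP_spec : List.Forall₂ (fun f r => (binaryMk 512).comp (kron ![3, 4, 0]) f =
    binaryMk 512 (toPoly r)) (monos (varActs (ZMod 2) vars3) 1 9) rowsP :=
  forall₂_mulActs ((binaryMk 512).comp (kron ![3, 4, 0])) (binaryMk 512) (binaryMk_self 512) 9
    ((kron_vars ![3, 4, 0]).imp fun _ _ h => congrArg (binaryMk 512) h) 9

lemma forall₂_reduce_rows {A : Type*} [CommRing A] [Algebra (ZMod 2) A]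
    {π : Polynomial (ZMod 2) →ₐ[ZMod 2] A} {D : ℕ} {ρ : A →ₗ[ZMod 2] Polynomial (ZMod 2)}
    (hρ : ∀ r < 2 ^ D, ρ (π (toPoly r)) = toPoly r) {β : Type*} {c : β → ℕ}
    (Φ : MvPolynomial (Fin 3) (ZMod 2) →ₗ[ZMod 2] A)
    {ms : List (MvPolynomial (Fin 3) (ZMod 2))} {rs : List β}
    (h : List.Forall₂ (fun f r => Φ f = π (toPoly (c r))) ms rs)
    (hr : (rs.map c).all (fun r => Nat.blt r (2 ^ D)) = true) :
    List.Forall₂ (fun f r => (ρ.comp Φ) f = toPoly r) ms (rs.map c) := by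
  induction h with
  | nil => exact List.Forall₂.nil
  | cons h _ ih =>
    rw [List.map_cons, List.all_cons, Bool.and_eq_true] at hr
    refine List.Forall₂.cons ?_ (ih hr.2)
    rw [LinearMap.comp_apply, h, hρ _ (Nat.le_of_ble_eq_true hr.1)]

/-- The rows of the linear system of equations that defines the linear system. -/
def nonicRows : List ℕ :=
  shiftZip 14 (shiftZip 14 (shiftZip 14 (shiftZip 9 rowsR rowsP) (rowsQ.map fun r => r.2.2))
    (rowsQ.map fun r => r.2.1)) (rowsQ.map fun r => r.1)

/-- The solutions of the linear conditions are spanned by the five nonics. Here `640 = 10 * 64`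
exceeds the largest exponent `9 * 64`. The remaining bounds say that the codes are reduced, so that
they represent the values in the residue rings. -/
lemma nonicRows_check : (spanCheck 1000
    (multipleCodes [1, 64, 0] (nonicMasks.map fun n => (9, n)) 9)
    (kern 640 1000 (shiftZip 640 nonicRows (codes (shifts [1, 64, 0]) 1 9))) &&
  ((codes (shifts [1, 64, 0]) 1 9).all (fun r => Nat.blt r (2 ^ 640)) &&
  ((rowsR.map id).all (fun r => Nat.blt r (2 ^ 5)) &&
  ((rowsQ.map fun r => r.1).all (fun r => Nat.blt r (2 ^ 14)) &&
  ((rowsQ.map fun r => r.2.1).all (fun r => Nat.blt r (2 ^ 14)) &&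
  ((rowsQ.map fun r => r.2.2).all (fun r => Nat.blt r (2 ^ 14)) &&
  ((rowsP.map id).all (fun r => Nat.blt r (2 ^ 9))))))))) = true := by decide +kernel

end LinearSystem

section LinearSystem

open MvPolynomial

lemma mem_span_nonicForm_of_conditions {f : MvPolynomial (Fin 3) (ZMod 2)}
    (hf : NonicConditions f) : f ∈ Submodule.span (ZMod 2) (Set.range nonicForm) := by
  have hc := nonicRows_check
  simp only [Bool.and_eq_true] at hc
  obtain ⟨hspan, hB, hR, hQ, hQx, hQy, hP⟩ := hc
  obtain ⟨ρQ, -, hρQ⟩ := exists_reduce (D := 14) toPoly_mod14 (by decide) (by decide)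
  obtain ⟨ρR, -, hρR⟩ := exists_reduce (D := 5) toPoly_mod5 (by decide) (by decide)
  obtain ⟨ρP, -, hρP⟩ := exists_reduce (g := toPoly 512) (D := 9) rfl (by decide) (by decide)
  have eQ := forall₂_reduce_rows (π := mk14) hρQ (c := fun r : ℕ × ℕ × ℕ => r.1)
    (aeval pointQ).toLinearMap (rowsQ_spec.imp fun _ _ h => h.1) hQ
  have eQx := forall₂_reduce_rows (π := mk14) hρQ (c := fun r : ℕ × ℕ × ℕ => r.2.1)
    ((aeval pointQ).toLinearMap.comp (pderiv 0).toLinearMap)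
    (rowsQ_spec.imp fun _ _ h => h.2.1) hQx
  have eQy := forall₂_reduce_rows (π := mk14) hρQ (c := fun r : ℕ × ℕ × ℕ => r.2.2)
    ((aeval pointQ).toLinearMap.comp (pderiv 1).toLinearMap)
    (rowsQ_spec.imp fun _ _ h => h.2.2) hQy
  have eR := forall₂_reduce_rows (π := mk5) hρR (c := id) (aeval pointR).toLinearMap rowsR_spec hR
  have eP := forall₂_reduce_rows (π := binaryMk 512) hρP (c := id)
    ((binaryMk 512).comp (kron ![3, 4, 0])).toLinearMap rowsP_spec hP
  rw [List.map_id] at eR eP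
  have hT := forall₂_pack 14 (forall₂_pack 14 (forall₂_pack 14 (forall₂_pack 9 eR eP) eQy) eQx) eQ
  have hk := kron_mem_polySpan_kern (w := weights3) (B := 640) (fuel := 1000) mem_vars3 _ hT hB
    hf.hom (by
      have h1 := hf.valP
      have h2 := hf.valQ
      have h3 := hf.dxQ
      have h4 := hf.dyQ
      have h5 := hf.valR
      rw [AlgHom.comp_apply] at h1
      simp [h1, h2, h3, h4, h5])
  have hm := mem_span_multiples (w := weights3) (l := vars3) (d := 9) (kronInjective3 (by decide))
    (gens := nonicMasks.map fun n => (9, n)) (by simp [nonicMasks]) hspan hf.hom hk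
  refine Submodule.span_mono ?_ hm
  intro m hm
  obtain ⟨g, hg, hm⟩ := List.mem_flatMap.1 hm
  obtain ⟨n, hn, rfl⟩ := List.mem_map.1 hg
  rw [Nat.sub_self, monos_zero, List.mem_singleton] at hm
  obtain ⟨i, hi, rfl⟩ := List.mem_iff_getElem.1 hn
  refine ⟨⟨i, hi⟩, ?_⟩
  rw [hm, nonicForm, List.getD_eq_getElem _ _ hi]

/-- Among the conjugates, only `Q` and `R` themselves are needed. For `P`, the images of `x` and `y`
are multiples of `X ^ 3`, so the cube of the ideal of `P` goes to zero modulo `X ^ 9`. -/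
lemma conditions_of_mem_nonics {f : MvPolynomial (Fin 3) (ZMod 2)} (hf : f ∈ nonics) :
    NonicConditions f := by
  obtain ⟨⟨⟨hom, hP⟩, hQ⟩, hR⟩ := hf
  have hQ0 : f ∈ multAtLeast pointQ 2 := by
    have := (Submodule.mem_iInf _).1 hQ 0
    rwa [show frobConj pointQ ((0 : Fin 14) : ℕ) = pointQ from
      funext fun j => by simp [frobConj]] at this
  have hR0 : f ∈ multAtLeast pointR 1 := by
    have := (Submodule.mem_iInf _).1 hR 0
    rwa [show frobConj pointR ((0 : Fin 5) : ℕ) = pointR from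
      funext fun j => by simp [frobConj]] at this
  obtain ⟨h1, h2⟩ := jet_eq_zero_of_mem hQ0
  refine ⟨hom, ?_, h1, h2 0, h2 1, aeval_eq_zero_of_mem hR0⟩
  have hP' : f ∈ pointIdeal pointP ^ 3 := by
    have := mem_multAtLeast.1 hP
    rwa [Algebra.algebraMap_self, map_id] at this
  have hle : (pointIdeal pointP).map ((binaryMk 512).comp (kron ![3, 4, 0])) ≤
      Ideal.span {binaryMk 512 (Polynomial.X ^ 3)} := by
    rw [pointIdeal, Ideal.map_span, Ideal.span_le]
    rintro _ ⟨_, ⟨⟨i, j⟩, rfl⟩, rfl⟩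
    rw [SetLike.mem_coe, Ideal.mem_span_singleton]
    have h3 : ∀ i : Fin 3, binaryMk 512 (Polynomial.X ^ 3) ∣
        ((binaryMk 512).comp (kron ![3, 4, 0])) (X i) ∨ i = 2 := by
      intro i
      fin_cases i
      · exact Or.inl (by simp [kron])
      · exact Or.inl ⟨binaryMk 512 Polynomial.X, by simp [kron]; ring⟩
      · exact Or.inr rfl
    have h4 : ∀ i : Fin 3, i = 2 ∨ pointP i = 0 := by decide
    change _ ∣ ((binaryMk 512).comp (kron ![3, 4, 0])) (C (pointP i) * X j - C (pointP j) * X i)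
    have key : ∀ i j : Fin 3, i ≠ j → binaryMk 512 (Polynomial.X ^ 3) ∣
        ((binaryMk 512).comp (kron ![3, 4, 0])) (C (pointP i) * X j) := by
      intro i j hij
      rw [map_mul]
      rcases h3 j with h | rfl
      · exact dvd_mul_of_dvd_right h _
      · rw [(h4 i).resolve_left hij, map_zero, map_zero, zero_mul]
        exact dvd_zero _
    by_cases hij : i = j
    · rw [hij, sub_self, map_zero]
      exact dvd_zero _
    · rw [map_sub]
      exact dvd_sub (key i j hij) (key j i (Ne.symm hij))
  have h5 := Ideal.mem_map_of_mem ((binaryMk 512).comp (kron ![3, 4, 0])) hP'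
  rw [Ideal.map_pow] at h5
  have h6 := Ideal.pow_right_mono hle 3 h5
  rw [Ideal.span_singleton_pow, ← map_pow, ← pow_mul, ← toPoly_two_pow,
    show 1 <<< (3 * 3) = 512 by decide, binaryMk_self, Ideal.mem_span_singleton,
    zero_dvd_iff] at h6
  exact h6

lemma nonicForm_check : (nonicMasks.all fun n => Nat.beq 0 (xlin n (rowsQ.map fun r => r.1)) &&
    (Nat.beq 0 (xlin n (rowsQ.map fun r => r.2.1)) &&
    (Nat.beq 0 (xlin n (rowsQ.map fun r => r.2.2)) && Nat.beq 0 (xlin n rowsR)))) = true := by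
  decide +kernel

lemma apply_lin_of_forall₂ {A : Type*} [CommRing A] [Algebra (ZMod 2) A]
    {π : Polynomial (ZMod 2) →ₐ[ZMod 2] A} {β : Type*} {c : β → ℕ}
    (Φ : MvPolynomial (Fin 3) (ZMod 2) →ₗ[ZMod 2] A)
    {ms : List (MvPolynomial (Fin 3) (ZMod 2))} {rs : List β}
    (h : List.Forall₂ (fun f r => Φ f = π (toPoly (c r))) ms rs) (n : ℕ) :
    Φ (lin n ms) = π (toPoly (xlin n (rs.map c))) := by
  have h1 := map_lin Φ.toAddMonoidHom ms n
  have h2 := map_lin π.toLinearMap.toAddMonoidHom ((rs.map c).map toPoly) n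
  rw [lin_map_toPoly] at h2
  refine h1.trans (Eq.trans (congrArg (lin n) ?_) h2.symm)
  clear h1 h2
  induction h with
  | nil => rfl
  | cons h _ ih =>
    rw [List.map_cons, List.map_cons, List.map_cons, List.map_cons, ih]
    exact congrArg (fun x => x :: _) h

lemma nonicForm_mem_multAtLeast_pointP (i : Fin 5) : nonicForm i ∈ multAtLeast pointP 3 := by
  have hspan : ∀ i : Fin 5, spanCheck 1000
      -- In degree 3 the masks 1, 2, 8, 64 select `x³`, `x²y`, `xy²`, `y³`, which generate the cube
      -- of the ideal of `P`.
      (multipleCodes [1, 64, 0] [(3, 1), (3, 2), (3, 8), (3, 64)] 9)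
      [xlin (nonicMasks.getD i 0) (codes (shifts [1, 64, 0]) 1 9)] = true := by decide +kernel
  have h := span_multiples_le _ _ _ (mem_span_multiples (w := weights3) (l := vars3)
    (kronInjective3 (by decide)) (by decide) (hspan i) (nonicForm_homogeneous i)
    (by rw [nonicForm, kron_form]; exact toPoly_mem_polySpan (by simp; rfl)))
  rw [mem_multAtLeast, Algebra.algebraMap_self, map_id]
  refine (Ideal.span_le.2 ?_ : formIdeal vars3 [(3, 1), (3, 2), (3, 8), (3, 64)] ≤ _) h
  have h0 : (X 0 : MvPolynomial (Fin 3) (ZMod 2)) ∈ pointIdeal pointP :=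
    Ideal.subset_span ⟨(2, 0), by simp [pointP]⟩
  have h1 : (X 1 : MvPolynomial (Fin 3) (ZMod 2)) ∈ pointIdeal pointP :=
    Ideal.subset_span ⟨(2, 1), by simp [pointP]⟩
  have hmul : ∀ a b c : MvPolynomial (Fin 3) (ZMod 2), a ∈ pointIdeal pointP →
      b ∈ pointIdeal pointP → c ∈ pointIdeal pointP → a * (b * c) ∈ pointIdeal pointP ^ 3 :=
    fun a b c ha hb hc => by
      rw [pow_succ', pow_two]
      exact Ideal.mul_mem_mul ha (Ideal.mul_mem_mul hb hc)
  rintro _ ⟨g, hg, rfl⟩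
  simp only [List.mem_cons, List.not_mem_nil, or_false] at hg
  rcases hg with rfl | rfl | rfl | rfl <;>
    simp [form, vars3, varActs, monos, prep, lin] <;>
    exact hmul _ _ _ ‹_› ‹_› ‹_›

lemma nonicForm_mem_nonics (i : Fin 5) : nonicForm i ∈ nonics := by
  have hn : nonicMasks.getD i 0 ∈ nonicMasks := by
    revert i; decide
  have hc := List.all_eq_true.1 nonicForm_check _ hn
  simp only [Bool.and_eq_true] at hc
  obtain ⟨hQ, hQx, hQy, hR⟩ := hc
  have eQ : aeval pointQ (nonicForm i) = 0 := by
    have := apply_lin_of_forall₂ (π := mk14) (c := fun r : ℕ × ℕ × ℕ => r.1)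
      (aeval pointQ).toLinearMap (rowsQ_spec.imp fun _ _ h => h.1) (nonicMasks.getD i 0)
    rw [← Nat.eq_of_beq_eq_true hQ, toPoly_zero, map_zero] at this
    exact this
  have eQx : aeval pointQ (pderiv 0 (nonicForm i)) = 0 := by
    have := apply_lin_of_forall₂ (π := mk14) (c := fun r : ℕ × ℕ × ℕ => r.2.1)
      ((aeval pointQ).toLinearMap.comp (pderiv 0).toLinearMap)
      (rowsQ_spec.imp fun _ _ h => h.2.1) (nonicMasks.getD i 0)
    rw [← Nat.eq_of_beq_eq_true hQx, toPoly_zero, map_zero] at this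
    exact this
  have eQy : aeval pointQ (pderiv 1 (nonicForm i)) = 0 := by
    have := apply_lin_of_forall₂ (π := mk14) (c := fun r : ℕ × ℕ × ℕ => r.2.2)
      ((aeval pointQ).toLinearMap.comp (pderiv 1).toLinearMap)
      (rowsQ_spec.imp fun _ _ h => h.2.2) (nonicMasks.getD i 0)
    rw [← Nat.eq_of_beq_eq_true hQy, toPoly_zero, map_zero] at this
    exact this
  have eR : aeval pointR (nonicForm i) = 0 := by
    have := apply_lin_of_forall₂ (π := mk5) (c := id)
      (aeval pointR).toLinearMap rowsR_spec (nonicMasks.getD i 0)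
    rw [List.map_id, ← Nat.eq_of_beq_eq_true hR, toPoly_zero, map_zero] at this
    exact this
  refine ⟨⟨⟨nonicForm_homogeneous i, nonicForm_mem_multAtLeast_pointP i⟩, ?_⟩, ?_⟩
  · refine (Submodule.mem_iInf _).2 fun j => mem_multAtLeast_two (d := 8) (one_pow _)
      (nonicForm_homogeneous i) ?_ ?_ ?_
    · rw [aeval_frobConj, eQ, zero_pow (by positivity)]
    · rw [aeval_frobConj, eQx, zero_pow (by positivity)]
    · rw [aeval_frobConj, eQy, zero_pow (by positivity)]
  · refine (Submodule.mem_iInf _).2 fun j => mem_multAtLeast_one (d := 9) (one_pow _)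
      (nonicForm_homogeneous i) ?_
    rw [aeval_frobConj, eR, zero_pow (by positivity)]

theorem nonics_eq_span : nonics = Submodule.span (ZMod 2) (Set.range nonicForm) := by
  refine le_antisymm (fun f hf => mem_span_nonicForm_of_conditions (conditions_of_mem_nonics hf)) ?_
  rw [Submodule.span_le]
  rintro _ ⟨i, rfl⟩
  exact nonicForm_mem_nonics i

/-- A relation between the nonics is a linear form killed by `paramHom`; the check in degree 1 with
no generators shows that it is zero. -/
theorem linearIndependent_nonicForm : LinearIndependent (ZMod 2) nonicForm := by
  rw [Fintype.linearIndependent_iff]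
  intro c hc i
  have hlin : ∑ j, C (c j) * X j ∈ homogeneousSubmodule (Fin 5) (ZMod 2) 1 :=
    sum_mem fun j _ => by
      rw [← smul_eq_C_mul]; exact Submodule.smul_mem _ _ (isHomogeneous_X _ j)
  have h0 : paramHom (∑ j, C (c j) * X j) = 0 := by
    rw [← hc, map_sum]
    exact Finset.sum_congr rfl fun j _ => by
      rw [← smul_eq_C_mul, map_smul, paramHom_X]
  have h := mem_span_of_paramHom_eq_zero (d := 1) (B := 640) (by decide) (gens := [])
    (by decide +kernel) hlin h0
  have h1 : (∑ j, C (c j) * X j : MvPolynomial (Fin 5) (ZMod 2)) = 0 := by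
    simpa [multiples] using h
  have h2 := congrArg (eval (Pi.single i 1)) h1
  simpa [Pi.single_apply] using h2

/-- The basis of the linear system that consists of the five nonics. -/
noncomputable def nonicBasis : Module.Basis (Fin 5) (ZMod 2) nonics :=
  (Module.Basis.span linearIndependent_nonicForm).map
    (LinearEquiv.ofEq _ _ nonics_eq_span.symm)

lemma coe_nonicBasis (i : Fin 5) :
    (nonicBasis i : MvPolynomial (Fin 3) (ZMod 2)) = nonicForm i := by
  rw [nonicBasis, Module.Basis.map_apply, LinearEquiv.coe_ofEq_apply, Module.Basis.span_apply]

end LinearSystem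

/-! ### Invariance under linear changes of coordinates. -/

section CoordinateChange

open MvPolynomial

variable {k : Type*} [Field k]

/-- The substitution of linear forms with the given matrix of coefficients. -/
noncomputable def linSubst (A : Matrix (Fin 5) (Fin 5) k) :
    MvPolynomial (Fin 5) k →ₐ[k] MvPolynomial (Fin 5) k :=
  aeval fun i => ∑ j, C (A i j) * X j

lemma linSubst_X (A : Matrix (Fin 5) (Fin 5) k) (i : Fin 5) :
    linSubst A (X i) = ∑ j, C (A i j) * X j := aeval_X _ _

lemma linSubst_comp (A B : Matrix (Fin 5) (Fin 5) k) :
    (linSubst A).comp (linSubst B) = linSubst (B * A) := by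
  refine algHom_ext fun i => ?_
  rw [AlgHom.comp_apply, linSubst_X, linSubst_X, map_sum]
  simp only [map_mul, linSubst_X, algHom_C, algebraMap_eq, Matrix.mul_apply, map_sum,
    Finset.mul_sum, Finset.sum_mul]
  rw [Finset.sum_comm]
  simp only [mul_assoc]

lemma linSubst_one : linSubst (1 : Matrix (Fin 5) (Fin 5) k) = AlgHom.id k _ := by
  refine algHom_ext fun i => ?_
  rw [linSubst_X, AlgHom.id_apply, Finset.sum_eq_single i]
  · simp
  · intro j _ hj
    simp [Matrix.one_apply_ne hj.symm]
  · simp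

/-- An invertible linear change of coordinates. -/
noncomputable def linEquiv (g : Matrix.GeneralLinearGroup (Fin 5) k) :
    MvPolynomial (Fin 5) k ≃ₐ[k] MvPolynomial (Fin 5) k :=
  AlgEquiv.ofAlgHom (linSubst g.1) (linSubst g⁻¹.1)
    (by rw [linSubst_comp, ← Units.val_mul, inv_mul_cancel, Units.val_one, linSubst_one])
    (by rw [linSubst_comp, ← Units.val_mul, mul_inv_cancel, Units.val_one, linSubst_one])

variable (g : Matrix.GeneralLinearGroup (Fin 5) k)

lemma linEquiv_symm : (linEquiv g).symm = linEquiv g⁻¹ := by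
  ext1 f
  rfl

lemma map_linEquiv (I : Ideal (MvPolynomial (Fin 5) k)) :
    I.map (aeval (R := k) fun i => ∑ j, C ((g : Matrix (Fin 5) (Fin 5) k) i j) *
      (X j : MvPolynomial (Fin 5) k)) = I.map (linEquiv g) := rfl

lemma linEquiv_homogeneous {f : MvPolynomial (Fin 5) k} {d : ℕ} (hf : f.IsHomogeneous d) :
    (linEquiv g f).IsHomogeneous d := by
  have h := hf.aeval (fun i => ∑ j, C (g.1 i j) * (X j : MvPolynomial (Fin 5) k)) (n := 1)
    fun i => IsHomogeneous.sum _ _ _ fun j _ => by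
      have := (isHomogeneous_C (Fin 5) (g.1 i j)).mul (isHomogeneous_X k j)
      rwa [zero_add] at this
  rwa [one_mul] at h

lemma linEquiv_homogeneous_iff {f : MvPolynomial (Fin 5) k} {d : ℕ} :
    (linEquiv g f).IsHomogeneous d ↔ f.IsHomogeneous d := by
  refine ⟨fun h => ?_, linEquiv_homogeneous g⟩
  have := linEquiv_homogeneous g⁻¹ h
  rwa [← linEquiv_symm, AlgEquiv.symm_apply_apply] at this

/-- The linear automorphism of the space of coordinate vectors that belongs to a change of
coordinates. -/
noncomputable def vecEquiv : (Fin 5 → k) ≃ₗ[k] (Fin 5 → k) :=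
  LinearEquiv.ofLinearMap (Matrix.mulVecLin g.1) (Matrix.mulVecLin g⁻¹.1)
    (by rw [← Matrix.mulVecLin_mul, ← Units.val_mul, mul_inv_cancel, Units.val_one,
      Matrix.mulVecLin_one])
    (by rw [← Matrix.mulVecLin_mul, ← Units.val_mul, inv_mul_cancel, Units.val_one,
      Matrix.mulVecLin_one])

lemma eval_linEquiv (v : Fin 5 → k) (f : MvPolynomial (Fin 5) k) :
    eval v (linEquiv g f) = eval (vecEquiv g v) f := by
  have h : (aeval v).comp (linSubst g.1) = aeval (R := k) (vecEquiv g v) := by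
    refine algHom_ext fun i => ?_
    rw [AlgHom.comp_apply, linSubst_X, aeval_X, map_sum]
    simp only [map_mul, aeval_C, aeval_X]
    rfl
  exact DFunLike.congr_fun h f

lemma mem_map_linEquiv {I : Ideal (MvPolynomial (Fin 5) k)} {f : MvPolynomial (Fin 5) k} :
    linEquiv g f ∈ I.map (linEquiv g) ↔ f ∈ I := by
  refine ⟨fun h => ?_, Ideal.mem_map_of_mem _⟩
  obtain ⟨f', hf', he⟩ := (Ideal.mem_map_iff_of_surjective _ (linEquiv g).surjective).1 h
  rwa [← (linEquiv g).injective he]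

lemma hilbertFn_map (I : Ideal (MvPolynomial (Fin 5) k)) (d : ℕ) :
    hilbertFn (I.map (linEquiv g)) d = hilbertFn I d := by
  let e : homogeneousSubmodule (Fin 5) k d ≃ₗ[k] homogeneousSubmodule (Fin 5) k d :=
    LinearEquiv.ofSubmodules (linEquiv g).toLinearEquiv _ _ (by
      refine le_antisymm ?_ fun f hf => ?_
      · rintro _ ⟨f, hf, rfl⟩
        exact linEquiv_homogeneous g hf
      · refine ⟨(linEquiv g).symm f, ?_, (linEquiv g).apply_symm_apply f⟩
        refine (linEquiv_homogeneous_iff g).1 ?_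
        rwa [AlgEquiv.apply_symm_apply])
  refine (LinearEquiv.finrank_eq (Submodule.Quotient.equiv _ _ e ?_)).symm
  refine le_antisymm ?_ fun f hf => ?_
  · rintro _ ⟨f, hf, rfl⟩
    exact (mem_map_linEquiv g).2 hf
  · refine ⟨e.symm f, ?_, e.apply_symm_apply f⟩
    have h : linEquiv g (e.symm f) = f := congrArg Subtype.val (e.apply_symm_apply f)
    refine (mem_map_linEquiv g).1 ?_
    change linEquiv g (e.symm f) ∈ _
    rw [h]
    exact hf

lemma hasLength_map {I : Ideal (MvPolynomial (Fin 5) k)} {n : ℕ} :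
    HasLength (I.map (linEquiv g)) n ↔ HasLength I n := by
  simp only [HasLength, hilbertFn_map]

/-- Substitution in forms is dual to the action on vectors, so the ideal of the transformed line is
carried back to that of `L`. -/
lemma linearIdeal_map (L : Submodule k (Fin 5 → k)) :
    (linearIdeal (L.map (vecEquiv g).toLinearMap)).map (linEquiv g) = linearIdeal L := by
  rw [linearIdeal, Ideal.map_span, linearIdeal]
  congr 1
  refine Set.Subset.antisymm ?_ fun f hf => ?_
  · rintro _ ⟨f, ⟨hf, hL⟩, rfl⟩
    refine ⟨linEquiv_homogeneous g hf, fun v hv => ?_⟩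
    exact (eval_linEquiv g v f).trans (hL _ (Submodule.mem_map_of_mem hv))
  · refine ⟨(linEquiv g).symm f, ⟨?_, ?_⟩, (linEquiv g).apply_symm_apply f⟩
    · refine (linEquiv_homogeneous_iff g).1 ?_
      rw [AlgEquiv.apply_symm_apply]
      exact hf.1
    · rintro _ ⟨v, hv, rfl⟩
      have := eval_linEquiv g v ((linEquiv g).symm f)
      rw [AlgEquiv.apply_symm_apply] at this
      exact this.symm.trans (hf.2 v hv)

lemma mem_secants_map {n : ℕ} {I : Ideal (MvPolynomial (Fin 5) k)}
    {L : Submodule k (Fin 5 → k)} : L ∈ secants n (I.map (linEquiv g)) ↔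
      L.map (vecEquiv g).toLinearMap ∈ secants n I := by
  refine and_congr ?_ ?_
  · rw [show Module.finrank k (L.map (vecEquiv g).toLinearMap) = Module.finrank k L from
      LinearEquiv.finrank_map_eq (vecEquiv g) L]
  · rw [← linearIdeal_map g L, ← Ideal.map_sup, hasLength_map]

lemma encard_secants_map (n : ℕ) (I : Ideal (MvPolynomial (Fin 5) k)) :
    (secants n (I.map (linEquiv g))).encard = (secants n I).encard := by
  have h : secants n (I.map (linEquiv g)) =
      (Submodule.orderIsoMapComap (vecEquiv g)) ⁻¹' secants n I :=
    Set.ext fun L => mem_secants_map g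
  rw [h]
  exact Set.encard_preimage_of_bijective (Submodule.orderIsoMapComap (vecEquiv g)).bijective _

lemma mem_cone_map {I : Ideal (MvPolynomial (Fin 5) k)} {v : Fin 5 → k} :
    v ∈ cone (I.map (linEquiv g)) ↔ vecEquiv g v ∈ cone I := by
  constructor
  · intro h f hf
    rw [← eval_linEquiv]
    exact h _ (Ideal.mem_map_of_mem _ hf)
  · intro h f hf
    rw [← (linEquiv g).apply_symm_apply f] at hf ⊢
    rw [eval_linEquiv]
    exact h _ ((mem_map_linEquiv g).1 hf)

lemma quinticPart_map (I : Ideal (MvPolynomial (Fin 5) k)) :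
    quinticPart (I.map (linEquiv g)) = (quinticPart I).map (linEquiv g) := by
  rw [quinticPart, quinticPart, Ideal.map_span]
  congr 1
  refine Set.Subset.antisymm (fun f hf => ?_) ?_
  · obtain ⟨hf, d, hd, hfd⟩ := hf
    rw [← (linEquiv g).apply_symm_apply f] at hf hfd
    exact ⟨(linEquiv g).symm f, ⟨(mem_map_linEquiv g).1 hf, d, hd,
      (linEquiv_homogeneous_iff g).1 hfd⟩, (linEquiv g).apply_symm_apply f⟩
  · rintro _ ⟨f, ⟨hf, d, hd, hfd⟩, rfl⟩
    exact ⟨(mem_map_linEquiv g).2 hf, d, hd, linEquiv_homogeneous g hfd⟩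

variable {R : Type*} [Field R] [Algebra R k]

/-- Extension of scalars for a change of coordinates. -/
noncomputable def glOver (g : Matrix.GeneralLinearGroup (Fin 5) R) (k : Type*) [Field k]
    [Algebra R k] : Matrix.GeneralLinearGroup (Fin 5) k :=
  Matrix.GeneralLinearGroup.map (algebraMap R k) g

lemma map_linEquiv_map (g : Matrix.GeneralLinearGroup (Fin 5) R)
    (I : Ideal (MvPolynomial (Fin 5) R)) :
    (I.map (linEquiv g)).map (MvPolynomial.map (algebraMap R k)) =
      (I.map (MvPolynomial.map (algebraMap R k))).map (linEquiv (glOver g k)) := by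
  have h : (MvPolynomial.map (algebraMap R k)).comp (linSubst g.1).toRingHom =
      (linSubst (glOver g k).1).toRingHom.comp (MvPolynomial.map (algebraMap R k)) := by
    refine ringHom_ext (fun r => ?_) fun i => ?_
    · simp
    · simp [linSubst_X, glOver]
  have h1 := Ideal.map_map (I := I) (linSubst g.1).toRingHom (MvPolynomial.map (algebraMap R k))
  have h2 := Ideal.map_map (I := I) (MvPolynomial.map (algebraMap R k))
    (linSubst (glOver g k).1).toRingHom
  rw [h] at h1
  exact h1.trans h2.symm

end CoordinateChange

/-! ### Arbitrary bases of the linear system, and the theorem. -/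

section Main

open MvPolynomial

/-- The parametrization by `b` is `paramHom` after the linear substitution `h`. Its kernel is the
preimage of `surface` under `h`, that is, the image under `h⁻¹`. -/
lemma surfaceIdeal_eq_map (b : Module.Basis (Fin 5) (ZMod 2) nonics) :
    ∃ g : Matrix.GeneralLinearGroup (Fin 5) (ZMod 2),
      surfaceIdeal b = surface.map (linEquiv g) := by
  have hinv := nonicBasis.toMatrix_mul_toMatrix_flip b
  have hinv' := b.toMatrix_mul_toMatrix_flip nonicBasis
  -- Transposes occur because `toMatrix` stores the coordinates of a vector in a column, while
  -- `linSubst` reads the coefficients of a linear form from a row.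
  let h : Matrix.GeneralLinearGroup (Fin 5) (ZMod 2) :=
    ⟨(nonicBasis.toMatrix b).transpose, (b.toMatrix nonicBasis).transpose, by
      rw [← Matrix.transpose_mul, hinv', Matrix.transpose_one], by
      rw [← Matrix.transpose_mul, hinv, Matrix.transpose_one]⟩
  have hb : aeval (R := ZMod 2) (fun i => (b i : MvPolynomial (Fin 3) (ZMod 2))) =
      paramHom.comp (linSubst h.1) := by
    refine algHom_ext fun i => ?_
    rw [aeval_X, AlgHom.comp_apply, linSubst_X, map_sum]
    have h1 := congrArg (fun x : nonics => (x : MvPolynomial (Fin 3) (ZMod 2)))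
      (nonicBasis.sum_toMatrix_smul_self b i)
    simp only [AddSubmonoidClass.coe_finsetSum, Submodule.coe_smul, coe_nonicBasis] at h1
    rw [← h1]
    refine Finset.sum_congr rfl fun j _ => ?_
    rw [map_mul, paramHom_X, algHom_C, algebraMap_eq, smul_eq_C_mul]
    rfl
  refine ⟨h⁻¹, ?_⟩
  ext f
  rw [surfaceIdeal, hb, ← (linEquiv h⁻¹).apply_symm_apply f, mem_map_linEquiv, ← ker_paramHom,
    RingHom.mem_ker, RingHom.mem_ker, AlgEquiv.apply_symm_apply, linEquiv_symm, inv_inv]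
  rfl

lemma surfaceIdealOver_eq_map (b : Module.Basis (Fin 5) (ZMod 2) nonics) (K : Type*) [Field K]
    [Algebra (ZMod 2) K] : ∃ g : Matrix.GeneralLinearGroup (Fin 5) K,
      surfaceIdealOver b K = (surfaceOver K).map (linEquiv g) := by
  obtain ⟨g, hg⟩ := surfaceIdeal_eq_map b
  refine ⟨glOver g K, ?_⟩
  rw [surfaceIdealOver, hg]
  exact map_linEquiv_map g surface

lemma encard_secants_surfaceOver (K : Type*) [Field K] [Algebra (ZMod 2) K] :
    (secants 6 (surfaceOver K)).encard = 2 := by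
  rw [secants_surfaceOver, Set.encard_pair (secantLine_injective K)]

end Main

end SecantSurface
theorem proposition2p4 :
    Module.finrank (ZMod 2) SecantSurface.nonics = 5 ∧
    ∀ (b : Module.Basis (Fin 5) (ZMod 2) SecantSurface.nonics)
      (K : Type*) [Field K] [Algebra (ZMod 2) K],
      -- exactly two 6-secant lines, and no line meets `S` in a finite scheme of greater length
      (SecantSurface.secants 6 (SecantSurface.surfaceIdealOver b K)).encard = 2 ∧
      (∀ n : ℕ, 6 < n → SecantSurface.secants n (SecantSurface.surfaceIdealOver b K) = ∅) ∧
      -- the 6-secants are the extra components of the zero locus of the quartics and quintics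
      -- through `S`
      SecantSurface.cone (SecantSurface.quinticPart (SecantSurface.surfaceIdealOver b K)) =
        SecantSurface.cone (SecantSurface.surfaceIdealOver b K) ∪
          (⋃ L ∈ SecantSurface.secants 6 (SecantSurface.surfaceIdealOver b K),
            (L : Set (Fin 5 → K))) ∧
      -- `S` lies in no family whose members have 0, 1 or infinitely many 6-secants
      (∀ family : Set (Ideal (MvPolynomial (Fin 5) K)),
        (∀ I ∈ family, (SecantSurface.secants 6 I).encard = 0 ∨
          (SecantSurface.secants 6 I).encard = 1 ∨ (SecantSurface.secants 6 I).encard = ⊤) →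
        ∀ J, SecantSurface.ProjEquiv (SecantSurface.surfaceIdealOver b K) J → J ∉ family) := by
  refine ⟨by simpa using Module.finrank_eq_card_basis SecantSurface.nonicBasis,
    fun b K _ _ => ?_⟩
  obtain ⟨g, hg⟩ := SecantSurface.surfaceIdealOver_eq_map b K
  have hcard : (SecantSurface.secants 6 (SecantSurface.surfaceIdealOver b K)).encard = 2 := by
    rw [hg, SecantSurface.encard_secants_map, SecantSurface.encard_secants_surfaceOver]
  refine ⟨hcard, fun n hn => ?_, ?_, fun family hfam J hJ hmem => ?_⟩
  · rw [← Set.encard_eq_zero, hg, SecantSurface.encard_secants_map,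
      SecantSurface.secants_surfaceOver_eq_empty K hn, Set.encard_empty]
  · ext v
    rw [hg, SecantSurface.quinticPart_map, SecantSurface.mem_cone_map,
      SecantSurface.cone_quinticPart_surfaceOver, Set.mem_union, Set.mem_union,
      SecantSurface.mem_cone_map]
    refine or_congr_right ?_
    simp only [Set.mem_iUnion, SetLike.mem_coe, exists_prop]
    constructor
    · rintro ⟨L, hL, hv⟩
      -- The secants of the transformed surface are the preimages of those of the reference surface.
      refine ⟨L.comap (SecantSurface.vecEquiv g).toLinearMap, ?_, hv⟩
      rw [SecantSurface.mem_secants_map, Submodule.map_comap_eq_of_surjective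
        (SecantSurface.vecEquiv g).surjective]
      exact hL
    · rintro ⟨L, hL, hv⟩
      exact ⟨_, (SecantSurface.mem_secants_map g).1 hL, Submodule.mem_map_of_mem hv⟩
  · obtain ⟨h, rfl⟩ := hJ
    have h2 := hfam _ hmem
    -- A projectively equivalent subscheme also has exactly two 6-secants, and 2 is none of 0, 1,
    -- `⊤`.
    rw [SecantSurface.map_linEquiv, SecantSurface.encard_secants_map, hcard] at h2
    rcases h2 with h2 | h2 | h2
    · exact absurd h2 (by norm_num)
    · exact absurd h2 (by norm_num)
    · exact absurd h2 (by decide)
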